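/- Let $\mathbb{F}_q$ be a finite field with $q$ elements, $A=\mathbb{F}_q[T]$, $K=\mathbb{F}_q(T)$, let $K_\infty=\mathbb{F}_q((1/T))$ be the completion of $K$ for the absolute value with $|P|=q^{\deg P}$ ($P\in A\setminus\{0\}$), and let $\mathbb{C}_\infty$ be the completion of an algebraic closure of $K_\infty$. Put $\Omega=\mathbb{C}_\infty\setminus K_\infty$ and $|z|_i=\inf_{x\in K_\infty}|z-x|$. Let $\Gamma$ be an arithmetic subgroup of $\mathrm{GL}_2(A)$, that is, a subgroup of finite index; it acts on $\Omega$ by fractional linear transformations. Let $\mathcal{Z}$ be the center of $\mathrm{GL}_2(K_\infty)$, $\widetilde\Gamma=\Gamma/(\Gamma\cap\mathcal{Z})$ and $\overline\Gamma=\Gamma^{\mathrm{ab}}/\mathrm{Tor}(\Gamma^{\mathrm{ab}})$. For $\alpha\in\overline\Gamma$ let $u_\alpha$ be the function on $\Omega$ given by $$u_\alpha(z)=\prod_{\gamma\in\widetilde\Gamma}\frac{z-\gamma\omega}{z-\gamma a\omega},$$ where $a\in\Gamma$ is a representative of $\alpha$ and $\omega$ is a point of $\Omega$ outside the orbit $\Gamma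 z$; it depends neither on the choice of $a$ nor on that of $\omega$. For $s\in K=\mathbb{P}^1(K)\setminus\{\infty\}$ let $\rho=\begin{pmatrix}s&1\\1&0\end{pmatrix}$, so that $\rho\infty=s$ and $\rho w=s+1/w$, let $\mathfrak{b}_s$ be the set of all $b\in K$ with $\rho\begin{pmatrix}1&b\\0&1\end{pmatrix}\rho^{-1}\in\Gamma$, and put $e_s(w)=w\prod_{0\ne b\in\mathfrak{b}_s}(1-w/b)$. A function $f$ on $\Omega$ is said to continue holomorphically to the cusp $s$ with value $v\in\mathbb{C}_\infty$ if there are a function $G$ that is given by a convergent power series near $0$, with $G(0)=v$, and a real number $R$ such that $f(s+1/w)=G(1/e_s(w))$ for all $w\in\Omega$ with $|w|_i\ge R$. **Theorem.** Let $\alpha\in\overline\Gamma$, let $a\in\Gamma$ be any representative of $\alpha$, let $\omega\in\Omega$, and let $s\in\mathbb{P}^1(K)\setminus\{\infty\}$. Then the product $$\prod_{\gamma\in\widetilde\Gamma}\frac{s-\gamma\omega}{s-\gamma a\omega}$$ converges, $u_\alpha$ continues holomorphically to the cusp $s$, and the value of the continuation at $s$ is uniquely determined and equals this product: $$u_\alpha(s)=\prod_{\gamma\in\widetilde\Gamma}\frac{s-\gamma\omega}{s-\gamma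 a\omega}.$$ -/

import Mathlib

open Polynomial

noncomputable section

namespace Drinfeld

/-! ### The fields `K_∞` and `C_∞` -/

section Fields

variable (F : Type*) [Field F]

/-- `K_∞ = F((1/T))`, the completion of `K = F(T)` at the place `∞`. -/
abbrev Kinf : Type _ :=
  @RatFunc.CompletionAtInfty F _ (Classical.decEq (RatFunc F))

instance : CompleteSpace (Kinf F) := by
  let := Classical.decEq (RatFunc F)
  let := RatFunc.inftyValued F
  exact inferInstanceAs (CompleteSpace (UniformSpace.Completion (RatFunc F)))

/-- The inclusion `A = F[T] → K_∞`. -/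
def polyToKinf : F[X] →+* Kinf F :=
  (algebraMap (RatFunc F) (Kinf F)).comp (algebraMap F[X] (RatFunc F))

variable [Finite F]

lemma one_lt_natCard : (1 : NNReal) < (Nat.card F : NNReal) := by
  exact_mod_cast Finite.one_lt_card

/-- The valuation of `K_∞` takes `T` to `exp 1`; the associated real absolute value is
normalised by `|T| = q`, where `q` is the number of elements of `F`. -/
instance rankOneKinf :
    Valuation.RankOne (Valued.v : Valuation (Kinf F) (WithZero (Multiplicative ℤ))) where
  hom' := (WithZeroMulInt.toNNReal (one_lt_natCard F).ne_zero).comp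
    MonoidWithZeroHom.ValueGroup₀.embedding
  strictMono' := (WithZeroMulInt.toNNReal_strictMono (one_lt_natCard F)).comp
    MonoidWithZeroHom.ValueGroup₀.embedding_strictMono
  exists_val_nontrivial := by
    let := Classical.decEq (RatFunc F)
    let := RatFunc.inftyValued F
    refine ⟨algebraMap (RatFunc F) (Kinf F) RatFunc.X, ?_⟩
    have h : (Valued.v (algebraMap (RatFunc F) (Kinf F) RatFunc.X) :
        WithZero (Multiplicative ℤ)) = WithZero.exp 1 :=
      (Valued.extensionValuation_apply_coe (RatFunc.X : RatFunc F)).trans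
        (RatFunc.inftyValuation.X F)
    rw [h]
    constructor
    · simp
    · simp [← WithZero.exp_zero]

instance nontriviallyNormedFieldKinf : NontriviallyNormedField (Kinf F) :=
  Valued.toNontriviallyNormedField (Kinf F) (WithZero (Multiplicative ℤ))

instance : IsUltrametricDist (Kinf F) :=
  ⟨fun x y z => by
    have h := Valued.isNonarchimedean_norm (Kinf F) (WithZero (Multiplicative ℤ)) (x - y) (y - z)
    rw [sub_add_sub_cancel] at h
    rw [dist_eq_norm, dist_eq_norm, dist_eq_norm]
    exact h⟩

/-- The absolute value of `K_∞` restricts to `|P| = q ^ deg P` on nonzero polynomials. -/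
lemma norm_polyToKinf {P : F[X]} (hP : P ≠ 0) :
    ‖polyToKinf F P‖ = (Nat.card F : ℝ) ^ P.natDegree := by
  let := Classical.decEq (RatFunc F)
  let := RatFunc.inftyValued F
  have h : (Valued.v (polyToKinf F P) : WithZero (Multiplicative ℤ)) =
      WithZero.exp (P.natDegree : ℤ) :=
    (Valued.extensionValuation_apply_coe (algebraMap F[X] (RatFunc F) P)).trans
      (RatFunc.inftyValuation.polynomial F hP)
  have h2 : ‖polyToKinf F P‖ = ((WithZeroMulInt.toNNReal (one_lt_natCard F).ne_zero
      (MonoidWithZeroHom.ValueGroup₀.embedding (Valued.v.restrict (polyToKinf F P))) : NNReal)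
        : ℝ) := rfl
  rw [h2, Valuation.embedding_restrict, h]
  rw [WithZeroMulInt.toNNReal_neg_apply _ WithZero.exp_ne_zero]
  simp [WithZero.exp]

/-- An algebraic closure of `K_∞`, with the unique extension of the absolute value. -/
abbrev KinfBar : Type _ := AlgebraicClosure (Kinf F)

instance nontriviallyNormedFieldKinfBar : NontriviallyNormedField (KinfBar F) :=
  spectralNorm.nontriviallyNormedField (Kinf F) (KinfBar F)

instance normedAlgebraKinfBar : NormedAlgebra (Kinf F) (KinfBar F) :=
  spectralNorm.normedAlgebra (Kinf F) (KinfBar F)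

/-- `C_∞`, the completion of an algebraic closure of `K_∞`. -/
abbrev Cinf : Type _ := UniformSpace.Completion (KinfBar F)

instance nontriviallyNormedFieldCinf : NontriviallyNormedField (Cinf F) where
  non_trivial := by
    obtain ⟨x, hx⟩ := NontriviallyNormedField.non_trivial (α := KinfBar F)
    exact ⟨(x : Cinf F), by rwa [UniformSpace.Completion.norm_coe]⟩

/-- The inclusion `K_∞ → C_∞`. -/
def kinfToC : Kinf F →+* Cinf F :=
  (algebraMap (KinfBar F) (Cinf F)).comp (algebraMap (Kinf F) (KinfBar F))

/-- The inclusion `K = F(T) → C_∞`. -/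
def ratToC : RatFunc F →+* Cinf F :=
  (kinfToC F).comp (algebraMap (RatFunc F) (Kinf F))

/-- The inclusion `A = F[T] → C_∞`. -/
def polyToC : F[X] →+* Cinf F :=
  (kinfToC F).comp (polyToKinf F)

end Fields

/-! ### The upper half-plane and the group action -/

section Action

variable {F : Type*} [Field F] [Finite F]

/-- The Drinfeld upper half-plane `Ω = C_∞ - K_∞`. -/
def upperHalfPlane (F : Type*) [Field F] [Finite F] : Set (Cinf F) :=
  (Set.range (kinfToC F))ᶜ

/-- The imaginary part `|z|_i = inf {|z - x| : x ∈ K_∞}`. -/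
def imagPart (z : Cinf F) : ℝ :=
  Metric.infDist z (Set.range (kinfToC F))

/-- The fractional linear transformation `z ↦ (a z + b) / (c z + d)`. -/
def moebius (g : GL (Fin 2) F[X]) (z : Cinf F) : Cinf F :=
  (polyToC F (g 0 0) * z + polyToC F (g 0 1)) / (polyToC F (g 1 0) * z + polyToC F (g 1 1))

/-- `Γ ∩ 𝒵`, as a subgroup of `Γ`, where `𝒵` is the center of `GL₂(K_∞)`. -/
def centralPart (Γ : Subgroup (GL (Fin 2) F[X])) : Subgroup Γ :=
  ((Subgroup.center (GL (Fin 2) (Kinf F))).comap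
    (Matrix.GeneralLinearGroup.map (polyToKinf F))).subgroupOf Γ

/-- `Γ̃ = Γ / (Γ ∩ 𝒵)`. -/
abbrev GammaTilde (Γ : Subgroup (GL (Fin 2) F[X])) : Type _ :=
  Γ ⧸ centralPart Γ

lemma moebius_mul_of_central (g h : GL (Fin 2) F[X])
    (hh : Matrix.GeneralLinearGroup.map (polyToKinf F) h ∈
      Subgroup.center (GL (Fin 2) (Kinf F))) (z : Cinf F) :
    moebius (g * h) z = moebius g z := by
  obtain ⟨x, hx⟩ := Matrix.GeneralLinearGroup.mem_center_iff_val_mem_range_scalar.mp hh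
  have e : ∀ i j, polyToKinf F (h i j) = Matrix.scalar (Fin 2) x i j := fun i j => by
    rw [hx]; rfl
  have e' : ∀ i j, polyToC F (h i j) = kinfToC F (Matrix.scalar (Fin 2) x i j) := fun i j =>
    congrArg (kinfToC F) (e i j)
  have hx0 : x ≠ 0 := by
    rintro rfl
    have := (Matrix.GeneralLinearGroup.map (polyToKinf F) h).isUnit
    rw [← hx] at this
    simp at this
  have hx1 : kinfToC F x ≠ 0 := (_root_.map_ne_zero _).mpr hx0
  have e00 := e' 0 0
  have e01 := e' 0 1
  have e10 := e' 1 0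
  have e11 := e' 1 1
  simp at e00 e01 e10 e11
  unfold moebius
  simp only [Units.val_mul, Matrix.mul_apply, Fin.sum_univ_two, map_add, map_mul,
    e00, e01, e10, e11]
  rw [← mul_div_mul_right (polyToC F (g 0 0) * z + polyToC F (g 0 1)) _ hx1]
  congr 1 <;> ring

/-- The action of `Γ̃` by fractional linear transformations. -/
def moebiusQ {Γ : Subgroup (GL (Fin 2) F[X])} (γ : GammaTilde Γ) (z : Cinf F) : Cinf F :=
  Quotient.liftOn' γ (fun g : Γ => moebius (g : GL (Fin 2) F[X]) z) (by
    intro g h hgh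
    have h1 := QuotientGroup.leftRel_apply.mp hgh
    have h2 := moebius_mul_of_central (g : GL (Fin 2) F[X]) ((g⁻¹ * h : Γ) : GL (Fin 2) F[X])
      h1 z
    simpa using h2.symm)

end Action

section Bar

variable {F : Type*} [Field F]

/-- `Γ̄ = Γ^ab / Tor(Γ^ab)`. -/
abbrev GammaBar (Γ : Subgroup (GL (Fin 2) F[X])) : Type _ :=
  Abelianization Γ ⧸ CommGroup.torsion (Abelianization Γ)

/-- The class in `Γ̄` of an element of `Γ`. -/
def toBar (Γ : Subgroup (GL (Fin 2) F[X])) : Γ →* GammaBar Γ :=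
  (QuotientGroup.mk' (CommGroup.torsion (Abelianization Γ))).comp Abelianization.of

lemma toBar_surjective (Γ : Subgroup (GL (Fin 2) F[X])) :
    Function.Surjective (toBar Γ : Γ → GammaBar Γ) :=
  (QuotientGroup.mk'_surjective _).comp (QuotientGroup.mk'_surjective _)

/-- A chosen representative in `Γ` of a class in `Γ̄`. -/
def barLift {Γ : Subgroup (GL (Fin 2) F[X])} (α : GammaBar Γ) : Γ :=
  Function.surjInv (toBar_surjective Γ) α

end Bar

/-! ### Theta functions -/

section Theta

variable {F : Type*} [Field F] [Finite F] (Γ : Subgroup (GL (Fin 2) F[X]))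

/-- `θ(ω, η, z) = ∏_{γ ∈ Γ̃} (z - γω) / (z - γη)`. -/
def theta (ω η z : Cinf F) : Cinf F :=
  ∏' γ : GammaTilde Γ, (z - moebiusQ γ ω) / (z - moebiusQ γ η)

/-- A point `ω` of `Ω` outside the orbit of `z`. -/
def auxPoint (z : Cinf F) : Cinf F :=
  Classical.epsilon fun ω => ω ∈ upperHalfPlane F ∧ ∀ γ : GammaTilde Γ, moebiusQ γ ω ≠ z

/-- The function `u_α` on `Ω`, for `α ∈ Γ̄`: `u_α(z) = θ(ω, aω, z)`, where `a ∈ Γ` represents `α`.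
This depends neither on `a` nor on `ω`. At the points of the orbit of `ω` the product formula reads
`0/0`, hence `ω` is taken outside the orbit of `z`. -/
def thetaU (α : GammaBar Γ) (z : Cinf F) : Cinf F :=
  theta Γ (auxPoint Γ z)
    (moebius (barLift α : GL (Fin 2) F[X]) (auxPoint Γ z)) z

/-! ### Continuation to a cusp

The cusps other than `∞` are the `s ∈ K`. The matrix `ρ = (s 1; 1 0)`, that is `w ↦ s + 1/w`,
maps `∞` to `s`, and the sets `{s + 1/w : w ∈ Ω, |w|_i ≥ R}` are the punctured neighbourhoods
of the cusp `s` in `Ω ⊔ ℙ¹(K)`. -/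

/-- The lattice of those `b ∈ K` for which `ρ (1 b; 0 1) ρ⁻¹` lies in `Γ`, with
`ρ = (s 1; 1 0)`. -/
def cuspLattice (s : RatFunc F) : Set (RatFunc F) :=
  {b | ∃ γ ∈ Γ, (γ : Matrix (Fin 2) (Fin 2) F[X]).map (algebraMap F[X] (RatFunc F)) =
    !![s, 1; 1, 0] * !![1, b; 0, 1] * !![0, 1; 1, -s]}

/-- The exponential function `e(w) = w ∏_{b ≠ 0} (1 - w / b)` of the lattice at the cusp `s`. -/
def cuspExp (s : RatFunc F) (w : Cinf F) : Cinf F :=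
  w * ∏' b : {b : RatFunc F // b ∈ cuspLattice Γ s ∧ b ≠ 0}, (1 - w / ratToC F b)

/-- `f` continues holomorphically to the cusp `s`, and its value there is `v`: near the cusp,
`f` is a convergent power series in the parameter `t(w) = 1 / e(w)`, with constant term `v`. -/
def HasCuspValue (f : Cinf F → Cinf F) (s : RatFunc F) (v : Cinf F) : Prop :=
  ∃ G : Cinf F → Cinf F, AnalyticAt (Cinf F) G 0 ∧ G 0 = v ∧
    ∃ R : ℝ, ∀ w ∈ upperHalfPlane F, R ≤ imagPart w →
      f (ratToC F s + 1 / w) = G (1 / cuspExp Γ s w)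

end Theta

end Drinfeld

end

open Drinfeld

/-! The map `ρ` carries the cusp `s` to `∞`. Let `Γ' = ρ⁻¹Γρ`, and write `γω = s + 1/v`, `γη = s +
1/v'`, where `v`, `v'` run through `Γ'`-orbits. At `z = s + 1/w` the factor `(z - γω)/(z - γη)`
equals `(w - v)/(w - v')` times `v'/v`, and `v'/v` is the factor at `z = s`. So `θ(ω, η, s + 1/w)`
is the theta function of `Γ'` at `w` times the product at `s`. It remains to see that the product at
`s` converges and that the theta function of `Γ'` is analytic in `t = 1/e(w)` with value `1` at `t =
0` (`exists_theta_eq_analytic`, `exists_theta_eq_analytic_cusp`).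

Convergence. In a complete ultrametric field a product converges as soon as its factors tend to `1`.
A factor is far from `1` only if the entries of `γ` are bounded, which leaves finitely many `γ`
(`finite_norm_sub_act_le`). This works at `z ∈ Ω` and also at `0`, the point that corresponds to
`s`.

Expansion at `∞`. Group the product by the cosets of the translation lattice `Λ`. The product over
one coset is `e(w - ω')/e(w - η')`, which is `(1 - t e(ω'))/(1 - t e(η'))` because `e` is additive.
The numbers `e(ω')`, `e(η')` are bounded, since `Λ` is cocompact and orbits have bounded imaginary
part, and `e(ω') - e(η') = e(ω' - η')` tends to `0`. Such a product is a convergent power series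
with constant term `1` (`exists_analyticAt_hasProd_div`).

Independence of choices. Telescoping products show that `θ(ω, aω, z)` does not depend on `ω` and is
multiplicative in `a`. For `a` in the kernel of `Γ → Γ̄` a power of `θ(ω, aω, ·)` is therefore `1`,
and one has to deduce that the function itself is `1` (`theta_eq_one_of_pow_eq_one`). It is `1` near
`∞`. In characteristic `p` a root of unity other than `1` has distance at least `1` from `1`. A
continuity argument along radii, applied to a finite partial product, excludes a jump between the
two cases.

Uniqueness of the value holds because `1/e(w)` tends to `0` along suitable `w`
(`eq_of_analytic_cusp`). -/

open Filter Topology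

/-! ### Infinite products in complete ultrametric fields -/

namespace Drinfeld

section Products

variable {C : Type*} [NontriviallyNormedField C] [IsUltrametricDist C]

lemma norm_sub_le_max (x y : C) : ‖x - y‖ ≤ max ‖x‖ ‖y‖ := by
  simpa [sub_eq_add_neg] using IsUltrametricDist.norm_add_le_max x (-y)

lemma norm_sub_le_max_sub (x y z : C) : ‖x - z‖ ≤ max ‖x - y‖ ‖y - z‖ := by
  simpa using IsUltrametricDist.norm_add_le_max (x - y) (y - z)

lemma norm_sub_eq_left {x y : C} (h : ‖y‖ < ‖x‖) : ‖x - y‖ = ‖x‖ := by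
  have := IsUltrametricDist.norm_add_eq_max_of_norm_ne_norm (x := x) (y := -y)
    (by rw [norm_neg]; exact h.ne')
  rw [sub_eq_add_neg, this, norm_neg, max_eq_left h.le]

lemma norm_sub_eq_right {x y : C} (h : ‖x‖ < ‖y‖) : ‖x - y‖ = ‖y‖ := by
  rw [norm_sub_rev, norm_sub_eq_left h]

lemma norm_le_one_of_norm_sub_one_le {x : C} (h : ‖x - 1‖ ≤ 1) : ‖x‖ ≤ 1 := by
  have := IsUltrametricDist.norm_add_le_max (x - 1) 1
  simpa [h] using this

/-- From `fg - 1 = f(g - 1) + (f - 1)` with `‖f‖ ≤ 1`: by the ultrametric inequality the bound does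
not grow with the number of factors. -/
lemma norm_prod_sub_one_le {I : Type*} {f : I → C} {ε : ℝ} (h0 : 0 ≤ ε) (h1 : ε ≤ 1) (s : Finset I)
    (h : ∀ i ∈ s, ‖f i - 1‖ ≤ ε) : ‖∏ i ∈ s, f i - 1‖ ≤ ε := by
  classical
  induction s using Finset.induction_on with
  | empty => simpa using h0
  | insert i s hi ih =>
    rw [Finset.prod_insert hi]
    have e : f i * ∏ j ∈ s, f j - 1 = f i * (∏ j ∈ s, f j - 1) + (f i - 1) := by ring
    have hfi := h i (Finset.mem_insert_self _ _)
    have ih' := ih fun j hj => h j (Finset.mem_insert_of_mem hj)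
    rw [e]
    refine (IsUltrametricDist.norm_add_le_max _ _).trans (max_le ?_ hfi)
    rw [norm_mul]
    calc ‖f i‖ * ‖∏ j ∈ s, f j - 1‖ ≤ 1 * ε := by
          gcongr
          exact norm_le_one_of_norm_sub_one_le (hfi.trans h1)
      _ = ε := one_mul _

omit [IsUltrametricDist C] in
lemma finite_le_norm_sub_one {I : Type*} {f : I → C} (hf : Tendsto f cofinite (𝓝 1)) {ε : ℝ}
    (hε : 0 < ε) : {i | ε ≤ ‖f i - 1‖}.Finite := by
  have := (Metric.tendsto_nhds.mp hf) ε hε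
  simpa [Filter.eventually_cofinite, dist_eq_norm] using this

/-- The tail of a product whose factors are close to `1` is close to `1`. -/
lemma norm_sub_prod_le_of_hasProd {I : Type*} {f : I → C} {a : C} (ha : HasProd f a) {ε : ℝ}
    (h0 : 0 ≤ ε) (h1 : ε ≤ 1) (s : Finset I) (h : ∀ i ∉ s, ‖f i - 1‖ ≤ ε) :
    ‖a - ∏ i ∈ s, f i‖ ≤ ‖∏ i ∈ s, f i‖ * ε := by
  classical
  have ht : Tendsto (fun t : Finset I => ‖∏ i ∈ t, f i - ∏ i ∈ s, f i‖) atTop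
      (𝓝 ‖a - ∏ i ∈ s, f i‖) := (ha.sub_const _).norm
  refine le_of_tendsto ht ?_
  filter_upwards [eventually_ge_atTop s] with t hst
  have e : ∏ i ∈ t, f i - ∏ i ∈ s, f i = (∏ i ∈ s, f i) * (∏ i ∈ t \ s, f i - 1) := by
    rw [← Finset.prod_sdiff hst]; ring
  rw [e, norm_mul]
  gcongr
  exact norm_prod_sub_one_le h0 h1 _ fun i hi => h i (Finset.mem_sdiff.mp hi).2

/-- All but finitely many factors have norm at most `1`, so the partial products are eventually
bounded by a constant `M`. Further factors within `δ` of `1` change them by at most `M δ`, so they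
form a Cauchy net. -/
theorem multipliable_of_tendsto_one [CompleteSpace C] {I : Type*} {f : I → C}
    (hf : Tendsto f cofinite (𝓝 1)) : Multipliable f := by
  classical
  suffices h : CauchySeq fun s : Finset I => ∏ i ∈ s, f i from
    ⟨_, (cauchySeq_tendsto_of_complete h).choose_spec⟩
  set s₀ := (finite_le_norm_sub_one hf one_pos).toFinset with hs₀
  have hM : ∀ s, s₀ ⊆ s → ‖∏ i ∈ s, f i‖ ≤ ‖∏ i ∈ s₀, f i‖ := by
    intro s hs
    rw [← Finset.prod_sdiff hs, norm_mul]
    refine mul_le_of_le_one_left (norm_nonneg _) (norm_le_one_of_norm_sub_one_le ?_)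
    refine norm_prod_sub_one_le zero_le_one le_rfl _ fun i hi => ?_
    have := (Finset.mem_sdiff.mp hi).2
    simp only [hs₀, Set.Finite.mem_toFinset, Set.mem_ofPred_eq, not_le] at this
    exact this.le
  set M := ‖∏ i ∈ s₀, f i‖
  rw [Metric.cauchySeq_iff']
  intro ε hε
  obtain ⟨δ, hδ0, hδ⟩ : ∃ δ : ℝ, 0 < δ ∧ M * δ < ε := by
    refine ⟨ε / (2 * (M + 1)), by positivity, ?_⟩
    have : 0 ≤ M := norm_nonneg _
    rw [mul_div_assoc', div_lt_iff₀ (by positivity)]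
    nlinarith
  set δ' := min δ 1
  have hδ' : 0 < δ' := lt_min hδ0 one_pos
  set s₁ := s₀ ∪ (finite_le_norm_sub_one hf hδ').toFinset with hs₁
  refine ⟨s₁, fun s hs => ?_⟩
  rw [dist_eq_norm]
  have e : ∏ i ∈ s, f i - ∏ i ∈ s₁, f i = (∏ i ∈ s₁, f i) * (∏ i ∈ s \ s₁, f i - 1) := by
    rw [← Finset.prod_sdiff hs]; ring
  rw [e, norm_mul]
  refine lt_of_le_of_lt ?_ hδ
  refine mul_le_mul (hM _ Finset.subset_union_left) ?_ (norm_nonneg _) (norm_nonneg _)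
  refine (norm_prod_sub_one_le hδ'.le (min_le_right _ _) _ fun i hi => ?_).trans (min_le_left _ _)
  have := (Finset.mem_sdiff.mp hi).2
  simp only [hs₁, Finset.mem_union, Set.Finite.mem_toFinset, Set.mem_ofPred_eq, not_or,
    not_le] at this
  exact this.2.le

/-- If `P` is the product of the finitely many factors at distance at least `1/2` from `1`, the
whole product differs from `P ≠ 0` by at most `‖P‖ / 2`. -/
lemma tprod_ne_zero_of_tendsto_one [CompleteSpace C] {I : Type*} {f : I → C}
    (hf : Tendsto f cofinite (𝓝 1)) (h0 : ∀ i, f i ≠ 0) : ∏' i, f i ≠ 0 := by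
  set s := (finite_le_norm_sub_one hf (one_half_pos (α := ℝ))).toFinset with hs
  have h := norm_sub_prod_le_of_hasProd (multipliable_of_tendsto_one hf).hasProd
    (one_half_pos (α := ℝ)).le (by norm_num) s fun i hi => by
      simp only [hs, Set.Finite.mem_toFinset, Set.mem_ofPred_eq, not_le] at hi
      exact hi.le
  intro h1
  have h2 : 0 < ‖∏ i ∈ s, f i‖ := norm_pos_iff.mpr (Finset.prod_ne_zero_iff.mpr fun i _ => h0 i)
  rw [h1, zero_sub, norm_neg] at h
  linarith

end Products

/-! ### Products of power series with bounded coefficients -/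

section PowerSeriesProducts

variable {C : Type*} [NontriviallyNormedField C]

/-- The coefficients of `φ` satisfy `‖φₙ‖ ≤ ε Bⁿ`. -/
def CoeffBound (B ε : ℝ) (φ : PowerSeries C) : Prop :=
  ∀ n, ‖PowerSeries.coeff n φ‖ ≤ ε * B ^ n

/-- The value of a power series at a point. -/
noncomputable def evalPS (t : C) (φ : PowerSeries C) : C :=
  ∑' n, PowerSeries.coeff n φ * t ^ n

lemma CoeffBound.summable_norm {B ε : ℝ} {φ : PowerSeries C} (hB : 0 < B)
    (h : CoeffBound B ε φ) {t : C} (ht : B * ‖t‖ < 1) :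
    Summable fun n => ‖PowerSeries.coeff n φ * t ^ n‖ := by
  refine Summable.of_nonneg_of_le (fun _ => norm_nonneg _) (fun n => ?_)
    ((summable_geometric_of_lt_one (by positivity) ht).mul_left ε)
  rw [norm_mul, norm_pow, mul_pow, ← mul_assoc]
  gcongr
  exact h n

variable [IsUltrametricDist C]

lemma CoeffBound.mul {B ε₁ ε₂ : ℝ} {φ ψ : PowerSeries C} (hB : 0 < B) (h₁ : 0 ≤ ε₁) (h₂ : 0 ≤ ε₂)
    (hφ : CoeffBound B ε₁ φ) (hψ : CoeffBound B ε₂ ψ) : CoeffBound B (ε₁ * ε₂) (φ * ψ) := by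
  intro n
  rw [PowerSeries.coeff_mul]
  refine IsUltrametricDist.norm_sum_le_of_forall_le_of_nonneg (by positivity) fun p hp => ?_
  rw [norm_mul, ← Finset.HasAntidiagonal.mem_antidiagonal.mp hp, pow_add]
  calc _ ≤ (ε₁ * B ^ p.1) * (ε₂ * B ^ p.2) := by
        gcongr
        exacts [hφ _, hψ _]
    _ = _ := by ring

lemma CoeffBound.add {B ε : ℝ} {φ ψ : PowerSeries C}
    (hφ : CoeffBound B ε φ) (hψ : CoeffBound B ε ψ) : CoeffBound B ε (φ + ψ) := by
  intro n
  rw [map_add]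
  exact (IsUltrametricDist.norm_add_le_max _ _).trans (max_le (hφ n) (hψ n))

omit [IsUltrametricDist C] in
lemma CoeffBound.mono {B ε ε' : ℝ} {φ : PowerSeries C} (hB : 0 < B) (h : ε ≤ ε')
    (hφ : CoeffBound B ε φ) : CoeffBound B ε' φ := fun n => (hφ n).trans (by gcongr)

omit [IsUltrametricDist C] in
lemma coeffBound_one {B : ℝ} (hB : 0 < B) : CoeffBound B 1 (1 : PowerSeries C) := by
  intro n
  rw [PowerSeries.coeff_one]
  split_ifs with h
  · simp [h]
  · rw [norm_zero]; positivity

lemma CoeffBound.of_sub_one {B : ℝ} {φ : PowerSeries C} (hB : 0 < B)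
    (hφ : CoeffBound B 1 (φ - 1)) : CoeffBound B 1 φ := by
  simpa using hφ.add (coeffBound_one hB)

lemma coeffBound_prod_sub_one {I : Type*} {φ : I → PowerSeries C} {B ε : ℝ} (hB : 0 < B)
    (h0 : 0 ≤ ε) (h1 : ε ≤ 1) (s : Finset I) (h : ∀ i ∈ s, CoeffBound B ε (φ i - 1)) :
    CoeffBound B ε (∏ i ∈ s, φ i - 1) := by
  classical
  induction s using Finset.induction_on with
  | empty => intro n; simp; positivity
  | insert i s hi ih =>
    rw [Finset.prod_insert hi]
    have e : φ i * ∏ j ∈ s, φ j - 1 = φ i * (∏ j ∈ s, φ j - 1) + (φ i - 1) := by ring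
    have hfi := h i (Finset.mem_insert_self _ _)
    have ih' := ih fun j hj => h j (Finset.mem_insert_of_mem hj)
    rw [e]
    refine CoeffBound.add ?_ hfi
    simpa using CoeffBound.mul hB zero_le_one h0 (CoeffBound.of_sub_one hB (hfi.mono hB h1)) ih'

variable [CompleteSpace C]

omit [IsUltrametricDist C] in
lemma evalPS_mul {B ε₁ ε₂ : ℝ} {φ ψ : PowerSeries C} (hB : 0 < B)
    (hφ : CoeffBound B ε₁ φ) (hψ : CoeffBound B ε₂ ψ) {t : C} (ht : B * ‖t‖ < 1) :
    evalPS t (φ * ψ) = evalPS t φ * evalPS t ψ := by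
  unfold evalPS
  rw [tsum_mul_tsum_eq_tsum_sum_antidiagonal_of_summable_norm (hφ.summable_norm hB ht)
    (hψ.summable_norm hB ht)]
  refine tsum_congr fun n => ?_
  rw [PowerSeries.coeff_mul, Finset.sum_mul]
  refine Finset.sum_congr rfl fun p hp => ?_
  rw [← Finset.HasAntidiagonal.mem_antidiagonal.mp hp, pow_add]
  ring

omit [IsUltrametricDist C] [CompleteSpace C] in
lemma evalPS_one (t : C) : evalPS t (1 : PowerSeries C) = 1 := by
  unfold evalPS
  rw [tsum_eq_single 0]
  · simp
  · intro n hn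
    simp [PowerSeries.coeff_one, hn]

lemma evalPS_prod {I : Type*} {φ : I → PowerSeries C} {B : ℝ} (hB : 0 < B)
    (s : Finset I) (h : ∀ i, CoeffBound B 1 (φ i - 1)) {t : C} (ht : B * ‖t‖ < 1) :
    evalPS t (∏ i ∈ s, φ i) = ∏ i ∈ s, evalPS t (φ i) := by
  classical
  induction s using Finset.induction_on with
  | empty => simp [evalPS_one]
  | insert i s hi ih =>
    rw [Finset.prod_insert hi, Finset.prod_insert hi, ← ih]
    exact evalPS_mul hB (CoeffBound.of_sub_one hB (h i)) (CoeffBound.of_sub_one hB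
      (coeffBound_prod_sub_one hB zero_le_one le_rfl s fun i _ => h i)) ht

omit [CompleteSpace C] in
lemma norm_evalPS_le {B ε : ℝ} {φ : PowerSeries C} (hB : 0 < B) (h0 : 0 ≤ ε)
    (h : CoeffBound B ε φ) {t : C} (ht : B * ‖t‖ < 1) : ‖evalPS t φ‖ ≤ ε := by
  refine IsUltrametricDist.norm_tsum_le_of_forall_le_of_nonneg h0 fun n => ?_
  rw [norm_mul, norm_pow]
  calc _ ≤ (ε * B ^ n) * ‖t‖ ^ n := by gcongr; exact h n
    _ = ε * (B * ‖t‖) ^ n := by rw [mul_pow, mul_assoc]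
    _ ≤ ε * 1 := by gcongr; exact pow_le_one₀ (by positivity) ht.le
    _ = ε := mul_one _

/-- An infinite product of power series `φ_i = 1 + O(δ_i)` with `δ_i → 0` is a power series. -/
theorem exists_hasProd_evalPS {I : Type*} {φ : I → PowerSeries C} {B : ℝ} (hB : 0 < B)
    (h1 : ∀ i, CoeffBound B 1 (φ i - 1))
    (h : ∀ ε > 0, {i | ¬ CoeffBound B ε (φ i - 1)}.Finite) :
    ∃ ψ : PowerSeries C, CoeffBound B 1 ψ ∧
      ∀ t : C, B * ‖t‖ < 1 → HasProd (fun i => evalPS t (φ i)) (evalPS t ψ) := by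
  classical
  -- The partial products are Cauchy for the submultiplicative norm `sup ‖φₙ‖ B⁻ⁿ`. The limit is
  -- taken coefficientwise, and the uniform bound lets evaluation at `t` pass to the limit.
  have key : ∀ (ε : ℝ) (hε : 0 < ε), ε ≤ 1 → ∀ s : Finset I, (h ε hε).toFinset ⊆ s → ∀ t, s ⊆ t →
      CoeffBound B ε (∏ i ∈ t, φ i - ∏ i ∈ s, φ i) := by
    intro ε hε hε1 s hs t hst
    have e : ∏ i ∈ t, φ i - ∏ i ∈ s, φ i = (∏ i ∈ s, φ i) * (∏ i ∈ t \ s, φ i - 1) := by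
      rw [← Finset.prod_sdiff hst]; ring
    rw [e]
    have a1 := CoeffBound.of_sub_one hB
      (coeffBound_prod_sub_one hB zero_le_one le_rfl s fun i _ => h1 i)
    have a2 : CoeffBound B ε (∏ i ∈ t \ s, φ i - 1) := by
      refine coeffBound_prod_sub_one hB hε.le hε1 _ fun i hi => ?_
      by_contra hc
      exact (Finset.mem_sdiff.mp hi).2 (hs (by simpa using hc))
    simpa using a1.mul hB zero_le_one hε.le a2
  have hcau : ∀ n, CauchySeq fun s : Finset I => PowerSeries.coeff n (∏ i ∈ s, φ i) := by
    intro n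
    rw [Metric.cauchySeq_iff']
    intro ε hε
    set δ := min (ε / (2 * B ^ n)) 1
    have hδ : 0 < δ := lt_min (by positivity) one_pos
    refine ⟨(h δ hδ).toFinset, fun t ht => ?_⟩
    rw [dist_eq_norm, ← map_sub]
    refine (key δ hδ (min_le_right _ _) _ subset_rfl t ht n).trans_lt ?_
    calc δ * B ^ n ≤ (ε / (2 * B ^ n)) * B ^ n := by gcongr; exact min_le_left _ _
      _ = ε / 2 := by field_simp
      _ < ε := by linarith
  choose g hg using fun n => cauchySeq_tendsto_of_complete (hcau n)
  refine ⟨PowerSeries.mk g, fun n => ?_, fun t ht => ?_⟩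
  · rw [PowerSeries.coeff_mk]
    refine le_of_tendsto (hg n).norm (Eventually.of_forall fun s => ?_)
    exact CoeffBound.of_sub_one hB
      (coeffBound_prod_sub_one hB zero_le_one le_rfl s fun i _ => h1 i) n
  · have hψ : CoeffBound B 1 (PowerSeries.mk g) := fun n => by
      rw [PowerSeries.coeff_mk]
      refine le_of_tendsto (hg n).norm (Eventually.of_forall fun s => ?_)
      exact CoeffBound.of_sub_one hB
        (coeffBound_prod_sub_one hB zero_le_one le_rfl s fun i _ => h1 i) n
    rw [HasProd, SummationFilter.unconditional_filter, Metric.tendsto_atTop]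
    intro ε hε
    set δ := min (ε / 2) 1
    have hδ : 0 < δ := lt_min (by positivity) one_pos
    refine ⟨(h δ hδ).toFinset, fun s hs => ?_⟩
    have hbd : CoeffBound B δ (PowerSeries.mk g - ∏ i ∈ s, φ i) := by
      intro n
      rw [map_sub, PowerSeries.coeff_mk]
      refine le_of_tendsto ((hg n).sub_const _).norm ?_
      filter_upwards [eventually_ge_atTop s] with t hst
      rw [← map_sub]
      exact key δ hδ (min_le_right _ _) s hs t hst n
    have hs1 := CoeffBound.of_sub_one hB
      (coeffBound_prod_sub_one hB zero_le_one le_rfl s fun i _ => h1 i)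
    have e : evalPS t (PowerSeries.mk g - ∏ i ∈ s, φ i) =
        evalPS t (PowerSeries.mk g) - evalPS t (∏ i ∈ s, φ i) := by
      unfold evalPS
      rw [← (hψ.summable_norm hB ht).of_norm.tsum_sub (hs1.summable_norm hB ht).of_norm]
      exact tsum_congr fun n => by rw [map_sub, sub_mul]
    rw [dist_comm, dist_eq_norm, ← evalPS_prod hB s h1 ht, ← e]
    refine (norm_evalPS_le hB hδ.le hbd ht).trans_lt ?_
    exact (min_le_left _ _).trans_lt (by linarith)

omit [IsUltrametricDist C] in
lemma analyticAt_evalPS {B ε : ℝ} {φ : PowerSeries C} (hB : 0 < B) (h : CoeffBound B ε φ) :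
    AnalyticAt C (fun t => evalPS t φ) 0 := by
  refine ⟨FormalMultilinearSeries.ofScalars C fun n => PowerSeries.coeff n φ, ?_⟩
  rw [hasFPowerSeriesAt_iff]
  have : ∀ᶠ t : C in 𝓝 0, B * ‖t‖ < 1 := by
    have : Tendsto (fun t : C => B * ‖t‖) (𝓝 0) (𝓝 (B * ‖(0 : C)‖)) :=
      (continuous_const.mul continuous_norm).tendsto 0
    rw [norm_zero, mul_zero] at this
    exact this.eventually_lt_const one_pos
  filter_upwards [this] with t ht
  rw [zero_add]
  convert (h.summable_norm hB ht).of_norm.hasSum using 2 with n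
  · simp [FormalMultilinearSeries.coeff_ofScalars, mul_comm]
  · rfl

/-- The product of the functions `(1 - x_i t) / (1 - y_i t)`, with `x_i` and `y_i` bounded and
`x_i - y_i → 0`, is analytic at `t = 0`. -/
theorem exists_analyticAt_hasProd_div {I : Type*} {x y : I → C} {B : ℝ} (hB : 0 < B)
    (hx : ∀ i, ‖x i‖ ≤ B) (hy : ∀ i, ‖y i‖ ≤ B)
    (hxy : Tendsto (fun i => x i - y i) cofinite (𝓝 0)) :
    ∃ G : C → C, AnalyticAt C G 0 ∧ G 0 = 1 ∧ ∀ t : C, B * ‖t‖ < 1 →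
      HasProd (fun i => (1 - t * x i) / (1 - t * y i)) (G t) := by
  -- Geometric series: `(1 - x t)/(1 - y t) = 1 + ∑_{n ≥ 1} yⁿ⁻¹ (y - x) tⁿ`.
  set φ : I → PowerSeries C := fun i =>
    1 + PowerSeries.mk fun n => if n = 0 then 0 else y i ^ (n - 1) * (y i - x i) with hφ
  have hco : ∀ i n, PowerSeries.coeff n (φ i - 1) =
      if n = 0 then 0 else y i ^ (n - 1) * (y i - x i) := by
    intro i n
    simp [hφ]
  have hbound : ∀ i ε, 0 ≤ ε → ‖y i - x i‖ ≤ ε * B → CoeffBound B ε (φ i - 1) := by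
    intro i ε h0 h n
    rw [hco]
    split_ifs with hn
    · rw [norm_zero]; positivity
    · obtain ⟨m, rfl⟩ := Nat.exists_eq_succ_of_ne_zero hn
      rw [norm_mul, norm_pow]
      calc _ ≤ B ^ m * (ε * B) := by
            simp only [Nat.succ_eq_add_one, Nat.add_sub_cancel]
            gcongr
            exact hy i
        _ = _ := by rw [pow_succ]; ring
  have h1 : ∀ i, CoeffBound B 1 (φ i - 1) := fun i => hbound i 1 zero_le_one <| by
    rw [one_mul]
    exact (norm_sub_le_max _ _).trans (max_le (hy i) (hx i))
  have hfin : ∀ ε > 0, {i | ¬ CoeffBound B ε (φ i - 1)}.Finite := by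
    intro ε hε
    have h2 := (Metric.tendsto_nhds.mp hxy) (ε * B) (by positivity)
    rw [Filter.eventually_cofinite] at h2
    refine h2.subset fun i hi hc => hi (hbound i ε hε.le ?_)
    rw [dist_eq_norm, sub_zero, norm_sub_rev] at hc
    exact hc.le
  have heval : ∀ (t : C), B * ‖t‖ < 1 → ∀ i,
      evalPS t (φ i) = (1 - t * x i) / (1 - t * y i) := by
    intro t ht i
    have hty : ‖t * y i‖ < 1 := by
      rw [norm_mul, mul_comm]
      exact (mul_le_mul_of_nonneg_right (hy i) (norm_nonneg _)).trans_lt ht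
    have hne : 1 - t * y i ≠ 0 := by
      intro h
      rw [sub_eq_zero] at h
      rw [← h, norm_one] at hty
      exact lt_irrefl _ hty
    have hs := ((CoeffBound.of_sub_one hB (h1 i)).summable_norm hB ht).of_norm
    unfold evalPS
    rw [hs.tsum_eq_zero_add]
    have e0 : PowerSeries.coeff 0 (φ i) = 1 := by
      simp [hφ]
    have e1 : ∀ n, PowerSeries.coeff (n + 1) (φ i) * t ^ (n + 1) =
        (t * y i) ^ n * (t * (y i - x i)) := by
      intro n
      simp [hφ, PowerSeries.coeff_one]
      ring
    simp_rw [e0, e1]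
    rw [tsum_mul_right, tsum_geometric_of_norm_lt_one hty]
    field_simp
    ring
  obtain ⟨ψ, hψ, hprod⟩ := exists_hasProd_evalPS hB h1 hfin
  refine ⟨fun t => evalPS t ψ, analyticAt_evalPS hB hψ, ?_, fun t ht => ?_⟩
  · have := hprod 0 (by simp)
    simp_rw [heval 0 (by simp)] at this
    simp only [zero_mul, sub_zero, div_one] at this
    exact this.unique hasProd_one
  · have := hprod t ht
    simp_rw [heval t ht] at this
    exact this

end PowerSeriesProducts

end Drinfeld

/-! ### The exponential function of a lattice -/

namespace Drinfeld

section FiniteAdditive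

/-- The polynomial of a finite additive subgroup of a field is additive. -/
lemma prod_add_sub_eq {E : Type*} [Field E] (S : Finset E) (h0 : (0 : E) ∈ S)
    (hadd : ∀ a ∈ S, ∀ b ∈ S, a - b ∈ S) (x y : E) :
    ∏ b ∈ S, (x + y - b) = ∏ b ∈ S, (x - b) + ∏ b ∈ S, (y - b) := by
  classical
  set P : E[X] := ∏ b ∈ S, (X - C b) with hP
  have hev : ∀ z, P.eval z = ∏ b ∈ S, (z - b) := fun z => by
    simp [hP, Polynomial.eval_prod]
  have hper : ∀ a ∈ S, ∀ z, P.eval (a + z) = P.eval z := by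
    intro a ha z
    rw [hev, hev]
    refine Finset.prod_bij' (fun b _ => b - a) (fun b _ => b + a) (fun b hb => hadd b hb a ha)
      (fun b hb => ?_) (fun b _ => by ring) (fun b _ => by ring) (fun b _ => by ring)
    have := hadd b hb (0 - a) (hadd 0 h0 a ha)
    simpa using this
  have hmonic : P.Monic := monic_prod_of_monic _ _ fun b _ => monic_X_sub_C b
  have hdeg : P.natDegree = S.card := by
    rw [hP, natDegree_prod_of_monic _ _ fun b _ => monic_X_sub_C b]
    simp
  have hcard : 0 < S.card := Finset.card_pos.mpr ⟨0, h0⟩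
  -- `D = P(X + y) - P(X) - P(y)` has degree less than `|S|`, since the leading terms cancel, and it
  -- vanishes on `S` because `P` is `S`-periodic. Hence `D = 0`.
  set D : E[X] := P.comp (X + C y) - P - C (P.eval y) with hD
  have hmonic' : (P.comp (X + C y)).Monic := hmonic.comp_X_add_C y
  have hdeg' : (P.comp (X + C y)).natDegree = S.card := by
    rw [natDegree_comp, natDegree_X_add_C, mul_one, hdeg]
  have hdD : D.degree < S.card := by
    have h1 : (P.comp (X + C y) - P).degree < S.card := by
      have := degree_sub_lt_left (p := P.comp (X + C y)) (q := P) (by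
        rw [degree_eq_natDegree hmonic'.ne_zero, degree_eq_natDegree hmonic.ne_zero, hdeg, hdeg'])
        hmonic'.ne_zero (by rw [hmonic.leadingCoeff, hmonic'.leadingCoeff])
      rwa [degree_eq_natDegree hmonic'.ne_zero, hdeg'] at this
    refine (degree_sub_le _ _).trans_lt (max_lt h1 ?_)
    exact (degree_C_le).trans_lt (Nat.cast_pos.mpr hcard)
  have hD0 : D = 0 := by
    refine Polynomial.eq_zero_of_degree_lt_of_eval_finset_eq_zero S hdD fun a ha => ?_
    have hPa : P.eval a = 0 := by
      rw [hev]; exact Finset.prod_eq_zero ha (sub_self a)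
    simp [hD, hper a ha y, hPa]
  have := congrArg (Polynomial.eval x) hD0
  simp only [hD, eval_sub, eval_comp, eval_add, eval_X, eval_C, eval_zero] at this
  rw [← hev, ← hev, ← hev]
  linear_combination this

end FiniteAdditive

section Exponential

variable {C : Type*} [NontriviallyNormedField C]

/-- `e(w) = w ∏_{b ≠ 0} (1 - w / b)`, the product over the nonzero elements of `Λ`. -/
noncomputable def latticeExp (Λ : AddSubgroup C) (w : C) : C :=
  w * ∏' b : {b : C // b ∈ Λ ∧ b ≠ 0}, (1 - w / b)

/-- `Λ` has only finitely many elements in every ball. -/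
def FiniteBalls {E : Type*} [NormedField E] (Λ : AddSubgroup E) : Prop :=
  ∀ M : ℝ, {x : E | x ∈ Λ ∧ ‖x‖ ≤ M}.Finite

variable {Λ : AddSubgroup C}

/-- The elements of norm at most `n` of a lattice. -/
noncomputable def FiniteBalls.ball (hΛ : FiniteBalls Λ) (n : ℕ) : Finset C := (hΛ n).toFinset

lemma FiniteBalls.mem_ball (hΛ : FiniteBalls Λ) {n : ℕ} {b : C} :
    b ∈ hΛ.ball n ↔ b ∈ Λ ∧ ‖b‖ ≤ n := by simp [FiniteBalls.ball]

lemma FiniteBalls.tendsto_norm_subtype (hΛ : FiniteBalls Λ) {p : C → Prop} (hp : ∀ b, p b → b ∈ Λ) :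
    Tendsto (fun b : {b : C // p b} => ‖(b : C)‖) cofinite atTop := by
  rw [tendsto_atTop]
  intro M
  rw [Filter.eventually_cofinite]
  refine Set.Finite.of_finite_image (f := Subtype.val) ((hΛ M).subset ?_)
    Subtype.val_injective.injOn
  rintro _ ⟨b, hb, rfl⟩
  exact ⟨hp b b.2, (not_le.mp hb).le⟩

lemma tendsto_one_sub_div (hΛ : FiniteBalls Λ) (w : C) :
    Tendsto (fun b : {b : C // b ∈ Λ ∧ b ≠ 0} => 1 - w / b) cofinite (𝓝 1) := by
  have h1 : Tendsto (fun b : {b : C // b ∈ Λ ∧ b ≠ 0} => w / (b : C)) cofinite (𝓝 0) := by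
    rw [tendsto_zero_iff_norm_tendsto_zero]
    simp_rw [norm_div]
    exact (hΛ.tendsto_norm_subtype fun b hb => hb.1).const_div_atTop _
  simpa using h1.const_sub 1

variable [IsUltrametricDist C] [CompleteSpace C]

lemma hasProd_latticeExp (hΛ : FiniteBalls Λ) (w : C) :
    HasProd (fun b : {b : C // b ∈ Λ ∧ b ≠ 0} => 1 - w / b)
      (∏' b : {b : C // b ∈ Λ ∧ b ≠ 0}, (1 - w / b)) :=
  (multipliable_of_tendsto_one (tendsto_one_sub_div hΛ w)).hasProd

open Classical in
/-- `e` is the limit of the normalized polynomials of the finite subgroups of `Λ`. -/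
lemma tendsto_latticeExp (hΛ : FiniteBalls Λ) :
    ∃ c : ℕ → C, (∀ n, c n ≠ 0) ∧ ∀ w,
      Tendsto (fun n : ℕ => c n * ∏ b ∈ hΛ.ball n, (w - b)) atTop (𝓝 (latticeExp Λ w)) := by
  set T : ℕ → Finset {b : C // b ∈ Λ ∧ b ≠ 0} := fun n => (hΛ.ball n).subtype _
  have hT : Tendsto T atTop atTop := by
    refine tendsto_atTop_finset_of_monotone (fun m n hmn b hb => ?_) fun b => ?_
    · simp only [T, Finset.mem_subtype, hΛ.mem_ball] at hb ⊢
      exact ⟨hb.1, hb.2.trans (by exact_mod_cast hmn)⟩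
    · obtain ⟨n, hn⟩ := exists_nat_ge ‖(b : C)‖
      exact ⟨n, by simp only [T, Finset.mem_subtype, hΛ.mem_ball]; exact ⟨b.2.1, hn⟩⟩
  -- The constant comes from `1 - w/b = (-1/b)(w - b)`; the element `b = 0` of the ball supplies the
  -- factor `w`.
  refine ⟨fun n => ∏ b ∈ T n, (-1 / (b : C)), fun n => Finset.prod_ne_zero_iff.mpr fun b _ =>
    div_ne_zero (by simp) b.2.2, fun w => ?_⟩
  have h := ((hasProd_latticeExp hΛ w).comp hT).const_mul w
  refine h.congr fun n => ?_
  have h0 : (0 : C) ∈ hΛ.ball n := by simp [hΛ.mem_ball, Λ.zero_mem]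
  have e1 : ∏ b ∈ hΛ.ball n, (w - b) = w * ∏ b ∈ T n, (w - (b : C)) := by
    rw [← Finset.mul_prod_erase _ _ h0, sub_zero]
    congr 1
    refine (Finset.prod_bij (fun (b : {b : C // b ∈ Λ ∧ b ≠ 0}) _ => (b : C)) ?_ ?_ ?_ ?_).symm
    · intro b hb
      simp only [T, Finset.mem_subtype] at hb
      exact Finset.mem_erase.mpr ⟨b.2.2, hb⟩
    · intro a _ b _ h
      exact Subtype.ext h
    · intro b hb
      obtain ⟨hb0, hb⟩ := Finset.mem_erase.mp hb
      exact ⟨⟨b, (hΛ.mem_ball.mp hb).1, hb0⟩, by simpa [T] using hb, rfl⟩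
    · intro b _; rfl
  simp only [Function.comp]
  rw [e1, mul_left_comm, ← Finset.prod_mul_distrib]
  congr 1
  refine Finset.prod_congr rfl fun b _ => ?_
  have := b.2.2
  field_simp
  ring

/-- The elements of `Λ` of norm at most `n` form a finite group, by the ultrametric inequality. Its
polynomial is additive by `prod_add_sub_eq`, and additivity passes to the limit. -/
lemma latticeExp_add (hΛ : FiniteBalls Λ) (x y : C) :
    latticeExp Λ (x + y) = latticeExp Λ x + latticeExp Λ y := by
  obtain ⟨c, -, hc⟩ := tendsto_latticeExp hΛ
  refine tendsto_nhds_unique (hc (x + y)) (((hc x).add (hc y)).congr fun n => ?_)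
  rw [prod_add_sub_eq (hΛ.ball n) (by simp [hΛ.mem_ball, Λ.zero_mem]) ?_ x y, mul_add]
  intro a ha b hb
  rw [hΛ.mem_ball] at *
  exact ⟨Λ.sub_mem ha.1 hb.1, (norm_sub_le_max a b).trans (max_le ha.2 hb.2)⟩

lemma latticeExp_sub (hΛ : FiniteBalls Λ) (x y : C) :
    latticeExp Λ (x - y) = latticeExp Λ x - latticeExp Λ y := by
  have := latticeExp_add hΛ (x - y) y
  rw [sub_add_cancel] at this
  rw [this, add_sub_cancel_right]

lemma latticeExp_eq_zero (hΛ : FiniteBalls Λ) {x : C} (hx : x ∈ Λ) : latticeExp Λ x = 0 := by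
  obtain ⟨c, -, hc⟩ := tendsto_latticeExp hΛ
  refine tendsto_nhds_unique (hc x) (tendsto_const_nhds.congr' ?_)
  obtain ⟨n, hn⟩ := exists_nat_ge ‖x‖
  filter_upwards [eventually_ge_atTop n] with m hm
  rw [Finset.prod_eq_zero (i := x) _ (sub_self x), mul_zero]
  exact hΛ.mem_ball.mpr ⟨hx, hn.trans (by exact_mod_cast hm)⟩

lemma latticeExp_sub_mem (hΛ : FiniteBalls Λ) (x : C) {b : C} (hb : b ∈ Λ) :
    latticeExp Λ (x - b) = latticeExp Λ x := by
  rw [latticeExp_sub hΛ, latticeExp_eq_zero hΛ hb, sub_zero]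

lemma latticeExp_ne_zero (hΛ : FiniteBalls Λ) {x : C} (hx : x ∉ Λ) : latticeExp Λ x ≠ 0 := by
  refine mul_ne_zero (fun h => hx (h ▸ Λ.zero_mem))
    (tprod_ne_zero_of_tendsto_one (tendsto_one_sub_div hΛ x) fun b hb => hx ?_)
  have h1 := b.2.2
  rw [sub_eq_zero, eq_comm, div_eq_one_iff_eq h1] at hb
  exact hb ▸ b.2.1

open Classical in
-- The product converges because `(x - b)/(y - b) = 1 + (x - y)/(y - b)`. Its value can be computed
-- along the balls of `Λ`, where the normalizing constants of numerator and denominator cancel.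
lemma hasProd_latticeExp_div (hΛ : FiniteBalls Λ) (x : C) {y : C} (hy : y ∉ Λ) :
    HasProd (fun b : Λ => (x - b) / (y - b)) (latticeExp Λ x / latticeExp Λ y) := by
  have hne : ∀ b : Λ, y - (b : C) ≠ 0 := fun b h => hy (by rw [sub_eq_zero.mp h]; exact b.2)
  have h1 : Tendsto (fun b : Λ => (x - b) / (y - b)) cofinite (𝓝 1) := by
    have h2 : Tendsto (fun b : Λ => (x - y) / (y - b)) cofinite (𝓝 0) := by
      rw [tendsto_zero_iff_norm_tendsto_zero]
      simp_rw [norm_div]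
      refine Tendsto.const_div_atTop ?_ _
      refine tendsto_atTop_mono (fun b : Λ => ?_) (tendsto_atTop_add_const_right _ (-‖y‖)
        (hΛ.tendsto_norm_subtype (p := (· ∈ Λ)) fun b hb => hb))
      have := norm_sub_norm_le (b : C) y
      rw [norm_sub_rev] at this
      linarith
    have h3 := h2.const_add 1
    rw [add_zero] at h3
    refine h3.congr fun b => ?_
    have := hne b
    field_simp
    ring
  obtain ⟨c, hc0, hc⟩ := tendsto_latticeExp hΛ
  set T : ℕ → Finset Λ := fun n => (hΛ.ball n).subtype _
  have hT : Tendsto T atTop atTop := by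
    refine tendsto_atTop_finset_of_monotone (fun m n hmn b hb => ?_) fun b => ?_
    · simp only [T, Finset.mem_subtype, hΛ.mem_ball] at hb ⊢
      exact ⟨hb.1, hb.2.trans (by exact_mod_cast hmn)⟩
    · obtain ⟨n, hn⟩ := exists_nat_ge ‖(b : C)‖
      exact ⟨n, by simp only [T, Finset.mem_subtype, hΛ.mem_ball]; exact ⟨b.2, hn⟩⟩
  have h4 := (multipliable_of_tendsto_one h1).hasProd
  have h5 := Tendsto.comp h4 hT
  have h6 := (hc x).div (hc y) (latticeExp_ne_zero hΛ hy)
  have h7 := tendsto_nhds_unique h5 (h6.congr fun n => ?_)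
  · rwa [h7] at h4
  · have e : ∀ z : C, ∏ b ∈ hΛ.ball n, (z - b) = ∏ b ∈ T n, (z - (b : C)) := by
      intro z
      refine (Finset.prod_bij (fun (b : Λ) _ => (b : C)) ?_ ?_ ?_ ?_).symm
      · intro b hb
        simpa [T] using hb
      · intro a _ b _ h
        exact Subtype.ext h
      · intro b hb
        exact ⟨⟨b, (hΛ.mem_ball.mp hb).1⟩, by simpa [T] using hb, rfl⟩
      · intro b _; rfl
    simp only [Function.comp, Pi.div_apply]
    rw [e, e, mul_div_mul_left _ _ (hc0 n), Finset.prod_div_distrib]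

/-- If `0` is a lattice point nearest to `w`, then `‖b‖ ≤ max ‖w‖ ‖w - b‖ = ‖w - b‖`, so every
factor `1 - w/b` has norm at least `1`. -/
lemma norm_le_norm_latticeExp_of_nearest (hΛ : FiniteBalls Λ) {w : C}
    (h : ∀ b ∈ Λ, ‖w‖ ≤ ‖w - b‖) : ‖w‖ ≤ ‖latticeExp Λ w‖ := by
  rw [latticeExp, norm_mul]
  refine le_mul_of_one_le_right (norm_nonneg _) ?_
  refine ge_of_tendsto (Tendsto.norm (hasProd_latticeExp hΛ w)) (Eventually.of_forall fun s => ?_)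
  rw [norm_prod, ← Finset.prod_const_one (s := s)]
  refine Finset.prod_le_prod (fun _ _ => zero_le_one) fun b _ => ?_
  have hb := b.2.2
  have e : 1 - w / (b : C) = ((b : C) - w) / b := by field_simp
  rw [e, norm_div, one_le_div (norm_pos_iff.mpr hb), norm_sub_rev]
  have h1 := h b b.2.1
  have h2 := norm_sub_le_max w (w - b)
  rw [sub_sub_cancel] at h2
  exact h2.trans (max_le h1 le_rfl)

/-- `|e(w)|` is at least the distance from `w` to `Λ`. -/
lemma le_norm_latticeExp (hΛ : FiniteBalls Λ) {w : C} {d : ℝ}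
    (h : ∀ b ∈ Λ, d ≤ ‖w - b‖) : d ≤ ‖latticeExp Λ w‖ := by
  -- A nearest lattice point exists: points with `‖b‖ > ‖w‖` are no closer than `0`, and only
  -- finitely many others remain. Periodicity of `e` then moves it to `0`.
  obtain ⟨b₀, hb₀, hmin⟩ : ∃ b₀ ∈ Λ, ∀ b ∈ Λ, ‖w - b₀‖ ≤ ‖w - b‖ := by
    obtain ⟨b₀, hb₀, hmin⟩ := Set.exists_min_image {x : C | x ∈ Λ ∧ ‖x‖ ≤ ‖w‖} (fun b => ‖w - b‖)
      (hΛ ‖w‖) ⟨0, Λ.zero_mem, by simp⟩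
    refine ⟨b₀, hb₀.1, fun b hb => ?_⟩
    rcases le_or_gt ‖b‖ ‖w‖ with h1 | h1
    · exact hmin b ⟨hb, h1⟩
    · rw [norm_sub_eq_right h1]
      have := hmin 0 ⟨Λ.zero_mem, by simp⟩
      rw [sub_zero] at this
      exact this.trans h1.le
  rw [← latticeExp_sub_mem hΛ w hb₀]
  refine (h b₀ hb₀).trans (norm_le_norm_latticeExp_of_nearest hΛ fun b hb => ?_)
  rw [sub_sub]
  exact hmin _ (Λ.add_mem hb₀ hb)

/-- On a ball, `|e(v)|` is at most a constant multiple of `|v|`. -/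
lemma exists_norm_latticeExp_le (hΛ : FiniteBalls Λ) (r : ℝ) :
    ∃ K : ℝ, 0 < K ∧ ∀ v : C, ‖v‖ ≤ r → ‖latticeExp Λ v‖ ≤ K * ‖v‖ := by
  have hfin : {b : {b : C // b ∈ Λ ∧ b ≠ 0} | ‖(b : C)‖ ≤ r}.Finite :=
    Set.Finite.of_finite_image (f := Subtype.val) ((hΛ r).subset (by
      rintro _ ⟨b, hb, rfl⟩
      exact ⟨b.2.1, hb⟩)) Subtype.val_injective.injOn
  -- On the ball of radius `r` the factor of `b` has norm at most `m b`, and `m b = 1` as soon as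
  -- `‖b‖ > r`.
  set m : {b : C // b ∈ Λ ∧ b ≠ 0} → ℝ := fun b => max 1 (r / ‖(b : C)‖)
  have hm : ∀ b, 1 ≤ m b := fun b => le_max_left _ _
  refine ⟨∏ b ∈ hfin.toFinset, m b,
    Finset.prod_pos fun b _ => one_pos.trans_le (hm b), fun v hv => ?_⟩
  rw [latticeExp, norm_mul, mul_comm]
  refine mul_le_mul_of_nonneg_right ?_ (norm_nonneg _)
  refine le_of_tendsto (Tendsto.norm (hasProd_latticeExp hΛ v)) ?_
  filter_upwards [eventually_ge_atTop hfin.toFinset] with s hs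
  rw [norm_prod, Finset.prod_subset hs]
  · refine Finset.prod_le_prod (fun _ _ => norm_nonneg _) fun b _ => ?_
    refine (norm_sub_le_max _ _).trans (max_le_max (by simp) ?_)
    rw [norm_div]
    gcongr
  · intro b _ hb
    simp only [Set.Finite.mem_toFinset, Set.mem_ofPred_eq, not_le] at hb
    refine max_eq_left ?_
    rw [div_le_one (norm_pos_iff.mpr b.2.2)]
    exact hb.le

end Exponential

end Drinfeld

/-! ### Fractional linear transformations over a complete subfield -/

namespace Drinfeld

section Moebius

variable {k C : Type*} [NormedField k] [NontriviallyNormedField C]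

/-- The complement of the subfield `ι(k)` of `C`. -/
def halfPlane (ι : k →+* C) : Set C := (Set.range ι)ᶜ

/-- The distance to the subfield `ι(k)`. -/
noncomputable def distTo (ι : k →+* C) (z : C) : ℝ := Metric.infDist z (Set.range ι)

/-- The denominator `c z + d`. -/
def moebDenom (ι : k →+* C) (g : GL (Fin 2) k) (z : C) : C := ι (g 1 0) * z + ι (g 1 1)

/-- The fractional linear transformation `z ↦ (a z + b) / (c z + d)`. -/
noncomputable def moeb (ι : k →+* C) (g : GL (Fin 2) k) (z : C) : C :=
  (ι (g 0 0) * z + ι (g 0 1)) / moebDenom ι g z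

variable {ι : k →+* C}

lemma linear_ne_zero {z : C} (hz : z ∈ halfPlane ι) {c d : k} (h : c ≠ 0 ∨ d ≠ 0) :
    ι c * z + ι d ≠ 0 := by
  intro h0
  by_cases hc : c = 0
  · subst hc
    simp only [map_zero, zero_mul, zero_add, map_eq_zero] at h0
    exact h.elim (fun h => h rfl) (fun h => h h0)
  · refine hz ⟨-d / c, ?_⟩
    have : ι c ≠ 0 := (_root_.map_ne_zero ι).mpr hc
    rw [map_div₀, map_neg, div_eq_iff this]
    linear_combination -h0

lemma det_apply_ne_zero (g : GL (Fin 2) k) : g 0 0 * g 1 1 - g 0 1 * g 1 0 ≠ 0 := by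
  have := g.det.ne_zero
  rwa [Matrix.GeneralLinearGroup.val_det_apply, Matrix.det_fin_two] at this

lemma bottom_ne_zero (g : GL (Fin 2) k) : g 1 0 ≠ 0 ∨ g 1 1 ≠ 0 := by
  by_contra! h
  exact det_apply_ne_zero g (by rw [h.1, h.2]; ring)

lemma top_ne_zero (g : GL (Fin 2) k) : g 0 0 ≠ 0 ∨ g 0 1 ≠ 0 := by
  by_contra! h
  exact det_apply_ne_zero g (by rw [h.1, h.2]; ring)

lemma moebDenom_ne_zero (g : GL (Fin 2) k) {z : C} (hz : z ∈ halfPlane ι) :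
    moebDenom ι g z ≠ 0 := linear_ne_zero hz (bottom_ne_zero g)

lemma moebDenom_mul (g h : GL (Fin 2) k) {z : C} (hz : z ∈ halfPlane ι) :
    moebDenom ι (g * h) z = moebDenom ι g (moeb ι h z) * moebDenom ι h z := by
  have h1 : moeb ι h z * moebDenom ι h z = ι (h 0 0) * z + ι (h 0 1) := by
    rw [moeb, div_mul_cancel₀ _ (moebDenom_ne_zero h hz)]
  have h2 : moebDenom ι h z = ι (h 1 0) * z + ι (h 1 1) := rfl
  rw [moebDenom, moebDenom]
  simp only [Units.val_mul, Matrix.mul_apply, Fin.sum_univ_two, map_add, map_mul]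
  linear_combination -ι (g 1 0) * h1 - ι (g 1 1) * h2

lemma moeb_mul (g h : GL (Fin 2) k) {z : C} (hz : z ∈ halfPlane ι) :
    moeb ι (g * h) z = moeb ι g (moeb ι h z) := by
  have h1 := moebDenom_ne_zero h hz
  have h2 := moebDenom_ne_zero (g * h) hz
  have h3 := moebDenom_mul g h hz
  have h4 : moebDenom ι g (moeb ι h z) ≠ 0 := left_ne_zero_of_mul (h3 ▸ h2)
  rw [moeb, moeb, div_eq_div_iff h2 h4, h3]
  simp only [Units.val_mul, Matrix.mul_apply, Fin.sum_univ_two, map_add, map_mul]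
  have h5 : moeb ι h z * moebDenom ι h z = ι (h 0 0) * z + ι (h 0 1) := by
    rw [moeb, div_mul_cancel₀ _ h1]
  have h6 : moebDenom ι h z = ι (h 1 0) * z + ι (h 1 1) := rfl
  linear_combination (-ι (g 0 0) * moebDenom ι g (moeb ι h z)) * h5
    - ι (g 0 1) * moebDenom ι g (moeb ι h z) * h6

lemma moeb_one (z : C) : moeb ι 1 z = z := by
  simp [moeb, moebDenom]

lemma moeb_sub_moeb (g : GL (Fin 2) k) {z w : C} (hz : z ∈ halfPlane ι) (hw : w ∈ halfPlane ι) :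
    moeb ι g z - moeb ι g w =
      ι (g 0 0 * g 1 1 - g 0 1 * g 1 0) * (z - w) / (moebDenom ι g z * moebDenom ι g w) := by
  have h1 := moebDenom_ne_zero g hz
  have h2 := moebDenom_ne_zero g hw
  rw [moeb, moeb, div_sub_div _ _ h1 h2]
  congr 1
  simp only [moebDenom, map_sub, map_mul]
  ring

lemma moeb_mem_halfPlane (g : GL (Fin 2) k) {z : C} (hz : z ∈ halfPlane ι) :
    moeb ι g z ∈ halfPlane ι := by
  rintro ⟨x, hx⟩
  have h1 := moebDenom_ne_zero g hz
  rw [moeb, eq_div_iff h1, moebDenom] at hx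
  refine linear_ne_zero hz (c := x * g 1 0 - g 0 0) (d := x * g 1 1 - g 0 1) ?_ ?_
  · by_contra! h
    refine det_apply_ne_zero g ?_
    linear_combination -(g 1 1) * h.1 + (g 1 0) * h.2
  · simp only [map_sub, map_mul]
    linear_combination hx

lemma moeb_scalar_mul (g h : GL (Fin 2) k) (hh : h ∈ Subgroup.center (GL (Fin 2) k)) (z : C) :
    moeb ι (g * h) z = moeb ι g z := by
  obtain ⟨x, hx⟩ := Matrix.GeneralLinearGroup.mem_center_iff_val_mem_range_scalar.mp hh
  have e : ∀ i j, h i j = Matrix.scalar (Fin 2) x i j := fun i j => by rw [hx]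
  have hx0 : ι x ≠ 0 := by
    rw [_root_.map_ne_zero]
    rintro rfl
    have := h.isUnit
    rw [← hx] at this
    simp at this
  unfold moeb moebDenom
  simp only [Units.val_mul, Matrix.mul_apply, Fin.sum_univ_two, e]
  simp
  rw [← mul_div_mul_right (ι (g 0 0) * z + ι (g 0 1)) _ hx0]
  congr 1 <;> ring

/-! ### The distance to the subfield -/

lemma distTo_le (z : C) (x : k) : distTo ι z ≤ ‖z - ι x‖ := by
  rw [← dist_eq_norm]
  exact Metric.infDist_le_dist_of_mem ⟨x, rfl⟩

lemma le_distTo {z : C} {d : ℝ} (h : ∀ x, d ≤ ‖z - ι x‖) : d ≤ distTo ι z := by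
  refine (Metric.le_infDist (Set.range_nonempty ι)).mpr ?_
  rintro _ ⟨x, rfl⟩
  rw [dist_eq_norm]
  exact h x

lemma distTo_nonneg (z : C) : 0 ≤ distTo ι z := Metric.infDist_nonneg

lemma exists_norm_sub_lt {z : C} {r : ℝ} (h : distTo ι z < r) : ∃ x, ‖z - ι x‖ < r := by
  by_contra! hc
  exact absurd (le_distTo hc) (not_le.mpr h)

lemma distTo_le_norm (z : C) : distTo ι z ≤ ‖z‖ := by simpa using distTo_le (ι := ι) z 0

lemma norm_mul_distTo_le (hι : ∀ x, ‖ι x‖ = ‖x‖) (z : C) (c d : k) :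
    ‖c‖ * distTo ι z ≤ ‖ι c * z + ι d‖ := by
  by_cases hc : c = 0
  · simp [hc]
  · have h := distTo_le (ι := ι) z (-d / c)
    have hc' : ι c ≠ 0 := (_root_.map_ne_zero ι).mpr hc
    have e : ι c * z + ι d = ι c * (z - ι (-d / c)) := by
      rw [map_div₀, map_neg]
      field_simp
      ring
    rw [e, norm_mul, hι]
    gcongr

lemma distTo_pos [CompleteSpace k] (hι : ∀ x, ‖ι x‖ = ‖x‖) {z : C} (hz : z ∈ halfPlane ι) :
    0 < distTo ι z := by
  have hiso : Isometry ι := AddMonoidHomClass.isometry_of_norm ι hι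
  have hcl : IsClosed (Set.range ι) := hiso.isClosedEmbedding.isClosed_range
  exact (hcl.notMem_iff_infDist_pos (Set.range_nonempty ι)).mp hz

lemma distTo_le_max [IsUltrametricDist C] (z w : C) :
    distTo ι z ≤ max ‖z - w‖ (distTo ι w) := by
  by_contra! h
  obtain ⟨h1, h2⟩ := max_lt_iff.mp h
  obtain ⟨x, hx⟩ := exists_norm_sub_lt h2
  exact absurd ((distTo_le z x).trans (norm_sub_le_max_sub z w (ι x))) (not_le.mpr (max_lt h1 hx))

/-- One half of the formula `|gz|_i = |z|_i / |cz + d|²`; the other half follows by applying it to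
`g⁻¹`. -/
lemma distTo_moeb_le [IsUltrametricDist C] (hι : ∀ x, ‖ι x‖ = ‖x‖) (g : GL (Fin 2) k)
    (hg : ‖g 0 0 * g 1 1 - g 0 1 * g 1 0‖ = 1) {z : C} (hz : z ∈ halfPlane ι) :
    distTo ι (moeb ι g z) * ‖moebDenom ι g z‖ ^ 2 ≤ distTo ι z := by
  have hd := moebDenom_ne_zero g hz
  have hdpos : 0 < ‖moebDenom ι g z‖ := norm_pos_iff.mpr hd
  refine le_distTo fun x => ?_
  set e := ι (g 1 0) * ι x + ι (g 1 1) with he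
  have hde : moebDenom ι g z - e = ι (g 1 0) * (z - ι x) := by rw [moebDenom, he]; ring
  -- In the first case `|cx + d| = |cz + d|` and `gz` is compared with `gx`. In the second `x` may
  -- be the pole of `g`, and `gz` is compared with `g∞ = a/c`.
  rcases lt_or_ge (‖g 1 0‖ * ‖z - ι x‖) ‖moebDenom ι g z‖ with h | h
  · have hn : ‖e‖ = ‖moebDenom ι g z‖ := by
      have := norm_sub_eq_left (x := moebDenom ι g z) (y := moebDenom ι g z - e) (by
        rw [hde, norm_mul, hι]; exact h)
      rwa [sub_sub_cancel] at this
    have he0 : e ≠ 0 := norm_pos_iff.mp (hn ▸ hdpos)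
    have hxe : moeb ι g z - ι ((g 0 0 * x + g 0 1) / (g 1 0 * x + g 1 1)) =
        ι (g 0 0 * g 1 1 - g 0 1 * g 1 0) * (z - ι x) / (moebDenom ι g z * e) := by
      rw [moeb, map_div₀]
      simp only [map_add, map_mul, ← he]
      rw [div_sub_div _ _ hd he0]
      congr 1
      simp only [moebDenom, map_sub, map_mul, he]
      ring
    have h1 := distTo_le (ι := ι) (moeb ι g z) ((g 0 0 * x + g 0 1) / (g 1 0 * x + g 1 1))
    rw [hxe, norm_div, norm_mul, norm_mul, hι, hg, hn, one_mul, ← sq] at h1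
    rwa [le_div_iff₀ (by positivity)] at h1
  · have hc : g 1 0 ≠ 0 := by
      intro hc
      rw [hc, norm_zero, zero_mul] at h
      linarith
    have hc' : ι (g 1 0) ≠ 0 := (_root_.map_ne_zero ι).mpr hc
    have hxe : moeb ι g z - ι (g 0 0 / g 1 0) =
        -ι (g 0 0 * g 1 1 - g 0 1 * g 1 0) / (ι (g 1 0) * moebDenom ι g z) := by
      rw [moeb, map_div₀, div_sub_div _ _ hd hc', mul_comm (ι (g 1 0)) (moebDenom ι g z)]
      congr 1
      simp only [moebDenom, map_sub, map_mul]
      ring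
    have h1 := distTo_le (ι := ι) (moeb ι g z) (g 0 0 / g 1 0)
    rw [hxe, norm_div, norm_neg, norm_mul, hι, hι, hg] at h1
    have hcpos : 0 < ‖g 1 0‖ := norm_pos_iff.mpr hc
    calc _ ≤ (1 / (‖g 1 0‖ * ‖moebDenom ι g z‖)) * ‖moebDenom ι g z‖ ^ 2 := by gcongr
      _ = ‖moebDenom ι g z‖ / ‖g 1 0‖ := by field_simp
      _ ≤ ‖z - ι x‖ := by rw [div_le_iff₀ hcpos]; linarith

lemma norm_det_apply_inv {g : GL (Fin 2) k} (hg : ‖g 0 0 * g 1 1 - g 0 1 * g 1 0‖ = 1) :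
    ‖g⁻¹ 0 0 * g⁻¹ 1 1 - g⁻¹ 0 1 * g⁻¹ 1 0‖ = 1 := by
  have h : ∀ g : GL (Fin 2) k, g 0 0 * g 1 1 - g 0 1 * g 1 0 = (g.det : k) := fun g => by
    rw [Matrix.GeneralLinearGroup.val_det_apply, Matrix.det_fin_two]
  rw [h] at hg ⊢
  rw [map_inv, Units.val_inv_eq_inv_val, norm_inv, hg, inv_one]

lemma distTo_moeb [IsUltrametricDist C] (hι : ∀ x, ‖ι x‖ = ‖x‖) (g : GL (Fin 2) k)
    (hg : ‖g 0 0 * g 1 1 - g 0 1 * g 1 0‖ = 1) {z : C} (hz : z ∈ halfPlane ι) :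
    distTo ι (moeb ι g z) * ‖moebDenom ι g z‖ ^ 2 = distTo ι z := by
  refine le_antisymm (distTo_moeb_le hι g hg hz) ?_
  have h := distTo_moeb_le hι g⁻¹ (norm_det_apply_inv hg) (moeb_mem_halfPlane g hz)
  rw [← moeb_mul _ _ hz, inv_mul_cancel, moeb_one] at h
  have h2 := moebDenom_mul g⁻¹ g hz
  rw [inv_mul_cancel] at h2
  have h3 : moebDenom ι (1 : GL (Fin 2) k) z = 1 := by simp [moebDenom]
  rw [h3] at h2
  have h4 : ‖moebDenom ι g⁻¹ (moeb ι g z)‖ * ‖moebDenom ι g z‖ = 1 := by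
    rw [← norm_mul, ← h2, norm_one]
  calc distTo ι z = distTo ι z *
      (‖moebDenom ι g⁻¹ (moeb ι g z)‖ * ‖moebDenom ι g z‖) ^ 2 := by rw [h4]; ring
    _ = (distTo ι z * ‖moebDenom ι g⁻¹ (moeb ι g z)‖ ^ 2) * ‖moebDenom ι g z‖ ^ 2 := by ring
    _ ≤ _ := by gcongr

end Moebius

end Drinfeld

/-! ### Theta functions of discrete groups -/

namespace Drinfeld

/-- A representation of `Γ` by matrices with entries in a lattice of `k` and with determinants in
a finite set of elements of norm `1`, such that `Z` is the subgroup of the elements that are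
represented by scalar matrices. -/
structure DiscreteRep (k : Type*) [NormedField k] {Γ : Type*} [Group Γ] (Z : Subgroup Γ) where
  toHom : Γ →* GL (Fin 2) k
  mem_iff : ∀ g, g ∈ Z ↔ toHom g ∈ Subgroup.center (GL (Fin 2) k)
  lattice : AddSubgroup k
  finiteBalls : FiniteBalls lattice
  entry_mem : ∀ g i j, toHom g i j ∈ lattice
  det_finite : (Set.range fun g => toHom g 0 0 * toHom g 1 1 - toHom g 0 1 * toHom g 1 0).Finite
  norm_det : ∀ g, ‖toHom g 0 0 * toHom g 1 1 - toHom g 0 1 * toHom g 1 0‖ = 1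

namespace DiscreteRep

variable {k C : Type*} [NormedField k] [NontriviallyNormedField C]
  {Γ : Type*} [Group Γ] {Z : Subgroup Γ}

/-- The action of `Γ / Z` on `C` by fractional linear transformations. -/
noncomputable def act (D : DiscreteRep k Z) (ι : k →+* C) (γ : Γ ⧸ Z) (z : C) : C :=
  moeb ι (D.toHom γ.out) z

variable {ι : k →+* C} (D : DiscreteRep k Z)

lemma act_mk (g : Γ) (z : C) : D.act ι (g : Γ ⧸ Z) z = moeb ι (D.toHom g) z := by
  have h : g⁻¹ * (g : Γ ⧸ Z).out ∈ Z := QuotientGroup.eq.mp (QuotientGroup.out_eq' _).symm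
  have e : (g : Γ ⧸ Z).out = g * (g⁻¹ * (g : Γ ⧸ Z).out) := by group
  rw [act, e, map_mul, moeb_scalar_mul _ _ ((D.mem_iff _).mp h)]

lemma act_mem {ω : C} (hω : ω ∈ halfPlane ι) (γ : Γ ⧸ Z) : D.act ι γ ω ∈ halfPlane ι :=
  moeb_mem_halfPlane _ hω

lemma act_mul_mk (γ : Γ ⧸ Z) [Z.Normal] (g : Γ) {ω : C} (hω : ω ∈ halfPlane ι) :
    D.act ι (γ * (g : Γ ⧸ Z)) ω = D.act ι γ (moeb ι (D.toHom g) ω) := by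
  obtain ⟨h, rfl⟩ := QuotientGroup.mk_surjective γ
  rw [← QuotientGroup.mk_mul, act_mk, act_mk, map_mul, moeb_mul _ _ hω]

lemma act_mk_mul (g : Γ) [Z.Normal] (γ : Γ ⧸ Z) {ω : C} (hω : ω ∈ halfPlane ι) :
    D.act ι ((g : Γ ⧸ Z) * γ) ω = moeb ι (D.toHom g) (D.act ι γ ω) := by
  obtain ⟨h, rfl⟩ := QuotientGroup.mk_surjective γ
  rw [← QuotientGroup.mk_mul, act_mk, act_mk, map_mul, moeb_mul _ _ hω]

/-- Bounded entries lie in a finite part of the lattice, and the matrix determines the class in `Γ /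
Z`, since the kernel of `toHom` is contained in `Z`. -/
lemma finite_entries_le (M : ℝ) :
    {γ : Γ ⧸ Z | ∀ i j, ‖D.toHom γ.out i j‖ ≤ M}.Finite := by
  have hfin : (Set.pi Set.univ fun _ : Fin 2 => Set.pi Set.univ fun _ : Fin 2 =>
      {x : k | x ∈ D.lattice ∧ ‖x‖ ≤ M}).Finite :=
    Set.Finite.pi fun _ => Set.Finite.pi fun _ => D.finiteBalls M
  refine Set.Finite.of_finite_image (f := fun γ : Γ ⧸ Z => fun i j => D.toHom γ.out i j)
    (hfin.subset ?_) ?_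
  · rintro _ ⟨γ, hγ, rfl⟩ i - j -
    exact ⟨D.entry_mem _ i j, hγ i j⟩
  · intro γ _ δ _ h
    have h1 : D.toHom γ.out = D.toHom δ.out := by
      ext i j
      exact congrFun (congrFun h i) j
    rw [← QuotientGroup.out_eq' γ, ← QuotientGroup.out_eq' δ, QuotientGroup.eq, D.mem_iff, map_mul,
      map_inv, h1, inv_mul_cancel]
    exact Subgroup.one_mem _

lemma exists_le_norm : ∃ m : ℝ, 0 < m ∧ ∀ x ∈ D.lattice, x ≠ 0 → m ≤ ‖x‖ := by
  have hf : ({x : k | x ∈ D.lattice ∧ ‖x‖ ≤ 1} \ {0}).Finite := (D.finiteBalls 1).sdiff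
  rcases Set.eq_empty_or_nonempty ({x : k | x ∈ D.lattice ∧ ‖x‖ ≤ 1} \ {0}) with he | hne
  · refine ⟨1, one_pos, fun x hx hx0 => ?_⟩
    by_contra! h
    exact Set.eq_empty_iff_forall_notMem.mp he x ⟨⟨hx, h.le⟩, hx0⟩
  · obtain ⟨x₀, ⟨hx₀, hne⟩, hmin⟩ := Set.exists_min_image _ (fun x => ‖x‖) hf hne
    refine ⟨‖x₀‖, norm_pos_iff.mpr hne, fun x hx hx0 => ?_⟩
    rcases le_or_gt ‖x‖ 1 with h | h
    · exact hmin x ⟨⟨hx, h⟩, hx0⟩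
    · exact hx₀.2.trans h.le

/-- Either `c ≠ 0` and `|cz + d| ≥ |c| |z|_i`, or the value is `|d|`; nonzero lattice elements are
bounded below. This bounds the denominators, and the numerators, of all group elements from below at
once. -/
lemma exists_le_norm_linear [CompleteSpace k] (hι : ∀ x, ‖ι x‖ = ‖x‖) {z : C}
    (hz : z ∈ halfPlane ι) :
    ∃ κ : ℝ, 0 < κ ∧ ∀ c ∈ D.lattice, ∀ d ∈ D.lattice, (c ≠ 0 ∨ d ≠ 0) → κ ≤ ‖ι c * z + ι d‖ := by
  obtain ⟨m, hm0, hm⟩ := D.exists_le_norm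
  have hpos := distTo_pos hι hz
  refine ⟨m * min 1 (distTo ι z), by positivity, fun c hc d hd hcd => ?_⟩
  by_cases hc0 : c = 0
  · subst hc0
    have hd0 : d ≠ 0 := hcd.resolve_left fun h => h rfl
    rw [map_zero, zero_mul, zero_add, hι]
    calc m * min 1 (distTo ι z) ≤ m * 1 := by gcongr; exact min_le_left _ _
      _ ≤ ‖d‖ := by rw [mul_one]; exact hm d hd hd0
  · refine le_trans ?_ (norm_mul_distTo_le hι z c d)
    exact mul_le_mul (hm c hc hc0) (min_le_right _ _) (by positivity) (norm_nonneg _)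

lemma exists_norm_le_of_linear_le [CompleteSpace k] (hι : ∀ x, ‖ι x‖ = ‖x‖) {z : C}
    (hz : z ∈ halfPlane ι) (M : ℝ) :
    ∃ M' : ℝ, ∀ c d : k, ‖ι c * z + ι d‖ ≤ M → ‖c‖ ≤ M' ∧ ‖d‖ ≤ M' := by
  have hpos := distTo_pos hι hz
  refine ⟨max (M / distTo ι z) (M + M / distTo ι z * ‖z‖), fun c d h => ?_⟩
  have hc : ‖c‖ ≤ M / distTo ι z := by
    rw [le_div_iff₀ hpos]
    exact (norm_mul_distTo_le hι z c d).trans h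
  refine ⟨hc.trans (le_max_left _ _), le_trans ?_ (le_max_right _ _)⟩
  have e : ι d = (ι c * z + ι d) - ι c * z := by ring
  rw [← hι d, e]
  refine (norm_sub_le _ _).trans ?_
  rw [norm_mul, hι]
  gcongr

lemma norm_moeb_sub_moeb (g : Γ) (hι : ∀ x, ‖ι x‖ = ‖x‖) {ω η : C} (hω : ω ∈ halfPlane ι)
    (hη : η ∈ halfPlane ι) :
    ‖moeb ι (D.toHom g) ω - moeb ι (D.toHom g) η‖ *
      (‖moebDenom ι (D.toHom g) ω‖ * ‖moebDenom ι (D.toHom g) η‖) = ‖ω - η‖ := by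
  have h1 := norm_pos_iff.mpr (moebDenom_ne_zero (D.toHom g) hω)
  have h2 := norm_pos_iff.mpr (moebDenom_ne_zero (D.toHom g) hη)
  rw [moeb_sub_moeb _ hω hη, norm_div, norm_mul, norm_mul, hι, D.norm_det, one_mul]
  field_simp

variable [IsUltrametricDist C] [CompleteSpace k]

/-- Only finitely many factors `(z - γω) / (z - γη)` are far from `1`. -/
lemma finite_norm_sub_act_le (hι : ∀ x, ‖ι x‖ = ‖x‖) {ω η z : C} (hω : ω ∈ halfPlane ι)
    (hη : η ∈ halfPlane ι) (hz : z ∈ halfPlane ι ∨ z = 0) {M : ℝ} (hM : 0 ≤ M) :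
    {γ : Γ ⧸ Z | ‖z - D.act ι γ η‖ ≤ M * ‖D.act ι γ ω - D.act ι γ η‖}.Finite := by
  obtain ⟨κω, hκω, hω1⟩ := D.exists_le_norm_linear hι hω
  obtain ⟨κη, hκη, hη1⟩ := D.exists_le_norm_linear hι hη
  set M₁ := M * ‖ω - η‖ with hM₁
  have hM₁0 : 0 ≤ M₁ := by positivity
  have hden : ∀ γ : Γ ⧸ Z, κω ≤ ‖moebDenom ι (D.toHom γ.out) ω‖ ∧
      κη ≤ ‖moebDenom ι (D.toHom γ.out) η‖ := fun γ =>
    ⟨hω1 _ (D.entry_mem _ _ _) _ (D.entry_mem _ _ _) (bottom_ne_zero _),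
      hη1 _ (D.entry_mem _ _ _) _ (D.entry_mem _ _ _) (bottom_ne_zero _)⟩
  -- Since `|γω - γη|` is `|ω - η|` divided by both denominators, an exceptional `γ` cannot have
  -- large denominators unless `γη` is close to `z`.
  have hkey : ∀ γ : Γ ⧸ Z, ‖z - D.act ι γ η‖ ≤ M * ‖D.act ι γ ω - D.act ι γ η‖ →
      ‖z - D.act ι γ η‖ * (‖moebDenom ι (D.toHom γ.out) ω‖ * ‖moebDenom ι (D.toHom γ.out) η‖) ≤
        M₁ := by
    intro γ h
    rw [hM₁, ← D.norm_moeb_sub_moeb γ.out hι hω hη, ← mul_assoc M]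
    gcongr
    exact h
  suffices h : ∃ N : ℝ, ∀ γ : Γ ⧸ Z, ‖z - D.act ι γ η‖ ≤ M * ‖D.act ι γ ω - D.act ι γ η‖ →
      ∀ i j, ‖D.toHom γ.out i j‖ ≤ N by
    obtain ⟨N, hN⟩ := h
    exact (D.finite_entries_le N).subset hN
  rcases hz with hz | rfl
  · have hzpos := distTo_pos hι hz
    have hηpos := distTo_pos hι hη
    set M₂ := max (Real.sqrt (distTo ι η / distTo ι z)) (M₁ / distTo ι z / κω) with hM₂
    set M₃ := (‖z‖ + M₁ / (κω * κη)) * M₂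
    obtain ⟨N₁, hN₁⟩ := exists_norm_le_of_linear_le hι hη M₂
    obtain ⟨N₂, hN₂⟩ := exists_norm_le_of_linear_le hι hη M₃
    refine ⟨max N₁ N₂, fun γ hγ => ?_⟩
    obtain ⟨hdω, hdη⟩ := hden γ
    have hk := hkey γ hγ
    have hdη2 : ‖moebDenom ι (D.toHom γ.out) η‖ ≤ M₂ := by
      -- If `γη` is closer to `z` than `|z|_i`, then `|γη|_i ≥ |z|_i`, and `|γη|_i = |η|_i / |cη +
      -- d|²` bounds the denominator. Otherwise `hkey` bounds it.
      rcases lt_or_ge ‖z - D.act ι γ η‖ (distTo ι z) with h | h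
      · refine le_trans ?_ (le_max_left _ _)
        refine Real.le_sqrt_of_sq_le ?_
        have h1 : distTo ι z ≤ distTo ι (D.act ι γ η) := by
          have := distTo_le_max (ι := ι) z (D.act ι γ η)
          rcases le_max_iff.mp this with h2 | h2
          · exact absurd h2 (not_le.mpr h)
          · exact h2
        have h2 := distTo_moeb hι _ (D.norm_det γ.out) hη
        rw [le_div_iff₀ hzpos, ← h2, mul_comm]
        gcongr
        exact h1
      · refine le_trans ?_ (le_max_right _ _)
        rw [le_div_iff₀ hκω, le_div_iff₀ hzpos]
        refine le_trans ?_ hk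
        calc _ = distTo ι z * (κω * ‖moebDenom ι (D.toHom γ.out) η‖) := by ring
          _ ≤ _ := by gcongr
    have hsub : ‖z - D.act ι γ η‖ ≤ M₁ / (κω * κη) := by
      rw [le_div_iff₀ (by positivity)]
      refine le_trans ?_ hk
      gcongr
    have hact : ‖D.act ι γ η‖ ≤ ‖z‖ + M₁ / (κω * κη) := by
      have := norm_sub_le z (z - D.act ι γ η)
      rw [sub_sub_cancel] at this
      linarith
    have hnum : ‖ι (D.toHom γ.out 0 0) * η + ι (D.toHom γ.out 0 1)‖ ≤ M₃ := by
      have e : ι (D.toHom γ.out 0 0) * η + ι (D.toHom γ.out 0 1) =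
          D.act ι γ η * moebDenom ι (D.toHom γ.out) η := by
        rw [act, moeb, div_mul_cancel₀ _ (moebDenom_ne_zero _ hη)]
      rw [e, norm_mul]
      exact mul_le_mul hact hdη2 (norm_nonneg _) (by positivity)
    have h1 := hN₁ _ _ hdη2
    have h2 := hN₂ _ _ hnum
    intro i j
    fin_cases i <;> fin_cases j
    exacts [h2.1.trans (le_max_right _ _), h2.2.trans (le_max_right _ _),
      h1.1.trans (le_max_left _ _), h1.2.trans (le_max_left _ _)]
  -- For `z = 0` the denominator at `η` cancels: `|cω + d| |aη + b| ≤ M₁`. Both factors are bounded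
  -- below, hence both are bounded above.
  · obtain ⟨N₁, hN₁⟩ := exists_norm_le_of_linear_le hι hω (M₁ / κη)
    obtain ⟨N₂, hN₂⟩ := exists_norm_le_of_linear_le hι hη (M₁ / κω)
    refine ⟨max N₁ N₂, fun γ hγ => ?_⟩
    obtain ⟨hdω, hdη⟩ := hden γ
    have hk := hkey γ hγ
    have hnum := hη1 _ (D.entry_mem γ.out 0 0) _ (D.entry_mem γ.out 0 1) (top_ne_zero _)
    have e : ‖0 - D.act ι γ η‖ * (‖moebDenom ι (D.toHom γ.out) ω‖ *
        ‖moebDenom ι (D.toHom γ.out) η‖) = ‖moebDenom ι (D.toHom γ.out) ω‖ *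
        ‖ι (D.toHom γ.out 0 0) * η + ι (D.toHom γ.out 0 1)‖ := by
      have h1 := norm_pos_iff.mpr (moebDenom_ne_zero (D.toHom γ.out) hη)
      rw [zero_sub, norm_neg, act, moeb, norm_div]
      field_simp
    rw [e] at hk
    have h1 := hN₁ (D.toHom γ.out 1 0) (D.toHom γ.out 1 1) (by
      rw [le_div_iff₀ hκη]
      refine le_trans ?_ hk
      exact mul_le_mul_of_nonneg_left hnum (norm_nonneg _))
    have h2 := hN₂ (D.toHom γ.out 0 0) (D.toHom γ.out 0 1) (by
      rw [le_div_iff₀ hκω, mul_comm]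
      refine le_trans ?_ hk
      exact mul_le_mul_of_nonneg_right hdω (norm_nonneg _))
    intro i j
    fin_cases i <;> fin_cases j
    exacts [h2.1.trans (le_max_right _ _), h2.2.trans (le_max_right _ _),
      h1.1.trans (le_max_left _ _), h1.2.trans (le_max_left _ _)]

lemma tendsto_ratio (hι : ∀ x, ‖ι x‖ = ‖x‖) {ω η z : C} (hω : ω ∈ halfPlane ι)
    (hη : η ∈ halfPlane ι) (hz : z ∈ halfPlane ι ∨ z = 0) :
    Tendsto (fun γ : Γ ⧸ Z => (z - D.act ι γ ω) / (z - D.act ι γ η)) cofinite (𝓝 1) := by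
  rw [Metric.tendsto_nhds]
  intro ε hε
  rw [Filter.eventually_cofinite]
  refine (D.finite_norm_sub_act_le hι hω hη hz (M := ε⁻¹) (by positivity)).subset fun γ hγ => ?_
  by_contra hc
  refine hγ ?_
  rw [Set.mem_ofPred_eq, not_le, inv_mul_lt_iff₀ hε] at hc
  have hpos : 0 < ‖z - D.act ι γ η‖ := by
    by_contra h0
    have h0' : ‖z - D.act ι γ η‖ = 0 := le_antisymm (not_lt.mp h0) (norm_nonneg _)
    rw [h0', mul_zero] at hc
    exact absurd hc (not_lt.mpr (norm_nonneg _))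
  have hne := norm_pos_iff.mp hpos
  have e : (z - D.act ι γ ω) / (z - D.act ι γ η) - 1 =
      -(D.act ι γ ω - D.act ι γ η) / (z - D.act ι γ η) := by
    field_simp
    ring
  rw [dist_eq_norm, e, norm_div, norm_neg, div_lt_iff₀ hpos]
  exact hc

/-- `θ(ω, η, z) = ∏_γ (z - γω) / (z - γη)`. -/
noncomputable def theta (D : DiscreteRep k Z) (ι : k →+* C) (ω η z : C) : C :=
  ∏' γ : Γ ⧸ Z, (z - D.act ι γ ω) / (z - D.act ι γ η)

variable [CompleteSpace C]

lemma multipliable_ratio (hι : ∀ x, ‖ι x‖ = ‖x‖) {ω η z : C} (hω : ω ∈ halfPlane ι)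
    (hη : η ∈ halfPlane ι) (hz : z ∈ halfPlane ι ∨ z = 0) :
    Multipliable (fun γ : Γ ⧸ Z => (z - D.act ι γ ω) / (z - D.act ι γ η)) :=
  multipliable_of_tendsto_one (D.tendsto_ratio hι hω hη hz)

lemma theta_ne_zero (hι : ∀ x, ‖ι x‖ = ‖x‖) {ω η z : C} (hω : ω ∈ halfPlane ι)
    (hη : η ∈ halfPlane ι) (hz : z ∈ halfPlane ι ∨ z = 0) (h1 : ∀ γ, D.act ι γ ω ≠ z)
    (h2 : ∀ γ, D.act ι γ η ≠ z) : D.theta ι ω η z ≠ 0 :=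
  tprod_ne_zero_of_tendsto_one (D.tendsto_ratio hι hω hη hz) fun γ =>
    div_ne_zero (sub_ne_zero.mpr (h1 γ).symm) (sub_ne_zero.mpr (h2 γ).symm)

/-- The factors telescope. The orbit of the middle point has to avoid `z`, because `0/0` is `0`
here. -/
lemma theta_mul_theta (hι : ∀ x, ‖ι x‖ = ‖x‖) {ω η ζ z : C} (hω : ω ∈ halfPlane ι)
    (hη : η ∈ halfPlane ι) (hζ : ζ ∈ halfPlane ι) (hz : z ∈ halfPlane ι ∨ z = 0)
    (h : ∀ γ, D.act ι γ η ≠ z) :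
    D.theta ι ω η z * D.theta ι η ζ z = D.theta ι ω ζ z := by
  rw [theta, theta, theta, ← (D.multipliable_ratio hι hω hη hz).tprod_mul
    (D.multipliable_ratio hι hη hζ hz)]
  refine tprod_congr fun γ => ?_
  have := sub_ne_zero.mpr (h γ).symm
  rw [div_mul_div_cancel₀ this]

omit [IsUltrametricDist C] [CompleteSpace k] [CompleteSpace C] in
lemma theta_moeb [Z.Normal] (a : Γ) {ω η : C} (z : C) (hω : ω ∈ halfPlane ι)
    (hη : η ∈ halfPlane ι) :
    D.theta ι (moeb ι (D.toHom a) ω) (moeb ι (D.toHom a) η) z = D.theta ι ω η z := by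
  rw [theta, theta, ← (Equiv.mulRight (a : Γ ⧸ Z)).tprod_eq
    fun γ => (z - D.act ι γ ω) / (z - D.act ι γ η)]
  refine tprod_congr fun γ => ?_
  simp only [Equiv.coe_mulRight, D.act_mul_mk γ a hω, D.act_mul_mk γ a hη]

omit [IsUltrametricDist C] [CompleteSpace k] [CompleteSpace C] in
lemma act_moeb_ne [Z.Normal] (a : Γ) {ω z : C} (hω : ω ∈ halfPlane ι)
    (h : ∀ γ, D.act ι γ ω ≠ z) (γ : Γ ⧸ Z) : D.act ι γ (moeb ι (D.toHom a) ω) ≠ z := by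
  rw [← D.act_mul_mk γ a hω]
  exact h _

/-- `θ(ω, aω, z)` does not depend on `ω`. -/
lemma theta_moeb_self [Z.Normal] (hι : ∀ x, ‖ι x‖ = ‖x‖) (a : Γ) {ω η z : C}
    (hω : ω ∈ halfPlane ι) (hη : η ∈ halfPlane ι) (hz : z ∈ halfPlane ι ∨ z = 0)
    (h1 : ∀ γ, D.act ι γ ω ≠ z) (h2 : ∀ γ, D.act ι γ η ≠ z) :
    D.theta ι ω (moeb ι (D.toHom a) ω) z = D.theta ι η (moeb ι (D.toHom a) η) z := by
  have haω := moeb_mem_halfPlane (D.toHom a) hω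
  have haη := moeb_mem_halfPlane (D.toHom a) hη
  -- `θ(ω, aω) θ(aω, aη) = θ(ω, aη) = θ(ω, η) θ(η, aη)`, and `θ(aω, aη) = θ(ω, η)` can be cancelled.
  have e1 := D.theta_mul_theta hι hω haω haη hz (D.act_moeb_ne a hω h1)
  have e2 := D.theta_mul_theta hι hω hη haη hz h2
  rw [D.theta_moeb a z hω hη] at e1
  have h0 := D.theta_ne_zero hι hω hη hz h1 h2
  refine mul_right_cancel₀ h0 ?_
  rw [e1, ← e2, mul_comm]

/-- The homomorphism `a ↦ θ(ω, aω, z)`. -/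
noncomputable def thetaHom [Z.Normal] (hι : ∀ x, ‖ι x‖ = ‖x‖) {ω z : C} (hω : ω ∈ halfPlane ι)
    (hz : z ∈ halfPlane ι ∨ z = 0) (h : ∀ γ, D.act ι γ ω ≠ z) : Γ →* C where
  toFun a := D.theta ι ω (moeb ι (D.toHom a) ω) z
  map_one' := by
    rw [map_one, moeb_one, theta]
    refine (tprod_congr fun γ => ?_).trans tprod_one
    exact div_self (sub_ne_zero.mpr (h γ).symm)
  map_mul' a b := by
    rw [map_mul, moeb_mul _ _ hω, ← D.theta_mul_theta hι hω (moeb_mem_halfPlane (D.toHom a) hω)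
      (moeb_mem_halfPlane _ (moeb_mem_halfPlane _ hω)) hz (D.act_moeb_ne a hω h),
      D.theta_moeb a z hω (moeb_mem_halfPlane _ hω)]

end DiscreteRep

end Drinfeld

/-! ### Expansion of theta functions at the cusp `∞` -/

namespace Drinfeld

namespace DiscreteRep

open Matrix.GeneralLinearGroup

variable {k C : Type*} [NormedField k] [NontriviallyNormedField C]
  {Γ : Type*} [Group Γ] {Z : Subgroup Γ} {ι : k →+* C} (D : DiscreteRep k Z)

/-- The lattice of those `b` for which `z ↦ z + b` comes from an element of `Γ`. -/
def translations : AddSubgroup k where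
  carrier := {b | ∃ g, D.toHom g = upperRightHom b}
  zero_mem' := ⟨1, by rw [map_one, AddChar.map_zero_eq_one]⟩
  add_mem' := by
    rintro a b ⟨g, hg⟩ ⟨h, hh⟩
    exact ⟨g * h, by rw [map_mul, hg, hh, AddChar.map_add_eq_mul]⟩
  neg_mem' := by
    rintro a ⟨g, hg⟩
    exact ⟨g⁻¹, by rw [map_inv, hg, AddChar.map_neg_eq_inv]⟩

lemma translations_le : D.translations ≤ D.lattice := by
  rintro b ⟨g, hg⟩
  have := D.entry_mem g 0 1
  rw [hg] at this
  simpa using this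

lemma finiteBalls_map_translations (hι : ∀ x, ‖ι x‖ = ‖x‖) :
    FiniteBalls (D.translations.map (ι : k →+ C)) := by
  intro M
  refine ((D.finiteBalls M).image ι).subset ?_
  rintro _ ⟨⟨x, hx, rfl⟩, hM⟩
  exact ⟨x, ⟨D.translations_le hx, by rw [← hι]; exact hM⟩, rfl⟩

lemma moeb_upperRightHom (x : k) (z : C) : moeb ι (upperRightHom x) z = z + ι x := by
  simp [moeb, moebDenom]

lemma mk_eq_mk_of_toHom_eq {g h : Γ} (e : D.toHom g = D.toHom h) : (g : Γ ⧸ Z) = (h : Γ ⧸ Z) := by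
  rw [QuotientGroup.eq, D.mem_iff, map_mul, map_inv, e, inv_mul_cancel]
  exact Subgroup.one_mem _

lemma eq_zero_of_upperRightHom_mem_center {x : k}
    (h : upperRightHom x ∈ Subgroup.center (GL (Fin 2) k)) : x = 0 := by
  obtain ⟨y, hy⟩ := mem_center_iff_val_mem_range_scalar.mp h
  have := congrFun (congrFun hy 0) 1
  simpa using this.symm

/-- Bottom row and determinant thus determine the coset modulo translations. The number `x` is
solved from a column whose bottom entry is nonzero; the determinant gives the other column. -/
lemma eq_upperRightHom_mul {g h : GL (Fin 2) k} (h0 : g 1 0 = h 1 0) (h1 : g 1 1 = h 1 1)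
    (hdet : g 0 0 * g 1 1 - g 0 1 * g 1 0 = h 0 0 * h 1 1 - h 0 1 * h 1 0) :
    ∃ x, g = upperRightHom x * h := by
  obtain ⟨x, hx0, hx1⟩ : ∃ x, g 0 0 = h 0 0 + x * h 1 0 ∧ g 0 1 = h 0 1 + x * h 1 1 := by
    rw [h0, h1] at hdet
    rcases bottom_ne_zero h with hc | hd
    · refine ⟨(g 0 0 - h 0 0) / h 1 0, by field_simp; ring, ?_⟩
      field_simp
      linear_combination -hdet
    · refine ⟨(g 0 1 - h 0 1) / h 1 1, ?_, by field_simp; ring⟩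
      field_simp
      linear_combination hdet
  refine ⟨x, ?_⟩
  ext i j
  fin_cases i <;> fin_cases j <;> simp [Matrix.mul_apply, Fin.sum_univ_two, hx0, hx1, h0, h1]

variable [Z.Normal]

/-- The image in `Γ / Z` of the group of translations. -/
def translationSubgroup : Subgroup (Γ ⧸ Z) :=
  ((upperRightHom (R := k)).toMonoidHom.range.comap D.toHom).map (QuotientGroup.mk' Z)

lemma mem_translationSubgroup {γ : Γ ⧸ Z} :
    γ ∈ D.translationSubgroup ↔ ∃ g : Γ, (∃ x, D.toHom g = upperRightHom x) ∧ (g : Γ ⧸ Z) = γ := by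
  constructor
  · rintro ⟨g, ⟨x, hx⟩, rfl⟩
    exact ⟨g, ⟨x.toAdd, hx.symm⟩, rfl⟩
  · rintro ⟨g, ⟨x, hx⟩, rfl⟩
    exact ⟨g, ⟨Multiplicative.ofAdd x, hx.symm⟩, rfl⟩

omit [Z.Normal] in
lemma exists_translation (b : D.translations.map (ι : k →+ C)) :
    ∃ g : Γ, ∃ x, D.toHom g = upperRightHom x ∧ ι x = b := by
  obtain ⟨_, x, ⟨g, hg⟩, rfl⟩ := b
  exact ⟨g, x, hg, rfl⟩

/-- A representative of the class `q`, on the side on which translations act from the left. -/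
noncomputable def rep (q : (Γ ⧸ Z) ⧸ D.translationSubgroup) : Γ ⧸ Z := (q.out)⁻¹

lemma rep_injective {q q' : (Γ ⧸ Z) ⧸ D.translationSubgroup}
    (h : D.rep q * (D.rep q')⁻¹ ∈ D.translationSubgroup) : q = q' := by
  rw [rep, rep, inv_inv] at h
  rw [← QuotientGroup.out_eq' q, ← QuotientGroup.out_eq' q', QuotientGroup.eq]
  exact h

/-- Every element of `Γ / Z` is uniquely a translation times a representative. -/
lemma bijective_translation_mul_rep (ι : k →+* C) :
    Function.Bijective fun p : ((Γ ⧸ Z) ⧸ D.translationSubgroup) × D.translations.map (ι : k →+ C) =>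
      ((D.exists_translation p.2).choose : Γ ⧸ Z) * D.rep p.1 := by
  constructor
  · rintro ⟨q, b⟩ ⟨q', b'⟩ h
    obtain ⟨x, hx, hxb⟩ := (D.exists_translation b).choose_spec
    obtain ⟨x', hx', hxb'⟩ := (D.exists_translation b').choose_spec
    simp only at h
    set g := (D.exists_translation b).choose
    set g' := (D.exists_translation b').choose
    have hq : q = q' := by
      refine D.rep_injective ?_
      have e : D.rep q * (D.rep q')⁻¹ = (g : Γ ⧸ Z)⁻¹ * (g' : Γ ⧸ Z) := by
        rw [mul_inv_eq_iff_eq_mul, mul_assoc, ← h, inv_mul_cancel_left]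
      rw [e]
      exact Subgroup.mul_mem _ (Subgroup.inv_mem _ (D.mem_translationSubgroup.mpr ⟨g, ⟨x, hx⟩, rfl⟩))
        (D.mem_translationSubgroup.mpr ⟨g', ⟨x', hx'⟩, rfl⟩)
    subst hq
    have hg : (g : Γ ⧸ Z) = g' := mul_right_cancel h
    -- A central translation is trivial, so the class in `Γ / Z` determines the translation.
    rw [QuotientGroup.eq, D.mem_iff, map_mul, map_inv, hx, hx', ← AddChar.map_neg_eq_inv,
      ← AddChar.map_add_eq_mul] at hg
    have h0 := eq_zero_of_upperRightHom_mem_center hg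
    have h1 : x' = x := by linear_combination h0
    subst h1
    congr 1
    exact Subtype.ext (hxb.symm.trans hxb')
  · intro γ
    set q : (Γ ⧸ Z) ⧸ D.translationSubgroup := QuotientGroup.mk γ⁻¹ with hq
    have hu : γ * (D.rep q)⁻¹ ∈ D.translationSubgroup := by
      have h : (γ⁻¹)⁻¹ * q.out ∈ D.translationSubgroup :=
        QuotientGroup.eq.mp (QuotientGroup.out_eq' q).symm
      rw [rep, inv_inv]
      rwa [inv_inv] at h
    obtain ⟨g, ⟨x, hx⟩, hg⟩ := D.mem_translationSubgroup.mp hu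
    refine ⟨(q, ⟨ι x, x, ⟨g, hx⟩, rfl⟩), ?_⟩
    set b : D.translations.map (ι : k →+ C) := ⟨ι x, x, ⟨g, hx⟩, rfl⟩
    obtain ⟨x', hx', hxb'⟩ := (D.exists_translation b).choose_spec
    have hxx : x' = x := ι.injective hxb'
    rw [hxx, ← hx] at hx'
    simp only
    rw [D.mk_eq_mk_of_toHom_eq hx', hg, inv_mul_cancel_right]

omit [Z.Normal] in
-- By `|γω|_i = |ω|_i / |cω + d|²` with denominators bounded below: an orbit stays away from the
-- cusp `∞`.
lemma exists_distTo_act_le [CompleteSpace k] [IsUltrametricDist C] (hι : ∀ x, ‖ι x‖ = ‖x‖) {ω : C}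
    (hω : ω ∈ halfPlane ι) : ∃ R : ℝ, ∀ γ, distTo ι (D.act ι γ ω) ≤ R := by
  obtain ⟨κ, hκ, h⟩ := D.exists_le_norm_linear hι hω
  refine ⟨distTo ι ω / κ ^ 2, fun γ => ?_⟩
  rw [le_div_iff₀ (by positivity), ← distTo_moeb hι _ (D.norm_det γ.out) hω]
  have := h _ (D.entry_mem γ.out 1 0) _ (D.entry_mem γ.out 1 1) (bottom_ne_zero _)
  have h0 : 0 ≤ distTo ι (D.act ι γ ω) := distTo_nonneg _
  exact mul_le_mul_of_nonneg_left (pow_le_pow_left₀ hκ.le this 2) h0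

/-- If `|γω - γη| ≥ ε`, then `|cω + d|` is bounded. This leaves finitely many bottom rows and
determinants, hence finitely many cosets. -/
lemma finite_rep_sub [CompleteSpace k] (hι : ∀ x, ‖ι x‖ = ‖x‖) {ω η : C}
    (hω : ω ∈ halfPlane ι) (hη : η ∈ halfPlane ι) {ε : ℝ} (hε : 0 < ε) :
    {q | ε ≤ ‖D.act ι (D.rep q) ω - D.act ι (D.rep q) η‖}.Finite := by
  obtain ⟨κ, hκ, hη1⟩ := D.exists_le_norm_linear hι hη
  obtain ⟨N, hN⟩ := exists_norm_le_of_linear_le hι hω (‖ω - η‖ / (ε * κ))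
  have hfin := (((D.finiteBalls N).prod (D.finiteBalls N)).prod D.det_finite)
  set M : (Γ ⧸ Z) ⧸ D.translationSubgroup → GL (Fin 2) k := fun q => D.toHom (D.rep q).out
  refine Set.Finite.of_finite_image (f := fun q =>
    ((M q 1 0, M q 1 1), M q 0 0 * M q 1 1 - M q 0 1 * M q 1 0)) (hfin.subset ?_) ?_
  · rintro _ ⟨q, hq, rfl⟩
    have h1 := D.norm_moeb_sub_moeb (D.rep q).out hι hω hη
    have h2 := hη1 _ (D.entry_mem (D.rep q).out 1 0) _ (D.entry_mem (D.rep q).out 1 1)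
      (bottom_ne_zero _)
    have h3 := hN (M q 1 0) (M q 1 1) (by
      rw [le_div_iff₀ (by positivity), ← h1]
      calc ‖moebDenom ι (M q) ω‖ * (ε * κ) = ε * (‖moebDenom ι (M q) ω‖ * κ) := by ring
        _ ≤ _ := mul_le_mul hq (mul_le_mul_of_nonneg_left h2 (norm_nonneg _)) (by positivity)
            (norm_nonneg _))
    exact ⟨⟨⟨D.entry_mem _ _ _, h3.1⟩, ⟨D.entry_mem _ _ _, h3.2⟩⟩, ⟨_, rfl⟩⟩
  · intro q _ q' _ h
    simp only [Prod.mk.injEq] at h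
    obtain ⟨x, hx⟩ := eq_upperRightHom_mul h.1.1 h.1.2 h.2
    refine D.rep_injective (D.mem_translationSubgroup.mpr
      ⟨(D.rep q).out * (D.rep q').out⁻¹, ⟨x, ?_⟩, ?_⟩)
    · rw [map_mul, map_inv]
      exact mul_inv_eq_iff_eq_mul.mpr hx
    · rw [QuotientGroup.mk_mul, QuotientGroup.mk_inv, QuotientGroup.out_eq', QuotientGroup.out_eq']

/-- If the translations form a cocompact lattice, then `θ(ω, η, w)` is an analytic function of the
parameter `1 / e(w)` at the cusp `∞`, with value `1` at `∞`. -/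
theorem exists_theta_eq_analytic [CompleteSpace k] [CompleteSpace C] [IsUltrametricDist C]
    (hι : ∀ x, ‖ι x‖ = ‖x‖)
    (hcoc : ∃ R : ℝ, ∀ x : k, ∃ b ∈ D.translations, ‖x - b‖ ≤ R) {ω η : C}
    (hω : ω ∈ halfPlane ι) (hη : η ∈ halfPlane ι) :
    ∃ G : C → C, AnalyticAt C G 0 ∧ G 0 = 1 ∧ ∃ R : ℝ, ∀ w ∈ halfPlane ι, R ≤ distTo ι w →
      D.theta ι ω η w = G (1 / latticeExp (D.translations.map (ι : k →+ C)) w) := by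
  set Λ := D.translations.map (ι : k →+ C) with hΛdef
  have hΛ : FiniteBalls Λ := D.finiteBalls_map_translations hι
  -- A translation moves `γζ` into a fixed ball: it is at bounded distance from `k`, and `Λ` is
  -- cocompact in `k`.
  have hbdd : ∀ ζ ∈ halfPlane ι, ∃ B : ℝ, ∀ γ, ‖latticeExp Λ (D.act ι γ ζ)‖ ≤ B := by
    intro ζ hζ
    obtain ⟨R₁, hR₁⟩ := D.exists_distTo_act_le hι hζ
    obtain ⟨R₂, hR₂⟩ := hcoc
    obtain ⟨K, hK, hKb⟩ := exists_norm_latticeExp_le hΛ (max (R₁ + 1) R₂)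
    refine ⟨K * max (R₁ + 1) R₂, fun γ => ?_⟩
    obtain ⟨x, hx⟩ := exists_norm_sub_lt (lt_of_le_of_lt (hR₁ γ) (lt_add_one R₁))
    obtain ⟨b, hb, hxb⟩ := hR₂ x
    have hbΛ : ι b ∈ Λ := ⟨b, hb, rfl⟩
    rw [← latticeExp_sub_mem hΛ _ hbΛ]
    have hle : ‖D.act ι γ ζ - ι b‖ ≤ max (R₁ + 1) R₂ := by
      refine (norm_sub_le_max_sub _ (ι x) _).trans (max_le_max hx.le ?_)
      rw [← map_sub, hι]
      exact hxb
    exact (hKb _ hle).trans (by gcongr)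
  obtain ⟨B₁, hB₁⟩ := hbdd ω hω
  obtain ⟨B₂, hB₂⟩ := hbdd η hη
  set B := max 1 (max B₁ B₂)
  have hB : 0 < B := one_pos.trans_le (le_max_left _ _)
  have htend : Tendsto (fun q => latticeExp Λ (D.act ι (D.rep q) ω) -
      latticeExp Λ (D.act ι (D.rep q) η)) cofinite (𝓝 0) := by
    simp_rw [← latticeExp_sub hΛ]
    obtain ⟨K, hK, hKb⟩ := exists_norm_latticeExp_le hΛ 1
    rw [Metric.tendsto_nhds]
    intro ε hε
    rw [Filter.eventually_cofinite]
    refine (D.finite_rep_sub hι hω hη (ε := min 1 (ε / K)) (by positivity)).subset fun q hq => ?_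
    by_contra hc
    rw [Set.mem_ofPred_eq, not_le, lt_min_iff] at hc
    refine hq ?_
    rw [dist_eq_norm, sub_zero]
    refine (hKb _ hc.1.le).trans_lt ?_
    rw [lt_div_iff₀ hK] at hc
    rw [mul_comm]
    exact hc.2
  obtain ⟨G, hG, hG0, hGprod⟩ := exists_analyticAt_hasProd_div hB
    (x := fun q => latticeExp Λ (D.act ι (D.rep q) ω))
    (y := fun q => latticeExp Λ (D.act ι (D.rep q) η))
    (fun q => (hB₁ _).trans ((le_max_left _ _).trans (le_max_right _ _)))
    (fun q => (hB₂ _).trans ((le_max_right _ _).trans (le_max_right _ _))) htend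
  obtain ⟨R₁, hR₁⟩ := D.exists_distTo_act_le hι hη
  refine ⟨G, hG, hG0, max (R₁ + 1) (B + 1), fun w hw hRw => ?_⟩
  have hwR₁ : R₁ < distTo ι w := by
    have := le_of_max_le_left hRw
    linarith
  have hwB : B < distTo ι w := by
    have := le_of_max_le_right hRw
    linarith
  -- `|e(w)|` is at least the distance from `w` to `Λ`, hence at least `|w|_i`. So `t = 1/e(w)` lies
  -- in the disc `B|t| < 1` where the product expansion holds.
  have hew : B < ‖latticeExp Λ w‖ := by
    refine hwB.trans_le (le_norm_latticeExp hΛ ?_)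
    rintro _ ⟨x, -, rfl⟩
    exact distTo_le w x
  have hew0 : latticeExp Λ w ≠ 0 := norm_pos_iff.mp (hB.trans hew)
  set E := Equiv.ofBijective _ (D.bijective_translation_mul_rep ι)
  have hact : ∀ {ζ : C}, ζ ∈ halfPlane ι → ∀ p, D.act ι (E p) ζ = D.act ι (D.rep p.1) ζ + p.2 := by
    intro ζ hζ p
    obtain ⟨x, hx, hxb⟩ := (D.exists_translation p.2).choose_spec
    change D.act ι (((D.exists_translation p.2).choose : Γ ⧸ Z) * D.rep p.1) ζ = _
    rw [D.act_mk_mul _ _ hζ, hx, moeb_upperRightHom, hxb]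
  have hP := (D.multipliable_ratio hι hω hη (Or.inl hw)).hasProd
  rw [← E.hasProd_iff] at hP
  have hnot : ∀ q, w - D.act ι (D.rep q) η ∉ Λ := by
    intro q hmem
    have h1 := hact hη (q, ⟨_, hmem⟩)
    simp only [add_sub_cancel] at h1
    have h2 := hR₁ (E (q, ⟨_, hmem⟩))
    rw [h1] at h2
    linarith
  -- For a fixed coset, the product over its translations is a quotient of values of `e`.
  have hfib := hP.prod_fiberwise (g := fun q => latticeExp Λ (w - D.act ι (D.rep q) ω) /
      latticeExp Λ (w - D.act ι (D.rep q) η)) fun q => by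
    convert hasProd_latticeExp_div hΛ (w - D.act ι (D.rep q) ω) (hnot q) using 2 with b
    simp only [Function.comp]
    rw [hact hω, hact hη, sub_sub, sub_sub]
  refine hfib.unique ?_
  convert hGprod (1 / latticeExp Λ w) ?_ using 2 with q
  · rw [latticeExp_sub hΛ, latticeExp_sub hΛ]
    rw [← mul_div_mul_left (1 - 1 / latticeExp Λ w * latticeExp Λ (D.act ι (D.rep q) ω)) _ hew0]
    congr 1 <;> field_simp
  · rw [norm_div, norm_one, mul_one_div, div_lt_one (hB.trans hew)]
    exact hew

end DiscreteRep

end Drinfeld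

/-! ### Theta functions whose values are roots of unity -/

namespace Drinfeld

section RootsOfUnity

variable {C : Type*} [NontriviallyNormedField C] [IsUltrametricDist C]

omit [IsUltrametricDist C] in
-- By Fermat's theorem the image of `m` in `C` is a root of unity.
lemma norm_natCast_eq_one {p : ℕ} [Fact p.Prime] [CharP C p] {m : ℕ} (hm : ¬ p ∣ m) :
    ‖(m : C)‖ = 1 := by
  have hp : p.Prime := Fact.out
  have hcop : Nat.Coprime m p := (Nat.Prime.coprime_iff_not_dvd hp).mpr hm |>.symm
  have h1 : ((m ^ Nat.totient p : ℕ) : C) = ((1 : ℕ) : C) :=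
    (CharP.natCast_eq_natCast C p).mpr (Nat.ModEq.pow_totient hcop)
  have h2 : ‖(m : C)‖ ^ Nat.totient p = 1 := by
    rw [← norm_pow, ← Nat.cast_pow, h1, Nat.cast_one, norm_one]
  exact (pow_eq_one_iff_of_nonneg (norm_nonneg _) (Nat.totient_pos.mpr hp.pos).ne').mp h2

/-- In characteristic `p` a root of unity other than `1` has distance `1` from `1`. -/
lemma eq_one_or_one_le_norm_sub_one {p : ℕ} [Fact p.Prime] [CharP C p] {n : ℕ} (hn : n ≠ 0)
    {x : C} (hx : x ^ n = 1) : x = 1 ∨ 1 ≤ ‖x - 1‖ := by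
  by_contra! h
  obtain ⟨hx1, hlt⟩ := h
  have hp : p.Prime := Fact.out
  obtain ⟨e, m, hm, rfl⟩ := Nat.exists_eq_pow_mul_and_not_dvd hn p hp.ne_one
  -- Frobenius is injective, so the `p`-part of the exponent can be dropped.
  have hxm : x ^ m = 1 := by
    have h0 : (x ^ m - 1) ^ p ^ e = 0 := by
      rw [sub_pow_char_pow, ← pow_mul, one_pow, mul_comm m, hx, sub_self]
    exact sub_eq_zero.mp ((pow_eq_zero_iff (pow_pos hp.pos e).ne').mp h0)
  -- The `m` terms of this vanishing sum are all within `‖x - 1‖` of `1`, so `1 = ‖m‖ ≤ ‖x - 1‖`.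
  have hsum : (∑ i ∈ Finset.range m, x ^ i) = 0 := by
    have := geom_sum_mul x m
    rw [hxm, sub_self] at this
    exact (mul_eq_zero.mp this).resolve_right (sub_ne_zero.mpr hx1)
  have hle : ‖∑ i ∈ Finset.range m, (x ^ i - 1)‖ ≤ ‖x - 1‖ := by
    refine IsUltrametricDist.norm_sum_le_of_forall_le_of_nonneg (norm_nonneg _) fun i _ => ?_
    have := norm_prod_sub_one_le (f := fun _ : ℕ => x) (norm_nonneg (x - 1)) hlt.le
      (Finset.range i) fun _ _ => le_rfl
    simpa using this
  rw [Finset.sum_sub_distrib, hsum, zero_sub, norm_neg] at hle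
  simp only [Finset.sum_const, Finset.card_range, nsmul_eq_mul, mul_one] at hle
  rw [norm_natCast_eq_one (p := p) hm] at hle
  exact absurd hle (not_le.mpr hlt)

/-- A connectedness statement for rational functions on an annulus. -/
lemma norm_prod_div_sub_one_lt {I : Type*} (S : Finset I) (α β : I → C) (V : Set ℝ)
    (hV : ∀ U : Set ℝ, IsOpen U → (U ∩ Set.Ioi 0).Nonempty → ∃ z : C, ‖z‖ ∈ U ∧ ‖z‖ ∈ V)
    {r₁ R₀ R : ℝ} (hr₁ : 0 < r₁) (h10 : r₁ < R₀) (h0R : R₀ < R)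
    (h1 : ∀ z : C, r₁ < ‖z‖ → ‖z‖ < R → ‖z‖ ∈ V →
      ‖∏ i ∈ S, (z - α i) / (z - β i) - 1‖ ≤ 1 / 2 ∨ 1 ≤ ‖∏ i ∈ S, (z - α i) / (z - β i) - 1‖)
    (h2 : ∀ z : C, R₀ < ‖z‖ → ‖z‖ < R → ‖z‖ ∈ V → ‖∏ i ∈ S, (z - α i) / (z - β i) - 1‖ < 1)
    {z₀ : C} (hz₀ : ‖z₀‖ = r₁) (hz₀β : ∀ i ∈ S, ‖z₀ - β i‖ = max ‖z₀‖ ‖β i‖) :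
    ‖∏ i ∈ S, (z₀ - α i) / (z₀ - β i) - 1‖ < 1 := by
  classical
  set f : C[X] := ∏ i ∈ S, (X - Polynomial.C (α i)) - ∏ i ∈ S, (X - Polynomial.C (β i)) with hf
  have hfe : ∀ z, f.eval z = ∏ i ∈ S, (z - α i) - ∏ i ∈ S, (z - β i) := fun z => by
    simp [hf, Polynomial.eval_prod]
  set Q : ℝ → ℝ := fun r => ∏ i ∈ S, max r ‖β i‖ with hQ
  have hQpos : ∀ r, 0 < r → 0 < Q r := fun r hr =>
    Finset.prod_pos fun i _ => hr.trans_le (le_max_left _ _)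
  have hval : ∀ z : C, 0 < ‖z‖ → (∀ i ∈ S, ‖z - β i‖ = max ‖z‖ ‖β i‖) →
      ‖∏ i ∈ S, (z - α i) / (z - β i) - 1‖ = ‖f.eval z‖ / Q ‖z‖ := by
    intro z hz h
    have hq : ‖∏ i ∈ S, (z - β i)‖ = Q ‖z‖ := by
      rw [norm_prod]
      exact Finset.prod_congr rfl h
    have hne : ∏ i ∈ S, (z - β i) ≠ 0 := norm_pos_iff.mp (hq ▸ hQpos _ hz)
    rw [Finset.prod_div_distrib, ← hq, ← norm_div, hfe, sub_div, div_self hne]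
  by_cases hf0 : f = 0
  · rw [hval z₀ (hz₀ ▸ hr₁) hz₀β, hf0]
    simp
  have hne : f.support.Nonempty := Polynomial.nonempty_support_iff.mpr hf0
  -- `N r` is the Gauss norm of `f` at radius `r`. It bounds `‖f(z)‖` for `‖z‖ = r`, with equality
  -- unless two terms have the same norm.
  set N : ℝ → ℝ := fun r => f.support.sup' hne fun j => ‖f.coeff j‖ * r ^ j with hN
  have hNle : ∀ z : C, ‖f.eval z‖ ≤ N ‖z‖ := by
    intro z
    rw [Polynomial.eval_eq_sum, Polynomial.sum_def]
    refine (Finset.Nonempty.norm_sum_le_sup'_norm hne _).trans ?_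
    simp only [norm_mul, norm_pow, hN]
    exact le_rfl
  -- The radii where two terms of `f` have equal norm, or which equal some `‖β i‖`. Off this finite
  -- set `‖∏ - 1‖ = N/Q`. Pairs with `p.2 ≤ p.1` have truncated difference `0` and contribute only
  -- the harmless radius `1`.
  set bad : Set ℝ := ((f.support ×ˢ f.support).image fun p =>
    (‖f.coeff p.1‖ / ‖f.coeff p.2‖) ^ (((p.2 - p.1 : ℕ) : ℝ)⁻¹) : Finset ℝ) ∪
      (S.image fun i => ‖β i‖ : Finset ℝ) with hbad
  have hbadfin : bad.Finite := (Finset.finite_toSet _).union (Finset.finite_toSet _)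
  have hNeq : ∀ z : C, 0 < ‖z‖ → ‖z‖ ∉ bad → ‖f.eval z‖ = N ‖z‖ := by
    intro z hz hzb
    have key : ∀ i ∈ f.support, ∀ j ∈ f.support, i < j →
        ‖f.coeff i‖ * ‖z‖ ^ i ≠ ‖f.coeff j‖ * ‖z‖ ^ j := by
      intro i hi j hj hij heq
      refine hzb (Or.inl ?_)
      rw [Finset.mem_coe, Finset.mem_image]
      refine ⟨(i, j), Finset.mem_product.mpr ⟨hi, hj⟩, ?_⟩
      have hj0 : ‖f.coeff j‖ ≠ 0 := norm_ne_zero_iff.mpr (Polynomial.mem_support_iff.mp hj)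
      have hdiv : ‖f.coeff i‖ / ‖f.coeff j‖ = ‖z‖ ^ (j - i) := by
        rw [div_eq_iff hj0]
        have hzi : ‖z‖ ^ i ≠ 0 := (pow_pos hz i).ne'
        refine mul_right_cancel₀ hzi ?_
        rw [heq, mul_right_comm, ← pow_add, Nat.sub_add_cancel hij.le, mul_comm]
      simp only
      rw [hdiv]
      exact Real.pow_rpow_inv_natCast hz.le (Nat.sub_pos_of_lt hij).ne'
    rw [Polynomial.eval_eq_sum, Polynomial.sum_def,
      IsUltrametricDist.norm_sum_eq_sup'_of_pairwise_ne hne]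
    · simp only [norm_mul, norm_pow, hN]
    · intro i hi j hj hij
      simp only [norm_mul, norm_pow]
      rcases lt_or_gt_of_ne hij with h | h
      · exact key i hi j hj h
      · exact (key j hj i hi h).symm
  have hgen : ∀ z : C, 0 < ‖z‖ → ‖z‖ ∉ bad →
      ‖∏ i ∈ S, (z - α i) / (z - β i) - 1‖ = N ‖z‖ / Q ‖z‖ := by
    intro z hz hzb
    rw [hval z hz, hNeq z hz hzb]
    intro i hi
    have hnei : ‖z‖ ≠ ‖β i‖ := fun h => hzb (Or.inr (by
      rw [h]
      exact Finset.mem_coe.mpr (Finset.mem_image_of_mem _ hi)))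
    have := IsUltrametricDist.norm_add_eq_max_of_norm_ne_norm (x := z) (y := -β i) (by
      rwa [norm_neg])
    rwa [norm_neg, ← sub_eq_add_neg] at this
  have hV' : ∀ U : Set ℝ, IsOpen U → U ⊆ Set.Ioi 0 → U.Nonempty →
      ∃ z : C, ‖z‖ ∈ U ∧ ‖z‖ ∈ V ∧ ‖z‖ ∉ bad := by
    intro U hU hU0 hne
    have hd : Dense badᶜ := hbadfin.countable.dense_compl ℝ
    obtain ⟨c, hcU, hcb⟩ := hd.inter_open_nonempty U hU hne
    obtain ⟨z, hz, hzV⟩ := hV (U ∩ badᶜ) (hU.inter hbadfin.isClosed.isOpen_compl)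
      ⟨c, ⟨hcU, hcb⟩, hU0 hcU⟩
    exact ⟨z, hz.1, hzV, hz.2⟩
  have hNc : Continuous N := Continuous.finset_sup'_apply hne fun j _ => by fun_prop
  have hQc : Continuous Q := by
    refine continuous_finsetProd _ fun i _ => ?_
    fun_prop
  obtain ⟨z₁, hz₁, hz₁V, hz₁b⟩ := hV' (Set.Ioo R₀ R) isOpen_Ioo
    (fun x hx => hr₁.trans (h10.trans hx.1)) (Set.nonempty_Ioo.mpr h0R)
  have hz₁pos : 0 < ‖z₁‖ := hr₁.trans (h10.trans hz₁.1)
  have hz₁half : N ‖z₁‖ / Q ‖z₁‖ ≤ 1 / 2 := by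
    have h3 := h1 z₁ (h10.trans hz₁.1) hz₁.2 hz₁V
    have h4 := h2 z₁ hz₁.1 hz₁.2 hz₁V
    rw [← hgen z₁ hz₁pos hz₁b]
    exact h3.resolve_right (not_le.mpr h4)
  by_contra hcon
  rw [not_lt, hval z₀ (hz₀ ▸ hr₁) hz₀β, hz₀] at hcon
  -- The radius `r₁` may be bad, but the inequality `‖f(z₀)‖ ≤ N r₁` suffices here.
  have hr₁one : 1 ≤ N r₁ / Q r₁ := by
    refine hcon.trans ?_
    have := hNle z₀
    rw [hz₀] at this
    exact div_le_div_of_nonneg_right this (hQpos _ hr₁).le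
  have hcont : ContinuousOn (fun r => N r / Q r) (Set.Ioi 0) :=
    hNc.continuousOn.div hQc.continuousOn fun r hr => (hQpos r hr).ne'
  have hr₁z₁ : r₁ < ‖z₁‖ := h10.trans hz₁.1
  -- The continuous function `N/Q` would pass through `3/4`, hence lie in `(1/2, 1)` on an open set
  -- of radii. A good radius there contradicts `h1`.
  obtain ⟨c, hc, hcval⟩ : (3 / 4 : ℝ) ∈ (fun r => N r / Q r) '' Set.Icc r₁ ‖z₁‖ :=
    intermediate_value_Icc' hr₁z₁.le (hcont.mono fun r hr => hr₁.trans_le hr.1)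
      ⟨by linarith, by linarith⟩
  simp only at hcval
  have hcr₁ : r₁ < c := lt_of_le_of_ne hc.1 (by
    rintro rfl
    linarith)
  have hcz₁ : c < ‖z₁‖ := lt_of_le_of_ne hc.2 (by
    rintro rfl
    linarith)
  have hU : IsOpen (Set.Ioo r₁ ‖z₁‖ ∩ (fun r => N r / Q r) ⁻¹' Set.Ioo (1 / 2) 1) :=
    (hcont.mono fun r hr => hr₁.trans hr.1).isOpen_inter_preimage isOpen_Ioo isOpen_Ioo
  obtain ⟨z, hz, hzV, hzb⟩ := hV' _ hU (fun r hr => hr₁.trans hr.1.1)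
    ⟨c, ⟨hcr₁, hcz₁⟩, by simp only [Set.mem_preimage, hcval]; norm_num⟩
  have h5 := h1 z hz.1.1 (hz.1.2.trans hz₁.2) hzV
  rw [hgen z (hr₁.trans hz.1.1) hzb] at h5
  have h6 : 1 / 2 < N ‖z‖ / Q ‖z‖ ∧ N ‖z‖ / Q ‖z‖ < 1 := hz.2
  rcases h5 with h5 | h5 <;> linarith [h6.1, h6.2]

end RootsOfUnity

/-! ### Theta functions of finite order are trivial -/

namespace DiscreteRep

variable {k C : Type*} [NormedField k] [NontriviallyNormedField C] [IsUltrametricDist C]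
  {Γ : Type*} [Group Γ] {Z : Subgroup Γ} {ι : k →+* C} (D : DiscreteRep k Z)

/-- The norms of the elements of `C` that do not have the norm of an element of `k` are dense. -/
def DenseNorms (ι : k →+* C) : Prop :=
  ∀ U : Set ℝ, IsOpen U → (U ∩ Set.Ioi 0).Nonempty →
    ∃ z : C, ‖z‖ ∈ U ∧ ‖z‖ ∈ (Set.range fun x : k => ‖ι x‖)ᶜ

lemma norm_le_norm_sub_of_notMem {z : C} (hz : ‖z‖ ∈ (Set.range fun x : k => ‖ι x‖)ᶜ) (x : k) :
    ‖z‖ ≤ ‖z - ι x‖ := by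
  have := IsUltrametricDist.norm_add_eq_max_of_norm_ne_norm (x := z) (y := -ι x) (by
    rw [norm_neg]
    exact fun h => hz ⟨x, h.symm⟩)
  rw [sub_eq_add_neg, this]
  exact le_max_left _ _

lemma distTo_eq_norm {z : C} (hz : ‖z‖ ∈ (Set.range fun x : k => ‖ι x‖)ᶜ) : distTo ι z = ‖z‖ :=
  le_antisymm (distTo_le_norm z) (le_distTo (norm_le_norm_sub_of_notMem hz))

omit [IsUltrametricDist C] in
lemma mem_halfPlane_of_notMem {z : C} (hz : ‖z‖ ∈ (Set.range fun x : k => ‖ι x‖)ᶜ) :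
    z ∈ halfPlane ι := by
  rintro ⟨x, rfl⟩
  exact hz ⟨x, rfl⟩

/-- There are orbits that avoid a given region `r ≤ |z|_i ≤ R`. -/
lemma exists_orbit_avoiding [CompleteSpace k] (hι : ∀ x, ‖ι x‖ = ‖x‖) (hd : DenseNorms ι)
    {r : ℝ} (hr : 0 < r) (R : ℝ) :
    ∃ ω ∈ halfPlane ι, ∀ γ, distTo ι (D.act ι γ ω) < r ∨ R < distTo ι (D.act ι γ ω) := by
  obtain ⟨m, hm0, hm⟩ := D.exists_le_norm
  -- Here `|ω|_i = ‖ω‖` is large. If `c = 0`, then `|ad| = 1` and `|γω|_i = ‖ω‖/|d|² ≥ m²‖ω‖ > R`.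
  -- If `c ≠ 0`, then `|cω + d| ≥ m‖ω‖` and `|γω|_i ≤ 1/(m²‖ω‖) < r`.
  obtain ⟨ω, hω, hωk⟩ := hd (Set.Ioi (max (1 / (m ^ 2 * r)) (R / m ^ 2))) isOpen_Ioi
    ⟨max (1 / (m ^ 2 * r)) (R / m ^ 2) + 1, by simp,
      lt_of_lt_of_le (a := 0) (by positivity : (0 : ℝ) < 1 / (m ^ 2 * r) + 1)
        (by gcongr; exact le_max_left _ _)⟩
  have hωΩ := mem_halfPlane_of_notMem hωk
  obtain ⟨h1, h2⟩ := max_lt_iff.mp (Set.mem_Ioi.mp hω)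
  have hωpos : 0 < ‖ω‖ := lt_trans (by positivity) h1
  refine ⟨ω, hωΩ, fun γ => ?_⟩
  have hdist := distTo_moeb hι _ (D.norm_det γ.out) hωΩ
  rw [distTo_eq_norm hωk] at hdist
  have hdpos := norm_pos_iff.mpr (moebDenom_ne_zero (D.toHom γ.out) hωΩ)
  change distTo ι (moeb ι (D.toHom γ.out) ω) < r ∨ R < distTo ι (moeb ι (D.toHom γ.out) ω)
  rw [← eq_div_iff (by positivity)] at hdist
  rw [hdist]
  by_cases hc : D.toHom γ.out 1 0 = 0
  · right
    have hdet := D.norm_det γ.out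
    rw [hc, mul_zero, sub_zero, norm_mul] at hdet
    have ha : m ≤ ‖D.toHom γ.out 0 0‖ := hm _ (D.entry_mem _ _ _) fun h0 => by
      rw [h0, norm_zero, zero_mul] at hdet
      exact zero_ne_one hdet
    have hden : ‖moebDenom ι (D.toHom γ.out) ω‖ = ‖D.toHom γ.out 1 1‖ := by
      rw [moebDenom, hc, map_zero, zero_mul, zero_add, hι]
    have hdm : m * ‖moebDenom ι (D.toHom γ.out) ω‖ ≤ 1 := by
      rw [hden, ← hdet]
      gcongr
    have hdm2 : (m * ‖moebDenom ι (D.toHom γ.out) ω‖) ^ 2 ≤ 1 := pow_le_one₀ (by positivity) hdm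
    rw [div_lt_iff₀ (by positivity)] at h2
    rw [lt_div_iff₀ (by positivity)]
    rcases le_or_gt R 0 with hR | hR
    · exact lt_of_le_of_lt (mul_nonpos_of_nonpos_of_nonneg hR (by positivity)) hωpos
    · calc R * ‖moebDenom ι (D.toHom γ.out) ω‖ ^ 2
          < (‖ω‖ * m ^ 2) * ‖moebDenom ι (D.toHom γ.out) ω‖ ^ 2 := by gcongr
        _ = ‖ω‖ * (m * ‖moebDenom ι (D.toHom γ.out) ω‖) ^ 2 := by ring
        _ ≤ ‖ω‖ * 1 := by gcongr
        _ = ‖ω‖ := mul_one _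
  · left
    have hcm := hm _ (D.entry_mem γ.out 1 0) hc
    have hle : m * ‖ω‖ ≤ ‖moebDenom ι (D.toHom γ.out) ω‖ := by
      refine le_trans ?_ (norm_mul_distTo_le hι ω _ _)
      rw [distTo_eq_norm hωk]
      gcongr
    rw [div_lt_iff₀ (by positivity)]
    rw [div_lt_iff₀ (by positivity)] at h1
    calc ‖ω‖ = ‖ω‖ * 1 := (mul_one _).symm
      _ < ‖ω‖ * (‖ω‖ * (m ^ 2 * r)) := by gcongr
      _ = r * (m * ‖ω‖) ^ 2 := by ring
      _ ≤ r * ‖moebDenom ι (D.toHom γ.out) ω‖ ^ 2 := by gcongr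

/-- If a power of `θ(ω, aω, ·)` is identically `1`, then so is `θ(ω, aω, ·)`. -/
theorem theta_eq_one_of_pow_eq_one [CompleteSpace k] [CompleteSpace C] [Z.Normal]
    {p : ℕ} [Fact p.Prime] [CharP C p]
    (hι : ∀ x, ‖ι x‖ = ‖x‖) (hcoc : ∃ R : ℝ, ∀ x : k, ∃ b ∈ D.translations, ‖x - b‖ ≤ R)
    (hd : DenseNorms ι) (hatt : ∀ z ∈ halfPlane ι, ∃ x, ‖z - ι x‖ = distTo ι z)
    {a : Γ} {n : ℕ} (hn : n ≠ 0)
    (h : ∀ z ∈ halfPlane ι, ∀ ω ∈ halfPlane ι, (∀ γ, D.act ι γ ω ≠ z) →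
      D.theta ι ω (moeb ι (D.toHom a) ω) z ^ n = 1)
    {z ω : C} (hz : z ∈ halfPlane ι) (hω : ω ∈ halfPlane ι) (hzω : ∀ γ, D.act ι γ ω ≠ z) :
    D.theta ι ω (moeb ι (D.toHom a) ω) z = 1 := by
  have hroot : ∀ z ∈ halfPlane ι, ∀ ω ∈ halfPlane ι, (∀ γ, D.act ι γ ω ≠ z) →
      D.theta ι ω (moeb ι (D.toHom a) ω) z = 1 ∨
        1 ≤ ‖D.theta ι ω (moeb ι (D.toHom a) ω) z - 1‖ := fun z hz ω hω hzω =>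
    eq_one_or_one_le_norm_sub_one (p := p) hn (h z hz ω hω hzω)
  -- Near `∞` the function is at distance less than `1` from its limit `1`; being a root of unity,
  -- it equals `1` there.
  obtain ⟨R₀, hR₀z, hR₀⟩ : ∃ R₀ : ℝ, distTo ι z < R₀ ∧ ∀ w ∈ halfPlane ι, R₀ ≤ distTo ι w →
      (∀ γ, D.act ι γ ω ≠ w) ∧ D.theta ι ω (moeb ι (D.toHom a) ω) w = 1 := by
    obtain ⟨G, hG, hG0, R₁, hR₁⟩ :=
      D.exists_theta_eq_analytic hι hcoc hω (moeb_mem_halfPlane (D.toHom a) hω)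
    obtain ⟨R₂, hR₂⟩ := D.exists_distTo_act_le hι hω
    have hGc := hG.continuousAt
    rw [Metric.continuousAt_iff] at hGc
    obtain ⟨δ, hδ, hGδ⟩ := hGc 1 one_pos
    refine ⟨max (max R₁ (R₂ + 1)) (max (distTo ι z + 1) (1 / δ + 1)), ?_, fun w hw hRw => ?_⟩
    · exact lt_of_lt_of_le (lt_add_one _) ((le_max_left _ _).trans (le_max_right _ _))
    simp only [max_le_iff] at hRw
    have hne : ∀ γ, D.act ι γ ω ≠ w := by
      rintro γ rfl
      linarith [hR₂ γ, hRw.1.2]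
    refine ⟨hne, (hroot w hw ω hω hne).resolve_right (not_le.mpr ?_)⟩
    rw [hR₁ w hw hRw.1.1]
    suffices hs : dist (1 / latticeExp (D.translations.map (ι : k →+ C)) w) 0 < δ by
      have := hGδ hs
      rwa [hG0, dist_eq_norm] at this
    have hle : distTo ι w ≤ ‖latticeExp (D.translations.map (ι : k →+ C)) w‖ := by
      refine le_norm_latticeExp (D.finiteBalls_map_translations hι) ?_
      rintro _ ⟨x, -, rfl⟩
      exact distTo_le w x
    have hlt : 1 / δ < ‖latticeExp (D.translations.map (ι : k →+ C)) w‖ := by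
      linarith [hRw.2.2]
    rw [dist_eq_norm, sub_zero, norm_div, norm_one]
    exact (one_div_lt hδ (lt_trans (by positivity) hlt)).mp hlt
  obtain ⟨x₀, hx₀⟩ := hatt z hz
  set r₁ := distTo ι z with hr₁
  have hr₁pos : 0 < r₁ := distTo_pos hι hz
  -- The function is followed from `z` to the cusp through points `w` with `|w|_i = ‖w - x₀‖`
  -- between `r₁` and `R₀ + 1`. With `ω₁` in place of `ω` no factor has a zero or pole there.
  obtain ⟨ω₁, hω₁, hav⟩ := D.exists_orbit_avoiding hι hd hr₁pos (R₀ + 1)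
  set η₁ := moeb ι (D.toHom a) ω₁ with hη₁def
  have hη₁ : η₁ ∈ halfPlane ι := moeb_mem_halfPlane _ hω₁
  have hav' : ∀ γ, distTo ι (D.act ι γ η₁) < r₁ ∨ R₀ + 1 < distTo ι (D.act ι γ η₁) := by
    intro γ
    rw [hη₁def, ← D.act_mul_mk γ a hω₁]
    exact hav _
  have hmax : ∀ w, r₁ ≤ ‖w - ι x₀‖ → ‖w - ι x₀‖ ≤ R₀ + 1 → distTo ι w = ‖w - ι x₀‖ →
      ∀ β, (distTo ι β < r₁ ∨ R₀ + 1 < distTo ι β) →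
        ‖w - β‖ = max ‖w - ι x₀‖ ‖β - ι x₀‖ := by
    intro w h1 h2 hw β hβ
    have hge : ‖w - ι x₀‖ ≤ ‖w - β‖ := by
      by_contra! hlt
      rw [← hw] at hlt h1 h2
      have h3 : distTo ι w ≤ distTo ι β :=
        (le_max_iff.mp (distTo_le_max (ι := ι) w β)).resolve_left (not_le.mpr hlt)
      have h4 : distTo ι β ≤ distTo ι w := by
        have := distTo_le_max (ι := ι) β w
        rw [norm_sub_rev] at this
        exact this.trans (max_le hlt.le le_rfl)
      rcases hβ with hβ | hβ <;> linarith
    refine le_antisymm ?_ (max_le hge ?_)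
    · have := norm_sub_le_max_sub w (ι x₀) β
      rwa [norm_sub_rev (ι x₀)] at this
    · have := norm_sub_le_max_sub β w (ι x₀)
      rw [norm_sub_rev β w] at this
      exact this.trans (max_le le_rfl hge)
  have hne : ∀ w, r₁ ≤ ‖w - ι x₀‖ → ‖w - ι x₀‖ ≤ R₀ + 1 → distTo ι w = ‖w - ι x₀‖ →
      ∀ γ, D.act ι γ ω₁ ≠ w := by
    rintro w h1 h2 hw γ rfl
    rw [← hw] at h1 h2
    rcases hav γ with h | h <;> linarith
  have hfin := finite_le_norm_sub_one (D.tendsto_ratio hι hω₁ hη₁ (Or.inl hz))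
    (one_half_pos (α := ℝ))
  set S := hfin.toFinset with hS
  -- By `hmax` a factor minus `1` has norm `|γη₁ - γω₁| / max(‖w - x₀‖, ‖γη₁ - x₀‖)`, which does not
  -- increase with `‖w - x₀‖`. So the finite set `S` chosen at `z` serves the whole region. The
  -- partial product has norm `1`, since the theta value is a root of unity.
  have happrox : ∀ w ∈ halfPlane ι, r₁ ≤ ‖w - ι x₀‖ → ‖w - ι x₀‖ ≤ R₀ + 1 →
      distTo ι w = ‖w - ι x₀‖ →
      ‖D.theta ι ω₁ η₁ w - ∏ γ ∈ S, (w - D.act ι γ ω₁) / (w - D.act ι γ η₁)‖ ≤ 1 / 2 := by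
    intro w hw h1 h2 hdw
    have hle := norm_sub_prod_le_of_hasProd
      (D.multipliable_ratio hι hω₁ hη₁ (Or.inl hw)).hasProd (one_half_pos (α := ℝ)).le
      (by norm_num) S fun γ hγ => by
        simp only [hS, Set.Finite.mem_toFinset, Set.mem_ofPred_eq, not_le] at hγ
        refine le_trans ?_ hγ.le
        have e : ∀ y, D.act ι γ η₁ ≠ y → (y - D.act ι γ ω₁) / (y - D.act ι γ η₁) - 1 =
            (D.act ι γ η₁ - D.act ι γ ω₁) / (y - D.act ι γ η₁) := by
          intro y hy
          have := sub_ne_zero.mpr hy.symm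
          field_simp
          ring
        have hzr : r₁ ≤ ‖z - ι x₀‖ := hx₀.ge
        have hzR : ‖z - ι x₀‖ ≤ R₀ + 1 := by linarith
        have hwne := D.act_moeb_ne a hω₁ (hne w h1 h2 hdw) γ
        have hzne := D.act_moeb_ne a hω₁ (hne z hzr hzR hx₀.symm) γ
        rw [e w hwne, e z hzne, norm_div, norm_div, hmax w h1 h2 hdw _ (hav' γ),
          hmax z hzr hzR hx₀.symm _ (hav' γ), hx₀]
        refine div_le_div_of_nonneg_left (norm_nonneg _) (lt_max_of_lt_left hr₁pos) ?_
        exact max_le_max h1 le_rfl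
    set P := ∏ γ ∈ S, (w - D.act ι γ ω₁) / (w - D.act ι γ η₁)
    change ‖D.theta ι ω₁ η₁ w - P‖ ≤ ‖P‖ * (1 / 2) at hle
    have hu : ‖D.theta ι ω₁ η₁ w‖ = 1 := by
      have := h w hw ω₁ hω₁ (hne w h1 h2 hdw)
      refine (pow_eq_one_iff_of_nonneg (norm_nonneg _) hn).mp ?_
      rw [← norm_pow, this, norm_one]
    have hP0 : 0 < ‖P‖ := by
      rw [norm_pos_iff]
      intro h0
      rw [h0, sub_zero, norm_zero, zero_mul, hu] at hle
      linarith
    have hP1 : ‖P‖ = 1 := by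
      have := norm_sub_eq_left (x := P) (y := P - D.theta ι ω₁ η₁ w) (by
        rw [norm_sub_rev]
        linarith)
      rw [sub_sub_cancel, hu] at this
      exact this.symm
    rwa [hP1, one_mul] at hle
  have hshift : ∀ (w : C), ∏ γ ∈ S, ((w - ι x₀) - (D.act ι γ ω₁ - ι x₀)) /
      ((w - ι x₀) - (D.act ι γ η₁ - ι x₀)) =
        ∏ γ ∈ S, (w - D.act ι γ ω₁) / (w - D.act ι γ η₁) := fun w =>
    Finset.prod_congr rfl fun γ _ => by rw [sub_sub_sub_cancel_right, sub_sub_sub_cancel_right]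
  have hvert : ∀ y : C, ‖y‖ ∈ (Set.range fun x : k => ‖ι x‖)ᶜ →
      y + ι x₀ ∈ halfPlane ι ∧ distTo ι (y + ι x₀) = ‖y‖ := by
    intro y hy
    refine ⟨?_, le_antisymm ?_ (le_distTo fun x => ?_)⟩
    · rintro ⟨x, hx⟩
      refine hy ⟨x - x₀, ?_⟩
      simp only
      rw [map_sub, hx, add_sub_cancel_right]
    · simpa using distTo_le (ι := ι) (y + ι x₀) x₀
    · have := norm_le_norm_sub_of_notMem hy (x - x₀)
      rw [map_sub] at this
      convert this using 2
      ring
  have hfinal : ‖∏ γ ∈ S, (z - D.act ι γ ω₁) / (z - D.act ι γ η₁) - 1‖ < 1 := by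
    rw [← hshift]
    refine norm_prod_div_sub_one_lt S (fun γ => D.act ι γ ω₁ - ι x₀)
      (fun γ => D.act ι γ η₁ - ι x₀) _ hd hr₁pos hR₀z (lt_add_one R₀) ?_ ?_ hx₀ ?_
    · intro y h1 h2 hy
      obtain ⟨hyΩ, hyd⟩ := hvert y hy
      have e : y = y + ι x₀ - ι x₀ := by ring
      have h1' : r₁ ≤ ‖y + ι x₀ - ι x₀‖ := by rw [← e]; exact h1.le
      have h2' : ‖y + ι x₀ - ι x₀‖ ≤ R₀ + 1 := by rw [← e]; exact h2.le
      have hyd' : distTo ι (y + ι x₀) = ‖y + ι x₀ - ι x₀‖ := by rw [← e, hyd]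
      have hap := happrox _ hyΩ h1' h2' hyd'
      rw [e, hshift]
      rcases hroot _ hyΩ ω₁ hω₁ (hne _ h1' h2' hyd') with hu | hu
      · left
        rw [hu, norm_sub_rev] at hap
        exact hap
      · right
        have := hu.trans (norm_sub_le_max_sub _
          (∏ γ ∈ S, (y + ι x₀ - D.act ι γ ω₁) / (y + ι x₀ - D.act ι γ η₁)) _)
        refine (le_max_iff.mp this).resolve_left (not_le.mpr ?_)
        exact hap.trans_lt (by norm_num)
    · intro y h1 h2 hy
      obtain ⟨hyΩ, hyd⟩ := hvert y hy
      have e : y = y + ι x₀ - ι x₀ := by ring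
      have h1' : r₁ ≤ ‖y + ι x₀ - ι x₀‖ := by rw [← e]; exact (hR₀z.trans h1).le
      have h2' : ‖y + ι x₀ - ι x₀‖ ≤ R₀ + 1 := by rw [← e]; exact h2.le
      have hyd' : distTo ι (y + ι x₀) = ‖y + ι x₀ - ι x₀‖ := by rw [← e, hyd]
      have hap := happrox _ hyΩ h1' h2' hyd'
      obtain ⟨hωy, hone⟩ := hR₀ _ hyΩ (by rw [hyd]; exact h1.le)
      -- Triviality near the cusp is known for `ω`; independence of the base point transfers it to
      -- `ω₁`.
      rw [D.theta_moeb_self hι a hω hω₁ (Or.inl hyΩ) hωy (hne _ h1' h2' hyd')] at hone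
      rw [e, hshift]
      change D.theta ι ω₁ η₁ _ = 1 at hone
      rw [hone, norm_sub_rev] at hap
      exact hap.trans_lt (by norm_num)
    · intro γ _
      rw [sub_sub_sub_cancel_right]
      exact hmax z hx₀.ge (by linarith) hx₀.symm _ (hav' γ)
  have hzr : r₁ ≤ ‖z - ι x₀‖ := hx₀.ge
  have hzR : ‖z - ι x₀‖ ≤ R₀ + 1 := by linarith
  have hω₁z := hne z hzr hzR hx₀.symm
  rw [D.theta_moeb_self hι a hω hω₁ (Or.inl hz) hzω hω₁z]
  refine (hroot z hz ω₁ hω₁ hω₁z).resolve_right (not_le.mpr ?_)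
  refine (norm_sub_le_max_sub _ _ _).trans_lt (max_lt ?_ hfinal)
  exact (happrox z hz hzr hzR hx₀.symm).trans_lt (by norm_num)

end DiscreteRep

end Drinfeld

/-! ### Expansion of theta functions at the other cusps -/

namespace Drinfeld

/-- The matrix `(s 1; 1 0)`, which maps `∞` to `s`. -/
def cuspMatrix {k : Type*} [Field k] (s : k) : GL (Fin 2) k :=
  ⟨!![s, 1; 1, 0], !![0, 1; 1, -s], by simp [Matrix.one_fin_two], by simp [Matrix.one_fin_two]⟩

namespace DiscreteRep

variable {k C : Type*} [NormedField k] [NontriviallyNormedField C]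
  {Γ : Type*} [Group Γ] {Z : Subgroup Γ} {ι : k →+* C}

lemma ne_zero_of_mem_halfPlane {w : C} (hw : w ∈ halfPlane ι) : w ≠ 0 := by
  rintro rfl
  exact hw ⟨0, map_zero ι⟩

lemma moeb_cuspMatrix (s : k) {w : C} (hw : w ∈ halfPlane ι) :
    moeb ι (cuspMatrix s) w = ι s + 1 / w := by
  have := ne_zero_of_mem_halfPlane hw
  simp only [moeb, moebDenom, cuspMatrix]
  simp
  field_simp

variable [IsUltrametricDist C] [CompleteSpace k] [CompleteSpace C] [Z.Normal]

/-- The expansion of `θ(ω, η, ·)` at the cusp `s`. -/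
theorem exists_theta_eq_analytic_cusp (D D' : DiscreteRep k Z) (s : k)
    (hconj : ∀ g, D.toHom g * cuspMatrix s = cuspMatrix s * D'.toHom g)
    (hι : ∀ x, ‖ι x‖ = ‖x‖) (hcoc : ∃ R : ℝ, ∀ x : k, ∃ b ∈ D'.translations, ‖x - b‖ ≤ R) {ω η : C}
    (hω : ω ∈ halfPlane ι) (hη : η ∈ halfPlane ι) :
    Multipliable (fun γ : Γ ⧸ Z => (ι s - D.act ι γ ω) / (ι s - D.act ι γ η)) ∧
    ∃ G : C → C, AnalyticAt C G 0 ∧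
      G 0 = ∏' γ : Γ ⧸ Z, (ι s - D.act ι γ ω) / (ι s - D.act ι γ η) ∧
      ∃ R : ℝ, ∀ w ∈ halfPlane ι, R ≤ distTo ι w → (∀ γ, D.act ι γ ω ≠ ι s + 1 / w) ∧
        D.theta ι ω η (ι s + 1 / w) =
          G (1 / latticeExp (D'.translations.map (ι : k →+ C)) w) := by
  have hact : ∀ ζ ∈ halfPlane ι, ∀ γ, D.act ι γ ζ =
      ι s + 1 / D'.act ι γ (moeb ι (cuspMatrix s)⁻¹ ζ) := by
    intro ζ hζ γ
    have hζ' := moeb_mem_halfPlane (cuspMatrix s)⁻¹ hζ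
    rw [← moeb_cuspMatrix s (D'.act_mem hζ' γ), act, act, ← moeb_mul _ _ hζ', ← hconj,
      moeb_mul _ _ hζ', ← moeb_mul _ _ hζ, mul_inv_cancel, moeb_one]
  set ω' := moeb ι (cuspMatrix s)⁻¹ ω
  set η' := moeb ι (cuspMatrix s)⁻¹ η
  have hω' : ω' ∈ halfPlane ι := moeb_mem_halfPlane _ hω
  have hη' : η' ∈ halfPlane ι := moeb_mem_halfPlane _ hη
  have hactω : ∀ γ, D.act ι γ ω = ι s + 1 / D'.act ι γ ω' := hact ω hω
  have hactη : ∀ γ, D.act ι γ η = ι s + 1 / D'.act ι γ η' := hact η hη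
  -- With `γω = s + 1/v` and `γη = s + 1/v'` the factor is `v'/v`: the product at `s` is the
  -- conjugate theta function at `0` with the two points exchanged.
  have hs : ∀ γ : Γ ⧸ Z, (ι s - D.act ι γ ω) / (ι s - D.act ι γ η) =
      (0 - D'.act ι γ η') / (0 - D'.act ι γ ω') := by
    intro γ
    rw [hactω, hactη]
    have h1 := ne_zero_of_mem_halfPlane (D'.act_mem hω' γ)
    have h2 := ne_zero_of_mem_halfPlane (D'.act_mem hη' γ)
    simp only [sub_add_cancel_left, zero_sub, neg_div_neg_eq]
    field_simp
  have hmul := D'.multipliable_ratio hι hη' hω' (Or.inr rfl)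
  simp_rw [hs]
  refine ⟨hmul, ?_⟩
  obtain ⟨G, hG, hG0, R₁, hR₁⟩ := D'.exists_theta_eq_analytic hι hcoc hω' hη'
  obtain ⟨R₂, hR₂⟩ := D'.exists_distTo_act_le hι hω'
  obtain ⟨R₃, hR₃⟩ := D'.exists_distTo_act_le hι hη'
  refine ⟨fun t => G t * D'.theta ι η' ω' 0, hG.mul analyticAt_const, ?_,
    max R₁ (max (R₂ + 1) (R₃ + 1)), fun w hw hRw => ?_⟩
  · simp only [hG0, one_mul]
    rfl
  simp only [max_le_iff] at hRw
  have hw0 := ne_zero_of_mem_halfPlane hw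
  have hneω : ∀ γ, D'.act ι γ ω' ≠ w := by
    rintro γ rfl
    linarith [hR₂ γ, hRw.2.1]
  have hneη : ∀ γ, D'.act ι γ η' ≠ w := by
    rintro γ rfl
    linarith [hR₃ γ, hRw.2.2]
  refine ⟨fun γ h => hneω γ ?_, ?_⟩
  · rw [hactω, add_right_inj, one_div, one_div, inv_inj] at h
    exact h
  · simp only
    rw [← hR₁ w hw hRw.1, theta, theta, theta, ← (D'.multipliable_ratio hι hω' hη'
      (Or.inl hw)).tprod_mul hmul]
    refine tprod_congr fun γ => ?_
    rw [hactω, hactη]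
    have h1 := ne_zero_of_mem_halfPlane (D'.act_mem hω' γ)
    have h2 := ne_zero_of_mem_halfPlane (D'.act_mem hη' γ)
    have h3 := sub_ne_zero.mpr (hneη γ)
    have h4 := sub_ne_zero.mpr (hneη γ).symm
    have e : ∀ v : C, v ≠ 0 → ι s + 1 / w - (ι s + 1 / v) = (v - w) / (v * w) := by
      intro v hv
      field_simp
      ring
    rw [e _ h1, e _ h2, zero_sub, zero_sub, neg_div_neg_eq]
    rw [div_div_div_eq, div_mul_div_comm, div_eq_div_iff (mul_ne_zero (mul_ne_zero h1 hw0) h3)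
      (mul_ne_zero h4 h1)]
    ring

omit [CompleteSpace k] [Z.Normal] in
/-- The value at the cusp of a function with an expansion at the cusp is unique. -/
lemma eq_of_analytic_cusp (D' : DiscreteRep k Z) (hι : ∀ x, ‖ι x‖ = ‖x‖) (hd : DenseNorms ι)
    {f G₁ G₂ : C → C} (h₁ : ContinuousAt G₁ 0) (h₂ : ContinuousAt G₂ 0) {R₁ R₂ : ℝ}
    (hf₁ : ∀ w ∈ halfPlane ι, R₁ ≤ distTo ι w →
      f w = G₁ (1 / latticeExp (D'.translations.map (ι : k →+ C)) w))
    (hf₂ : ∀ w ∈ halfPlane ι, R₂ ≤ distTo ι w →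
      f w = G₂ (1 / latticeExp (D'.translations.map (ι : k →+ C)) w)) : G₁ 0 = G₂ 0 := by
  -- For these points `|w|_i = ‖w‖ ≤ |e(w)|`, so `1/e(w)` tends to `0` while both expansions apply.
  have hex : ∀ n : ℕ, ∃ w : C, max (max R₁ R₂) n < ‖w‖ ∧
      ‖w‖ ∈ (Set.range fun x : k => ‖ι x‖)ᶜ := by
    intro n
    refine hd (Set.Ioi (max (max R₁ R₂) n)) isOpen_Ioi ⟨max (max R₁ R₂) n + 1, by simp, ?_⟩
    exact lt_of_lt_of_le (by positivity : (0 : ℝ) < (n : ℝ) + 1) (by gcongr; exact le_max_right _ _)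
  choose w hw hwk using hex
  have ht : Tendsto (fun n => 1 / latticeExp (D'.translations.map (ι : k →+ C)) (w n)) atTop
      (𝓝 0) := by
    rw [tendsto_zero_iff_norm_tendsto_zero]
    simp_rw [norm_div, norm_one]
    refine Tendsto.const_div_atTop (tendsto_atTop_mono (fun n => ?_) tendsto_natCast_atTop_atTop) _
    refine ((max_lt_iff.mp (hw n)).2.le).trans ?_
    refine le_norm_latticeExp (D'.finiteBalls_map_translations hι) ?_
    rintro _ ⟨x, -, rfl⟩
    exact norm_le_norm_sub_of_notMem (hwk n) x
  refine tendsto_nhds_unique (h₁.tendsto.comp ht) ((h₂.tendsto.comp ht).congr fun n => ?_)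
  obtain ⟨h3, h4⟩ := max_lt_iff.mp (max_lt_iff.mp (hw n)).1
  have hdist := distTo_eq_norm (hwk n)
  simp only [Function.comp]
  rw [← hf₁ _ (mem_halfPlane_of_notMem (hwk n)) (by rw [hdist]; exact h3.le),
    ← hf₂ _ (mem_halfPlane_of_notMem (hwk n)) (by rw [hdist]; exact h4.le)]

end DiscreteRep

end Drinfeld

/-! ### The fields `K_∞` and `C_∞` -/

namespace Drinfeld

section Concrete

variable (F : Type*) [Field F] [Finite F]

instance isUltrametricDistKinfBar : IsUltrametricDist (KinfBar F) :=
  IsUltrametricDist.isUltrametricDist_of_isNonarchimedean_norm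
    (isNonarchimedean_spectralNorm (K := Kinf F) (L := KinfBar F))

instance isUltrametricDistCinf : IsUltrametricDist (Cinf F) := by
  constructor
  intro x y z
  induction x, y, z using UniformSpace.Completion.induction_on₃ with
  | hp => exact isClosed_le (by fun_prop) (by fun_prop)
  | ih a b c =>
    simp only [UniformSpace.Completion.dist_eq]
    exact dist_triangle_max a b c

lemma norm_kinfToC (x : Kinf F) : ‖kinfToC F x‖ = ‖x‖ := by
  have h : kinfToC F x = ((algebraMap (Kinf F) (KinfBar F) x : KinfBar F) : Cinf F) := rfl
  rw [h, UniformSpace.Completion.norm_coe]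
  exact spectralNorm_extends x

/-- The absolute value of `K_∞` takes its nonzero values in `q ^ ℤ`. -/
lemma exists_norm_eq_zpow {x : Kinf F} (hx : x ≠ 0) : ∃ j : ℤ, ‖x‖ = (Nat.card F : ℝ) ^ j := by
  have hv : (Valued.v x : WithZero (Multiplicative ℤ)) ≠ 0 := (Valuation.ne_zero_iff _).mpr hx
  have h2 : ‖x‖ = ((WithZeroMulInt.toNNReal (one_lt_natCard F).ne_zero
      (MonoidWithZeroHom.ValueGroup₀.embedding (Valued.v.restrict x)) : NNReal) : ℝ) := rfl
  refine ⟨Multiplicative.toAdd (WithZero.unzero hv), ?_⟩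
  rw [h2, Valuation.embedding_restrict, WithZeroMulInt.toNNReal_neg_apply _ hv]
  simp

lemma one_lt_card_real : (1 : ℝ) < Nat.card F := by exact_mod_cast Finite.one_lt_card

/-- The distance to `K_∞` is attained. -/
lemma exists_norm_sub_eq_distTo {z : Cinf F} (hz : z ∈ halfPlane (kinfToC F)) :
    ∃ x, ‖z - kinfToC F x‖ = distTo (kinfToC F) z := by
  have hq := one_lt_card_real F
  have hpos := distTo_pos (norm_kinfToC F) hz
  by_contra! hne
  -- If the infimum is not attained, each `x` has a better `y`, and then `‖z - x‖ = ‖y - x‖ ∈ q^ℤ`.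
  -- Starting within a factor `q` of the infimum, one improvement falls below it.
  have hstep : ∀ x, ∃ y, ‖z - kinfToC F y‖ < ‖z - kinfToC F x‖ ∧
      ‖y - x‖ = ‖z - kinfToC F x‖ := by
    intro x
    have hlt : distTo (kinfToC F) z < ‖z - kinfToC F x‖ :=
      lt_of_le_of_ne (distTo_le z x) (hne x).symm
    obtain ⟨y, hy⟩ := exists_norm_sub_lt hlt
    refine ⟨y, hy, ?_⟩
    rw [← norm_kinfToC F, map_sub]
    have := norm_sub_eq_left hy
    rwa [sub_sub_sub_cancel_left] at this
  have hval : ∀ x, ∃ j : ℤ, ‖z - kinfToC F x‖ = (Nat.card F : ℝ) ^ j := by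
    intro x
    obtain ⟨y, hy, hyx⟩ := hstep x
    obtain ⟨j, hj⟩ := exists_norm_eq_zpow F (x := y - x) (by
      rintro h0
      rw [h0, norm_zero] at hyx
      rw [← hyx] at hy
      exact absurd hy (not_lt.mpr (norm_nonneg _)))
    exact ⟨j, by rw [← hyx, hj]⟩
  obtain ⟨x, hx⟩ := exists_norm_sub_lt (ι := kinfToC F) (z := z)
    (r := Nat.card F * distTo (kinfToC F) z) (by nlinarith)
  obtain ⟨y, hy, -⟩ := hstep x
  obtain ⟨i, hi⟩ := hval x
  obtain ⟨j, hj⟩ := hval y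
  rw [hi, hj] at hy
  have hji : j < i := (zpow_lt_zpow_iff_right₀ hq).mp hy
  have h1 := distTo_le (ι := kinfToC F) z y
  have h2 : (Nat.card F : ℝ) * (Nat.card F : ℝ) ^ j ≤ (Nat.card F : ℝ) ^ i := by
    rw [← zpow_one_add₀ (by linarith)]
    exact zpow_le_zpow_right₀ hq.le (by omega)
  rw [hj] at h1
  rw [hi] at hx
  nlinarith

lemma exists_norm_eq_rpow (r : ℚ) : ∃ z : Cinf F, ‖z‖ = (Nat.card F : ℝ) ^ (r : ℝ) := by
  have hq := one_lt_card_real F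
  obtain ⟨t, ht⟩ := IsAlgClosed.exists_pow_nat_eq
    (algebraMap (Kinf F) (KinfBar F) (polyToKinf F X)) r.den_pos
  have hX : ‖polyToKinf F (X : F[X])‖ = Nat.card F := by
    rw [norm_polyToKinf F X_ne_zero, natDegree_X, pow_one]
  have ht' : ‖t‖ ^ r.den = Nat.card F := by
    rw [← norm_pow, ht, ← hX]
    exact spectralNorm_extends _
  refine ⟨((t ^ r.num : KinfBar F) : Cinf F), ?_⟩
  rw [UniformSpace.Completion.norm_coe, norm_zpow]
  have h1 : ‖t‖ = (Nat.card F : ℝ) ^ ((r.den : ℝ)⁻¹) := by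
    rw [← ht', Real.pow_rpow_inv_natCast (norm_nonneg _) r.den_nz]
  rw [h1, ← Real.rpow_intCast, ← Real.rpow_mul (by linarith)]
  congr 1
  rw [mul_comm, ← div_eq_mul_inv]
  exact_mod_cast Rat.num_div_den r

/-- Roots of `T` give all norms in `q^ℚ`, which is dense in the positive reals, while `K_∞` has only
`q^ℤ` and `0`. -/
lemma denseNorms_kinfToC : DiscreteRep.DenseNorms (kinfToC F) := by
  intro U hU ⟨u, huU, hu0⟩
  have hq := one_lt_card_real F
  have hq0 : (0 : ℝ) < Nat.card F := by linarith
  set f : ℝ → ℝ := fun y => (Nat.card F : ℝ) ^ y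
  have hf : Continuous f := Real.continuous_const_rpow hq0.ne'
  have hO : IsOpen (f ⁻¹' U) := hU.preimage hf
  have hne : (f ⁻¹' U).Nonempty := ⟨Real.logb (Nat.card F) u, by
    simp only [Set.mem_preimage, f]
    rwa [Real.rpow_logb hq0 hq.ne' hu0]⟩
  have hZ : IsClosed (Set.range ((↑) : ℤ → ℝ)) := Int.isClosedEmbedding_coe_real.isClosed_range
  have hdense : Dense (Set.range ((↑) : ℤ → ℝ))ᶜ := (Set.countable_range _).dense_compl ℝ
  have hne' := hdense.inter_open_nonempty _ hO hne
  obtain ⟨r, hr⟩ := Rat.denseRange_cast.exists_mem_open (hO.inter hZ.isOpen_compl) hne'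
  obtain ⟨z, hz⟩ := exists_norm_eq_rpow F r
  refine ⟨z, by rw [hz]; exact hr.1, ?_⟩
  rintro ⟨x, hx⟩
  simp only at hx
  rw [norm_kinfToC, hz] at hx
  have hx0 : x ≠ 0 := by
    rintro rfl
    rw [norm_zero] at hx
    exact (Real.rpow_pos_of_pos hq0 _).ne hx
  obtain ⟨j, hj⟩ := exists_norm_eq_zpow F hx0
  rw [hj, ← Real.rpow_intCast] at hx
  exact hr.2 ⟨j, (Real.rpow_right_inj hq0 hq.ne').mp hx⟩

lemma exists_charP_Cinf : ∃ p : ℕ, p.Prime ∧ CharP (Cinf F) p := by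
  obtain ⟨p, hp⟩ := CharP.exists F
  have hp' : p.Prime := (CharP.char_is_prime_or_zero F p).resolve_right
    (CharP.char_ne_zero_of_finite F p)
  exact ⟨p, hp', charP_of_injective_ringHom (f := (polyToC F).comp (C : F →+* F[X]))
    (RingHom.injective _) p⟩

variable {F}

lemma polyToKinf_injective : Function.Injective (polyToKinf F) := by
  rw [injective_iff_map_eq_zero]
  intro P hP
  by_contra h0
  have := norm_polyToKinf F h0
  rw [hP, norm_zero] at this
  have hq := one_lt_card_real F
  exact (pow_pos (by linarith) _).ne this

/-- Every element of `K_∞` is within distance `1` of a polynomial. -/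
lemma exists_norm_sub_polyToKinf_le (x : Kinf F) : ∃ P : F[X], ‖x - polyToKinf F P‖ ≤ 1 := by
  have hdense : DenseRange (algebraMap (RatFunc F) (Kinf F)) := by
    let := Classical.decEq (RatFunc F)
    let := RatFunc.inftyValued F
    -- A rational function close to `x` is replaced by its polynomial part; division with remainder
    -- makes the rest of norm at most `1`.
    exact UniformSpace.Completion.denseRange_coe
  obtain ⟨f, hf⟩ := hdense.exists_dist_lt x one_pos
  rw [dist_eq_norm] at hf
  have hd := RatFunc.denom_ne_zero f
  have hd' : polyToKinf F f.denom ≠ 0 := fun h =>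
    hd (polyToKinf_injective (h.trans (map_zero _).symm))
  refine ⟨f.num / f.denom, ?_⟩
  have e : algebraMap (RatFunc F) (Kinf F) f - polyToKinf F (f.num / f.denom) =
      polyToKinf F (f.num % f.denom) / polyToKinf F f.denom := by
    have h1 : algebraMap (RatFunc F) (Kinf F) f =
        polyToKinf F f.num / polyToKinf F f.denom := by
      conv_lhs => rw [← RatFunc.num_div_denom f, map_div₀]
      rfl
    rw [h1, eq_div_iff hd', sub_mul, div_mul_cancel₀ _ hd', ← map_mul, ← map_sub]
    congr 1
    have := EuclideanDomain.div_add_mod f.num f.denom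
    linear_combination -this
  refine (norm_sub_le_max_sub x (algebraMap (RatFunc F) (Kinf F) f) _).trans (max_le hf.le ?_)
  rw [e, norm_div]
  by_cases hr : f.num % f.denom = 0
  · simp [hr]
  · rw [norm_polyToKinf F hr, norm_polyToKinf F hd]
    have hq := one_lt_card_real F
    rw [div_le_one (pow_pos (by linarith) _)]
    refine pow_le_pow_right₀ hq.le ?_
    exact natDegree_le_natDegree (EuclideanDomain.mod_lt f.num hd).le

/-- The fractional ideal `N⁻¹ A` in `K_∞`. -/
def fractionLattice (N : F[X]) : AddSubgroup (Kinf F) where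
  carrier := {x | ∃ P, x * polyToKinf F N = polyToKinf F P}
  zero_mem' := ⟨0, by simp⟩
  add_mem' := by
    rintro a b ⟨P, hP⟩ ⟨Q, hQ⟩
    exact ⟨P + Q, by rw [add_mul, hP, hQ, map_add]⟩
  neg_mem' := by
    rintro a ⟨P, hP⟩
    exact ⟨-P, by rw [neg_mul, hP, map_neg]⟩

lemma finite_natDegree_le (n : ℕ) : {P : F[X] | P.natDegree ≤ n}.Finite := by
  have : Finite (Polynomial.degreeLT F (n + 1)) :=
    Finite.of_equiv _ (Polynomial.degreeLTEquiv F (n + 1)).symm.toEquiv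
  refine (Set.toFinite (Polynomial.degreeLT F (n + 1) : Set F[X])).subset fun P hP => ?_
  rw [SetLike.mem_coe, Polynomial.mem_degreeLT]
  exact lt_of_le_of_lt (degree_le_of_natDegree_le hP) (by exact_mod_cast Nat.lt_succ_self n)

lemma finiteBalls_fractionLattice {N : F[X]} (hN : N ≠ 0) : FiniteBalls (fractionLattice N) := by
  intro M
  have hq := one_lt_card_real F
  have hN' : polyToKinf F N ≠ 0 := fun h => hN (polyToKinf_injective (h.trans (map_zero _).symm))
  obtain ⟨n, hn⟩ := pow_unbounded_of_one_lt (M * ‖polyToKinf F N‖) hq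
  refine ((finite_natDegree_le (F := F) n).image
    fun P => polyToKinf F P / polyToKinf F N).subset ?_
  rintro x ⟨⟨P, hP⟩, hx⟩
  refine ⟨P, ?_, by simp only; rw [← hP, mul_div_cancel_right₀ _ hN']⟩
  by_cases hP0 : P = 0
  · simp [hP0]
  have h1 : (Nat.card F : ℝ) ^ P.natDegree < (Nat.card F : ℝ) ^ n := by
    rw [← norm_polyToKinf F hP0, ← hP, norm_mul]
    exact lt_of_le_of_lt (by gcongr) hn
  exact ((pow_lt_pow_iff_right₀ hq).mp h1).le

end Concrete

end Drinfeld

/-! ### Arithmetic groups -/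

namespace Drinfeld

noncomputable section Arithmetic

open Matrix.GeneralLinearGroup

variable {F : Type*} [Field F] [Finite F] (Γ : Subgroup (GL (Fin 2) F[X]))

omit [Finite F] in
lemma mem_centralPart {g : Γ} : g ∈ centralPart Γ ↔
    Matrix.GeneralLinearGroup.map (polyToKinf F) (g : GL (Fin 2) F[X]) ∈
      Subgroup.center (GL (Fin 2) (Kinf F)) := Iff.rfl

instance normal_centralPart : (centralPart Γ).Normal := by
  unfold centralPart
  infer_instance

lemma det_apply_eq {R : Type*} [CommRing R] (g : GL (Fin 2) R) :
    g 0 0 * g 1 1 - g 0 1 * g 1 0 = (g.det : R) := by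
  rw [Matrix.GeneralLinearGroup.val_det_apply, Matrix.det_fin_two]

/-- The conjugation `γ ↦ ρ⁻¹ γ ρ` as a homomorphism to `GL₂(K_∞)`. -/
def conjHom (ρ : GL (Fin 2) (Kinf F)) : Γ →* GL (Fin 2) (Kinf F) :=
  (MulAut.conj ρ⁻¹).toMonoidHom.comp
    ((Matrix.GeneralLinearGroup.map (polyToKinf F)).comp Γ.subtype)

omit [Finite F] in
lemma conjHom_apply (ρ : GL (Fin 2) (Kinf F)) (g : Γ) :
    conjHom Γ ρ g = ρ⁻¹ * Matrix.GeneralLinearGroup.map (polyToKinf F) (g : GL (Fin 2) F[X]) * ρ := by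
  simp [conjHom]

omit [Finite F] in
lemma det_conjHom (ρ : GL (Fin 2) (Kinf F)) (g : Γ) :
    ((conjHom Γ ρ g).det : Kinf F) = polyToKinf F ((g : GL (Fin 2) F[X]).det : F[X]) := by
  rw [conjHom_apply, map_mul, map_mul, map_inv, mul_comm, mul_inv_cancel_left, val_det_apply, val_det_apply,
    RingHom.map_det]
  rfl

omit [Finite F] in
lemma exists_det_eq_C (g : GL (Fin 2) F[X]) : ∃ c : F, c ≠ 0 ∧ (g.det : F[X]) = C c := by
  obtain ⟨c, hc, h⟩ := Polynomial.isUnit_iff.mp g.det.isUnit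
  exact ⟨c, hc.ne_zero, h.symm⟩

/-- The representation `γ ↦ ρ⁻¹ γ ρ` of `Γ`, for a matrix `ρ` such that the matrices `ρ⁻¹ γ ρ` have
the common denominator `N`. -/
def conjRep (ρ : GL (Fin 2) (Kinf F)) {N : F[X]} (hN : N ≠ 0)
    (h : ∀ g : Γ, ∀ i j, conjHom Γ ρ g i j ∈ fractionLattice N) :
    DiscreteRep (Kinf F) (centralPart Γ) where
  toHom := conjHom Γ ρ
  mem_iff g := by
    rw [mem_centralPart, conjHom_apply]
    constructor
    · intro hg
      have := Subgroup.Normal.conj_mem inferInstance _ hg ρ⁻¹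
      rwa [inv_inv] at this
    · intro hg
      have := Subgroup.Normal.conj_mem inferInstance _ hg ρ
      simpa [mul_assoc] using this
  lattice := fractionLattice N
  finiteBalls := finiteBalls_fractionLattice hN
  entry_mem := h
  det_finite := by
    refine (Set.finite_range fun c : F => polyToKinf F (C c)).subset ?_
    rintro _ ⟨g, rfl⟩
    obtain ⟨c, -, hc⟩ := exists_det_eq_C (g : GL (Fin 2) F[X])
    exact ⟨c, by simp only; rw [det_apply_eq, det_conjHom, hc]⟩
  norm_det g := by
    obtain ⟨c, hc0, hc⟩ := exists_det_eq_C (g : GL (Fin 2) F[X])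
    rw [det_apply_eq, det_conjHom, hc, norm_polyToKinf F (C_ne_zero.mpr hc0), natDegree_C, pow_zero]

/-- The translations in an arithmetic group form a cocompact lattice. -/
lemma exists_translation_near [Γ.FiniteIndex] (ρ : GL (Fin 2) (Kinf F)) {N : F[X]} (hN : N ≠ 0)
    (h : ∀ g : Γ, ∀ i j, conjHom Γ ρ g i j ∈ fractionLattice N) {M : F[X]} (hM : M ≠ 0)
    (ψ : F[X] → GL (Fin 2) F[X])
    (hψ : ∀ P, Matrix.GeneralLinearGroup.map (polyToKinf F) (ψ P) * ρ =
      ρ * upperRightHom (polyToKinf F (M * P))) :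
    ∃ R : ℝ, ∀ x : Kinf F, ∃ b ∈ (conjRep Γ ρ hN h).translations, ‖x - b‖ ≤ R := by
  classical
  -- Pigeonhole: if `P` and `P₀` have the same class among the finitely many, then `ψ(P) ψ(P₀)⁻¹ ∈
  -- Γ` and it is the translation by `M(P - P₀)` after conjugation. One `P₀` per class adds only a
  -- bounded error.
  set f : F[X] → GL (Fin 2) F[X] ⧸ Γ := fun P => QuotientGroup.mk (ψ P)⁻¹ with hf
  have : Fintype (GL (Fin 2) F[X] ⧸ Γ) := Fintype.ofFinite _
  set P₀ : GL (Fin 2) F[X] ⧸ Γ → F[X] := fun c => if hc : ∃ P, f P = c then hc.choose else 0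
  have hP₀ : ∀ P, f (P₀ (f P)) = f P := by
    intro P
    have hc : ∃ P', f P' = f P := ⟨P, rfl⟩
    simp only [P₀, dif_pos hc]
    exact hc.choose_spec
  have hM' : polyToKinf F M ≠ 0 := fun h => hM (polyToKinf_injective (h.trans (map_zero _).symm))
  refine ⟨‖polyToKinf F M‖ + ∑ c, ‖polyToKinf F (M * P₀ c)‖, fun x => ?_⟩
  obtain ⟨P, hP⟩ := exists_norm_sub_polyToKinf_le (x / polyToKinf F M)
  have hmem : ψ P * (ψ (P₀ (f P)))⁻¹ ∈ Γ := by
    have := QuotientGroup.eq.mp (hP₀ P).symm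
    rwa [inv_inv] at this
  refine ⟨polyToKinf F (M * P) - polyToKinf F (M * P₀ (f P)), ⟨⟨_, hmem⟩, ?_⟩, ?_⟩
  · change conjHom Γ ρ _ = _
    have e : ∀ P, Matrix.GeneralLinearGroup.map (polyToKinf F) (ψ P) =
        ρ * upperRightHom (polyToKinf F (M * P)) * ρ⁻¹ := fun P => by
      rw [← hψ, mul_inv_cancel_right]
    rw [conjHom_apply, map_mul, map_inv, e, e, sub_eq_add_neg, AddChar.map_add_eq_mul,
      AddChar.map_neg_eq_inv]
    group
  · have h1 : ‖x - polyToKinf F (M * P)‖ ≤ ‖polyToKinf F M‖ := by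
      have e : x - polyToKinf F (M * P) =
          polyToKinf F M * (x / polyToKinf F M - polyToKinf F P) := by
        rw [map_mul]
        field_simp
      rw [e, norm_mul]
      exact mul_le_of_le_one_right (norm_nonneg _) hP
    have h2 : ‖polyToKinf F (M * P₀ (f P))‖ ≤ ∑ c, ‖polyToKinf F (M * P₀ c)‖ :=
      Finset.single_le_sum (f := fun c => ‖polyToKinf F (M * P₀ c)‖) (fun _ _ => norm_nonneg _)
        (Finset.mem_univ (f P))
    rw [sub_sub_eq_add_sub, add_sub_right_comm]
    exact (norm_add_le _ _).trans (add_le_add h1 h2)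

/-! #### The standard representation -/

omit [Finite F] in
lemma conjHom_one_mem (g : Γ) (i j : Fin 2) : conjHom Γ 1 g i j ∈ fractionLattice (1 : F[X]) := by
  refine ⟨(g : GL (Fin 2) F[X]) i j, ?_⟩
  rw [conjHom_apply]
  simp

/-- The inclusion of `Γ` in `GL₂(K_∞)`. -/
def stdRep : DiscreteRep (Kinf F) (centralPart Γ) :=
  conjRep Γ 1 one_ne_zero (conjHom_one_mem Γ)

lemma stdRep_toHom (g : Γ) : (stdRep Γ).toHom g =
    Matrix.GeneralLinearGroup.map (polyToKinf F) (g : GL (Fin 2) F[X]) := by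
  change conjHom Γ 1 g = _
  simp [conjHom_apply]

lemma moeb_stdRep (g : Γ) (z : Cinf F) :
    moeb (kinfToC F) ((stdRep Γ).toHom g) z = moebius (g : GL (Fin 2) F[X]) z := by
  rw [stdRep_toHom]
  rfl

lemma act_stdRep (γ : GammaTilde Γ) (z : Cinf F) :
    (stdRep Γ).act (kinfToC F) γ z = moebiusQ γ z := by
  obtain ⟨g, rfl⟩ := QuotientGroup.mk_surjective γ
  rw [DiscreteRep.act_mk, moeb_stdRep]
  rfl

lemma theta_stdRep (ω η z : Cinf F) : (stdRep Γ).theta (kinfToC F) ω η z = theta Γ ω η z := by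
  unfold DiscreteRep.theta theta
  simp_rw [act_stdRep]

lemma exists_stdRep_translation_near [Γ.FiniteIndex] :
    ∃ R : ℝ, ∀ x : Kinf F, ∃ b ∈ (stdRep Γ).translations, ‖x - b‖ ≤ R := by
  refine exists_translation_near Γ 1 one_ne_zero (conjHom_one_mem Γ) one_ne_zero
    (fun P => upperRightHom P) fun P => ?_
  ext i j
  fin_cases i <;> fin_cases j <;> simp

/-! #### The representation at a cusp -/

/-- The element `s` of `K` as an element of `K_∞`. -/
abbrev ratToKinf (s : RatFunc F) : Kinf F := algebraMap (RatFunc F) (Kinf F) s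

omit [Finite F] in
lemma ratToKinf_mul_denom (s : RatFunc F) :
    ratToKinf s * polyToKinf F s.denom = polyToKinf F s.num := by
  have hd : algebraMap F[X] (RatFunc F) s.denom ≠ 0 :=
    (_root_.map_ne_zero_iff _ (IsFractionRing.injective F[X] (RatFunc F))).mpr s.denom_ne_zero
  have h := RatFunc.num_div_denom s
  rw [div_eq_iff hd] at h
  have e : ∀ P, polyToKinf F P =
    algebraMap (RatFunc F) (Kinf F) (algebraMap F[X] (RatFunc F) P) := fun _ => rfl
  rw [e, e, ← map_mul, h]

omit [Finite F] in
lemma conjHom_cuspMatrix (s : Kinf F) (g : Γ) :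
    (conjHom Γ (cuspMatrix s) g : Matrix (Fin 2) (Fin 2) (Kinf F)) =
      !![polyToKinf F (g.1 1 0) * s + polyToKinf F (g.1 1 1), polyToKinf F (g.1 1 0);
        (polyToKinf F (g.1 0 0) - s * polyToKinf F (g.1 1 0)) * s +
          (polyToKinf F (g.1 0 1) - s * polyToKinf F (g.1 1 1)),
        polyToKinf F (g.1 0 0) - s * polyToKinf F (g.1 1 0)] := by
  rw [conjHom_apply]
  change !![0, 1; 1, -s] * (g.1 : Matrix (Fin 2) (Fin 2) F[X]).map (polyToKinf F) *
    !![s, 1; 1, 0] = _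
  rw [Matrix.eta_fin_two ((g.1 : Matrix (Fin 2) (Fin 2) F[X]).map (polyToKinf F)),
    Matrix.mul_fin_two, Matrix.mul_fin_two]
  refine Matrix.ext fun i j => ?_
  fin_cases i <;> fin_cases j <;> simp <;> ring

omit [Finite F] in
lemma conjHom_cuspMatrix_mem (s : RatFunc F) (g : Γ) (i j : Fin 2) :
    conjHom Γ (cuspMatrix (ratToKinf s)) g i j ∈ fractionLattice (s.denom ^ 2) := by
  have hs := ratToKinf_mul_denom s
  set G := (g : GL (Fin 2) F[X])
  rw [conjHom_cuspMatrix]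
  set σ := ratToKinf s
  fin_cases i <;> fin_cases j
  · refine ⟨G 1 0 * s.num * s.denom + G 1 1 * s.denom ^ 2, ?_⟩
    simp [G]
    linear_combination (polyToKinf F (G 1 0) * polyToKinf F s.denom) * hs
  · refine ⟨G 1 0 * s.denom ^ 2, ?_⟩
    simp [G]
  · refine ⟨G 0 0 * s.num * s.denom + G 0 1 * s.denom ^ 2 - G 1 0 * s.num ^ 2
      - G 1 1 * s.num * s.denom, ?_⟩
    simp [G]
    linear_combination (polyToKinf F (G 0 0) * polyToKinf F s.denom
      - polyToKinf F (G 1 1) * polyToKinf F s.denom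
      - polyToKinf F (G 1 0) * (σ * polyToKinf F s.denom + polyToKinf F s.num)) * hs
  · refine ⟨G 0 0 * s.denom ^ 2 - G 1 0 * s.num * s.denom, ?_⟩
    simp [G]
    linear_combination (-polyToKinf F (G 1 0) * polyToKinf F s.denom) * hs

/-- The representation `γ ↦ ρ⁻¹ γ ρ`, where `ρ = (s 1; 1 0)`. -/
def cuspRep (s : RatFunc F) : DiscreteRep (Kinf F) (centralPart Γ) :=
  conjRep Γ (cuspMatrix (ratToKinf s)) (pow_ne_zero 2 s.denom_ne_zero) (conjHom_cuspMatrix_mem Γ s)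

lemma stdRep_mul_cuspMatrix (s : RatFunc F) (g : Γ) :
    (stdRep Γ).toHom g * cuspMatrix (ratToKinf s) =
      cuspMatrix (ratToKinf s) * (cuspRep Γ s).toHom g := by
  change _ = cuspMatrix (ratToKinf s) * conjHom Γ (cuspMatrix (ratToKinf s)) g
  rw [stdRep_toHom, conjHom_apply, mul_assoc, mul_inv_cancel_left]

/-- The unipotent matrices that fix the cusp `P / Q`. -/
def cuspUnipotent (P Q b : F[X]) : GL (Fin 2) F[X] :=
  ⟨!![1 + P * Q * b, -P ^ 2 * b; Q ^ 2 * b, 1 - P * Q * b],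
    !![1 - P * Q * b, P ^ 2 * b; -Q ^ 2 * b, 1 + P * Q * b],
    by
      refine Matrix.ext fun i j => ?_
      fin_cases i <;> fin_cases j <;> simp [Matrix.mul_apply, Fin.sum_univ_two] <;> ring,
    by
      refine Matrix.ext fun i j => ?_
      fin_cases i <;> fin_cases j <;> simp [Matrix.mul_apply, Fin.sum_univ_two] <;> ring⟩

lemma exists_cuspRep_translation_near [Γ.FiniteIndex] (s : RatFunc F) :
    ∃ R : ℝ, ∀ x : Kinf F, ∃ b ∈ (cuspRep Γ s).translations, ‖x - b‖ ≤ R := by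
  -- For `s = P/Q` the matrix `ρ (1 Q²b; 0 1) ρ⁻¹` has polynomial entries, hence the choice `M =
  -- Q²`.
  refine exists_translation_near Γ _ (pow_ne_zero 2 s.denom_ne_zero) (conjHom_cuspMatrix_mem Γ s)
    (pow_ne_zero 2 s.denom_ne_zero) (fun b => cuspUnipotent s.num s.denom b) fun b => ?_
  have hs := ratToKinf_mul_denom s
  set σ := ratToKinf s
  ext i j
  fin_cases i <;> fin_cases j <;>
    simp [Matrix.mul_apply, Fin.sum_univ_two, cuspUnipotent, cuspMatrix] <;>
    simp only [← hs] <;> ring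

lemma mem_cuspLattice_iff (s b : RatFunc F) :
    b ∈ cuspLattice Γ s ↔ ratToKinf b ∈ (cuspRep Γ s).translations := by
  have hinj : Function.Injective (algebraMap (RatFunc F) (Kinf F)) := RingHom.injective _
  have hiff : ∀ g : Γ, ((g : GL (Fin 2) F[X]) : Matrix (Fin 2) (Fin 2) F[X]).map
      (algebraMap F[X] (RatFunc F)) = !![s, 1; 1, 0] * !![1, b; 0, 1] * !![0, 1; 1, -s] ↔
      Matrix.GeneralLinearGroup.map (polyToKinf F) (g : GL (Fin 2) F[X]) =
        cuspMatrix (ratToKinf s) * upperRightHom (ratToKinf b) * (cuspMatrix (ratToKinf s))⁻¹ := by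
    intro g
    rw [← (Matrix.map_injective hinj).eq_iff, Units.ext_iff]
    have e1 : ((Matrix.GeneralLinearGroup.map (polyToKinf F) (g : GL (Fin 2) F[X]) :
        GL (Fin 2) (Kinf F)) : Matrix (Fin 2) (Fin 2) (Kinf F)) =
        (((g : GL (Fin 2) F[X]) : Matrix (Fin 2) (Fin 2) F[X]).map
          (algebraMap F[X] (RatFunc F))).map (algebraMap (RatFunc F) (Kinf F)) := rfl
    have e2 : ((cuspMatrix (ratToKinf s) * upperRightHom (ratToKinf b) *
        (cuspMatrix (ratToKinf s))⁻¹ : GL (Fin 2) (Kinf F)) : Matrix (Fin 2) (Fin 2) (Kinf F)) =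
        (!![s, 1; 1, 0] * !![1, b; 0, 1] * !![0, 1; 1, -s] :
          Matrix (Fin 2) (Fin 2) (RatFunc F)).map (algebraMap (RatFunc F) (Kinf F)) := by
      have e3 : ((cuspMatrix (ratToKinf s) * upperRightHom (ratToKinf b) *
        (cuspMatrix (ratToKinf s))⁻¹ : GL (Fin 2) (Kinf F)) : Matrix (Fin 2) (Fin 2) (Kinf F)) =
        !![ratToKinf s, 1; 1, 0] * !![1, ratToKinf b; 0, 1] * !![0, 1; 1, -ratToKinf s] := rfl
      rw [e3]
      simp only [Matrix.mul_fin_two]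
      ext i j
      fin_cases i <;> fin_cases j <;> simp
    rw [e1, e2]
  constructor
  · rintro ⟨γ, hγ, h⟩
    refine ⟨⟨γ, hγ⟩, ?_⟩
    change conjHom Γ _ _ = _
    rw [conjHom_apply, (hiff ⟨γ, hγ⟩).mp h]
    group
  · rintro ⟨g, hg⟩
    refine ⟨g, g.2, (hiff g).mpr ?_⟩
    change conjHom Γ _ _ = _ at hg
    rw [← hg, conjHom_apply]
    group

/-- The upper right entry of `ρ⁻¹γρ` is the lower left entry of `γ`, a polynomial. So the lattice in
`K_∞` is the one defined in `K`. -/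
lemma exists_ratToKinf_eq (s : RatFunc F) {x : Kinf F} (hx : x ∈ (cuspRep Γ s).translations) :
    ∃ b : RatFunc F, ratToKinf b = x := by
  obtain ⟨g, hg⟩ := hx
  change conjHom Γ _ _ = _ at hg
  have h := congrArg (fun M : GL (Fin 2) (Kinf F) => M 0 1) hg
  rw [conjHom_cuspMatrix] at h
  simp at h
  exact ⟨algebraMap F[X] (RatFunc F) ((g : GL (Fin 2) F[X]) 1 0), h⟩

lemma cuspExp_eq_latticeExp (s : RatFunc F) (w : Cinf F) :
    cuspExp Γ s w =
      latticeExp ((cuspRep Γ s).translations.map (kinfToC F : Kinf F →+ Cinf F)) w := by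
  unfold cuspExp latticeExp
  congr 1
  have hinj : Function.Injective (ratToC F) := RingHom.injective _
  set f : {b : RatFunc F // b ∈ cuspLattice Γ s ∧ b ≠ 0} →
      {b : Cinf F // b ∈ (cuspRep Γ s).translations.map (kinfToC F : Kinf F →+ Cinf F) ∧ b ≠ 0} :=
    fun b => ⟨ratToC F b, ⟨ratToKinf b.1, (mem_cuspLattice_iff Γ s b.1).mp b.2.1, rfl⟩,
      (_root_.map_ne_zero _).mpr b.2.2⟩
  have hf : Function.Bijective f := by
    constructor
    · intro a b h
      exact Subtype.ext (hinj (congrArg Subtype.val h))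
    · rintro ⟨_, ⟨x, hx, rfl⟩, h0⟩
      obtain ⟨b, rfl⟩ := exists_ratToKinf_eq Γ s hx
      refine ⟨⟨b, (mem_cuspLattice_iff Γ s b).mpr hx, ?_⟩, rfl⟩
      rintro rfl
      exact h0 (by simp)
  exact (Equiv.ofBijective f hf).tprod_eq
    fun b : {b : Cinf F // b ∈ (cuspRep Γ s).translations.map (kinfToC F : Kinf F →+ Cinf F) ∧
      b ≠ 0} => 1 - w / b

end Arithmetic

end Drinfeld

/-! ### The functions `u_α` -/

namespace Drinfeld

section ThetaU

variable {F : Type*} [Field F] [Finite F] (Γ : Subgroup (GL (Fin 2) F[X]))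

/-- An orbit can be chosen none of whose points has imaginary part `|z|_i`. This makes `auxPoint`
meaningful. -/
lemma exists_orbit_ne {z : Cinf F} (hz : z ∈ upperHalfPlane F) :
    ∃ ω ∈ upperHalfPlane F, ∀ γ : GammaTilde Γ, moebiusQ γ ω ≠ z := by
  obtain ⟨ω, hω, h⟩ := (stdRep Γ).exists_orbit_avoiding (norm_kinfToC F) (denseNorms_kinfToC F)
    (distTo_pos (norm_kinfToC F) hz) (distTo (kinfToC F) z)
  refine ⟨ω, hω, fun γ hγ => ?_⟩
  have := h γ
  rw [act_stdRep, hγ] at this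
  exact this.elim (lt_irrefl _) (lt_irrefl _)

lemma auxPoint_spec {z : Cinf F} (hz : z ∈ upperHalfPlane F) :
    auxPoint Γ z ∈ upperHalfPlane F ∧ ∀ γ : GammaTilde Γ, moebiusQ γ (auxPoint Γ z) ≠ z :=
  Classical.epsilon_spec (p := fun ω => ω ∈ upperHalfPlane F ∧ ∀ γ : GammaTilde Γ, moebiusQ γ ω ≠ z)
    (exists_orbit_ne Γ hz)

omit [Finite F] in
lemma exists_pow_mem_commutator {c : Γ} (hc : toBar Γ c = 1) :
    ∃ n ≠ 0, Abelianization.of (c ^ n) = 1 := by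
  have h : Abelianization.of c ∈ CommGroup.torsion (Abelianization Γ) :=
    (QuotientGroup.eq_one_iff _).mp hc
  obtain ⟨n, hn, h⟩ := isOfFinOrder_iff_pow_eq_one.mp h
  exact ⟨n, hn.ne', by rw [map_pow, h]⟩

/-- `θ(ω, aω, z)` depends only on the class of `a` modulo torsion. -/
theorem theta_eq_of_toBar_eq [Γ.FiniteIndex] {a b : Γ} (hab : toBar Γ a = toBar Γ b)
    {ω z : Cinf F} (hz : z ∈ upperHalfPlane F) (hω : ω ∈ upperHalfPlane F)
    (h : ∀ γ, (stdRep Γ).act (kinfToC F) γ ω ≠ z) :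
    (stdRep Γ).theta (kinfToC F) ω (moeb (kinfToC F) ((stdRep Γ).toHom a) ω) z =
      (stdRep Γ).theta (kinfToC F) ω (moeb (kinfToC F) ((stdRep Γ).toHom b) ω) z := by
  obtain ⟨p, hp, hchar⟩ := exists_charP_Cinf F
  have : Fact p.Prime := ⟨hp⟩
  have hι := norm_kinfToC F
  obtain ⟨n, hn, hc⟩ := exists_pow_mem_commutator Γ (c := a * b⁻¹) (by
    rw [map_mul, map_inv, hab, mul_inv_cancel])
  have hone : (stdRep Γ).theta (kinfToC F) ω
      (moeb (kinfToC F) ((stdRep Γ).toHom (a * b⁻¹)) ω) z = 1 := by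
    refine (stdRep Γ).theta_eq_one_of_pow_eq_one (p := p) hι (exists_stdRep_translation_near Γ)
      (denseNorms_kinfToC F) (fun z hz => exists_norm_sub_eq_distTo F hz) hn ?_ hz hω h
    intro z hz ω hω h
    set f := (stdRep Γ).thetaHom hι hω (Or.inl hz) h
    have h1 : f ((a * b⁻¹) ^ n) = 1 := by
      -- A homomorphism to the commutative group of units factors through the abelianization, where
      -- this power is trivial.
      have h2 : f.toHomUnits ((a * b⁻¹) ^ n) = 1 := by
        rw [← Abelianization.lift_apply_of f.toHomUnits, hc, map_one]
      exact congrArg Units.val h2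
    rw [map_pow] at h1
    exact h1
  set f := (stdRep Γ).thetaHom hι hω (Or.inl hz) h
  have e : f a = f (a * b⁻¹) * f b := by rw [← map_mul, inv_mul_cancel_right]
  have hone' : f (a * b⁻¹) = 1 := hone
  rw [hone', one_mul] at e
  exact e

/-- `u_α(z) = θ(ω, aω, z)` for every representative `a` of `α` and every `ω` outside `Γz`. -/
theorem thetaU_eq_theta [Γ.FiniteIndex] {α : GammaBar Γ} {a : Γ} (ha : toBar Γ a = α)
    {ω z : Cinf F} (hz : z ∈ upperHalfPlane F) (hω : ω ∈ upperHalfPlane F)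
    (h : ∀ γ, (stdRep Γ).act (kinfToC F) γ ω ≠ z) :
    thetaU Γ α z =
      (stdRep Γ).theta (kinfToC F) ω (moeb (kinfToC F) ((stdRep Γ).toHom a) ω) z := by
  obtain ⟨h1, h2⟩ := auxPoint_spec Γ hz
  have h3 : ∀ γ, (stdRep Γ).act (kinfToC F) γ (auxPoint Γ z) ≠ z := fun γ => by
    rw [act_stdRep]
    exact h2 γ
  have hlift : toBar Γ (barLift α) = toBar Γ a :=
    (Function.surjInv_eq (toBar_surjective Γ) α).trans ha.symm
  rw [thetaU, ← theta_stdRep, ← moeb_stdRep, theta_eq_of_toBar_eq Γ hlift hz h1 h3]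
  exact (stdRep Γ).theta_moeb_self (norm_kinfToC F) a h1 hω (Or.inl hz) h3 h

end ThetaU

end Drinfeld

open Drinfeld
theorem theorem5p1 {F : Type*} [Field F] [Finite F]
    (Γ : Subgroup (GL (Fin 2) F[X])) (hΓ : Γ.FiniteIndex)
    (α : GammaBar Γ) (a : Γ) (ha : toBar Γ a = α)
    (ω : Cinf F) (hω : ω ∈ upperHalfPlane F) (s : RatFunc F) :
    Multipliable (fun γ : GammaTilde Γ =>
      (ratToC F s - moebiusQ γ ω) / (ratToC F s - moebiusQ γ (moebius (a : GL (Fin 2) F[X]) ω))) ∧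
    ∀ v : Cinf F, HasCuspValue Γ (thetaU Γ α) s v ↔
      v = ∏' γ : GammaTilde Γ,
        (ratToC F s - moebiusQ γ ω) /
          (ratToC F s - moebiusQ γ (moebius (a : GL (Fin 2) F[X]) ω)) := by
  have hι := norm_kinfToC F
  obtain ⟨hmul, G, hG, hG0, R, hR⟩ := (stdRep Γ).exists_theta_eq_analytic_cusp (cuspRep Γ s)
    (ratToKinf s) (stdRep_mul_cuspMatrix Γ s) hι (exists_cuspRep_translation_near Γ s) hω
    (moeb_mem_halfPlane ((stdRep Γ).toHom a) hω)
  simp_rw [act_stdRep, moeb_stdRep] at hmul hG0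
  -- The auxiliary point in `thetaU` varies with its argument. Near the cusp the fixed `ω` is
  -- outside the orbit of `s + 1/w`, so it can be used throughout.
  have hexp : ∀ w ∈ upperHalfPlane F, R ≤ imagPart w →
      thetaU Γ α (ratToC F s + 1 / w) = G (1 / latticeExp ((cuspRep Γ s).translations.map
        (kinfToC F : Kinf F →+ Cinf F)) w) := by
    intro w hw hRw
    obtain ⟨h1, h2⟩ := hR w hw hRw
    have hz : ratToC F s + 1 / w ∈ upperHalfPlane F := by
      have := moeb_mem_halfPlane (cuspMatrix (ratToKinf s)) hw
      rwa [DiscreteRep.moeb_cuspMatrix _ hw] at this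
    exact (thetaU_eq_theta Γ ha hz hω h1).trans h2
  refine ⟨hmul, fun v => ⟨?_, ?_⟩⟩
  · rintro ⟨G', hG', rfl, R', hR'⟩
    simp_rw [cuspExp_eq_latticeExp] at hR'
    rw [← DiscreteRep.eq_of_analytic_cusp (cuspRep Γ s) hι (denseNorms_kinfToC F)
      (f := fun w => thetaU Γ α (ratToC F s + 1 / w))
      hG.continuousAt hG'.continuousAt hexp hR']
    exact hG0
  · rintro rfl
    refine ⟨G, hG, hG0, R, fun w hw hRw => ?_⟩
    rw [cuspExp_eq_latticeExp]
    exact hexp w hw hRw
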